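/- Let $d,m\in\mathbb{N}$, and let $p_{\mathbf x},p_{\mathbf y}$ be the laws of two zero-mean Gaussian stationary random fields $\mathbf x=\{\mathbf x_{\mathbf t}\}_{\mathbf t\in\mathbb Z^d}$ and $\mathbf y=\{\mathbf y_{\mathbf t}\}_{\mathbf t\in\mathbb Z^d}$ with values in $\mathbb R^m$. Assume that they have power spectral densities $\Phi_{\mathbf x},\Phi_{\mathbf y}$ on $[0,2\pi]^d$, where $$\Phi_{\mathbf x}(\vartheta)=\sum_{\mathbf t\in\mathbb Z^d}\mathbb E[\mathbf x_{\mathbf t}\mathbf x_{0}^T]\,e^{-i\langle\vartheta,\mathbf t\rangle}$$ (convergence in $L^2([0,2\pi]^d)$), and similarly for $\mathbf y$, and that both densities are bounded and coercive: $cI\le\Phi_{\mathbf x},\Phi_{\mathbf y}\le CI$ almost everywhere for some constants $0<c\le C$. Let $\mathbf h=\{H_{\mathbf t}\}_{\mathbf t\in\mathbb Z^d}$ be an absolutely summable sequence of matrices $H_{\mathbf t}\in\mathbb R^{m\times m}$, and put $$(\mathbf h\star\mathbf e)_{\mathbf t}=\sum_{\mathbf s\in\mathbb Z^d}H_{\mathbf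 t-\mathbf s}\,\mathbf e_{\mathbf s},\qquad H(\vartheta)=\sum_{\mathbf t\in\mathbb Z^d}H_{\mathbf t}\,e^{-i\langle\vartheta,\mathbf t\rangle},\qquad \Omega(\vartheta)=H(\vartheta)^*H(\vartheta).$$ Let $\mathcal P$ be the set of laws of zero-mean, jointly Gaussian and jointly stationary random fields $(\mathbf x,\mathbf y)$ whose marginals are $p_{\mathbf x}$ and $p_{\mathbf y}$. Fix any $\mathbf t\in\mathbb Z^d$. For every law in $\mathcal P$ the series $(\mathbf h\star(\mathbf x-\mathbf y))_{\mathbf t}$ converges absolutely almost surely and has finite second moment, and the optimal transport cost $$d_\Omega(p_{\mathbf x},p_{\mathbf y})^2:=\inf_{\mathcal P}\ \mathbb E\big[\|(\mathbf h\star(\mathbf x-\mathbf y))_{\mathbf t}\|^2\big]$$ equals the squared weighted Hellinger distance between $\Phi_{\mathbf x}$ and $\Phi_{\mathbf y}$ with weight $\Omega$: $$d_\Omega(p_{\mathbf x},p_{\mathbf y})^2=\operatorname{tr}\int_{[0,2\pi]^d}\Big(\Omega\Phi_{\mathbf x}+\Omega\Phi_{\mathbf y}-2\big(\Phi_{\mathbf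 y}^{1/2}\,\Omega\,\Phi_{\mathbf x}\,\Omega\,\Phi_{\mathbf y}^{1/2}\big)^{1/2}\Big)\,d\mu,\qquad d\mu(\vartheta)=\frac{d\vartheta}{(2\pi)^d},$$ where the integrand is integrable and the square roots are the positive semidefinite ones. The infimum has the same value when it is restricted to those laws in $\mathcal P$ all of whose finite-dimensional distributions have probability density functions. -/

import Mathlib

open MeasureTheory ProbabilityTheory Filter Topology Matrix
open scoped MatrixOrder ComplexOrder ENNReal

namespace GaussianField

noncomputable section

/-- The index set `ℤ^d` of the random fields. -/
abbrev Site (d : ℕ) : Type := Fin d → ℤ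

/-- The state space `ℝ^m`, with its Euclidean norm. -/
abbrev State (m : ℕ) : Type := EuclideanSpace ℝ (Fin m)

/-- `p`, a law on `E`-valued configurations indexed by `ℤ^d`, is the law of a zero mean Gaussian
stationary random field. -/
structure IsStationaryGaussian {d : ℕ} {E : Type*} [NormedAddCommGroup E] [NormedSpace ℝ E]
    [MeasurableSpace E] [BorelSpace E] (p : Measure (Site d → E)) : Prop where
  /-- The finite dimensional distributions are Gaussian (possibly degenerate). -/
  gaussian : IsGaussianProcess (fun (t : Site d) (x : Site d → E) => x t) p
  /-- The mean is zero. -/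
  zero_mean : ∀ t : Site d, ∫ x, x t ∂p = 0
  /-- The law is invariant under the shifts of `ℤ^d`. -/
  stationary : ∀ s : Site d, p.map (fun x t => x (t + s)) = p

/-- The covariance field `R_t = E[x_t x_0^T] = E[x_{t+s} x_s^T]` of an `ℝ^m`-valued field. -/
def covariance {d m : ℕ} (p : Measure (Site d → State m)) (t : Site d) :
    Matrix (Fin m) (Fin m) ℝ :=
  Matrix.of fun i j => ∫ x, x t i * x 0 j ∂p

/-- The normalized Lebesgue measure `dϑ / (2π)^d` on `[0, 2π]^d`. -/
def torusMeasure (d : ℕ) : Measure (Fin d → ℝ) :=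
  ENNReal.ofReal ((2 * Real.pi) ^ d)⁻¹ •
    volume.restrict (Set.Icc (0 : Fin d → ℝ) (fun _ => 2 * Real.pi))

/-- The character `e^{-j⟨ϑ, t⟩}`. -/
def character {d : ℕ} (t : Site d) (θ : Fin d → ℝ) : ℂ :=
  Complex.exp (-Complex.I * ∑ k, (θ k : ℂ) * (t k : ℂ))

/-- `Φ` is the power spectral density of the random field with law `p`, that is
`Φ(e^{jϑ}) = ∑_t R_t e^{-j⟨ϑ, t⟩}`, where the Fourier series converges in `L²([0, 2π]^d)`. -/
def IsPowerSpectralDensity {d m : ℕ} (p : Measure (Site d → State m))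
    (Φ : (Fin d → ℝ) → Matrix (Fin m) (Fin m) ℂ) : Prop :=
  ∀ i j : Fin m,
    AEStronglyMeasurable (fun θ => Φ θ i j) (torusMeasure d) ∧
    Tendsto
      (fun F : Finset (Site d) =>
        eLpNorm (fun θ => Φ θ i j - ∑ t ∈ F, (covariance p t i j : ℂ) * character t θ) 2
          (torusMeasure d))
      atTop (𝓝 0)

/-- `Φ` is bounded and coercive: `c I ≤ Φ ≤ C I` almost everywhere, with constants `0 < c` and `C`. -/
def IsBoundedCoercive {d m : ℕ} (Φ : (Fin d → ℝ) → Matrix (Fin m) (Fin m) ℂ) : Prop :=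
  ∃ c C : ℝ, 0 < c ∧ ∀ᵐ θ ∂(torusMeasure d),
    (Φ θ - (c : ℂ) • (1 : Matrix (Fin m) (Fin m) ℂ)).PosSemidef ∧
    ((C : ℂ) • (1 : Matrix (Fin m) (Fin m) ℂ) - Φ θ).PosSemidef

/-- `h` belongs to `ℓ₁^{m×m}(ℤ^d)`. -/
def IsL1Filter {d m : ℕ} (h : Site d → Matrix (Fin m) (Fin m) ℝ) : Prop :=
  ∀ i j : Fin m, Summable fun t => |h t i j|

/-- The term `H_{t-s} e_s` of the convolution `(h ⋆ e)_t`. -/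
def filterTerm {d m : ℕ} (h : Site d → Matrix (Fin m) (Fin m) ℝ) (e : Site d → State m)
    (t s : Site d) : State m :=
  WithLp.toLp 2 (h (t - s) *ᵥ (e s).ofLp)

/-- The discrete convolution `(h ⋆ e)_t = ∑_s H_{t-s} e_s`. -/
def filtered {d m : ℕ} (h : Site d → Matrix (Fin m) (Fin m) ℝ) (e : Site d → State m)
    (t : Site d) : State m :=
  ∑' s, filterTerm h e t s

/-- The discrepancy field `x - y` of a configuration of the joint field. -/
def discrepancy {d m : ℕ} (ω : Site d → State m × State m) : Site d → State m :=
  fun t => (ω t).1 - (ω t).2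

/-- `π` is the law of a zero mean, jointly Gaussian and jointly stationary field `(x, y)` such
that `x` has law `p` and `y` has law `q`. -/
structure IsGaussianCoupling {d m : ℕ} (p q : Measure (Site d → State m))
    (π : Measure (Site d → State m × State m)) : Prop where
  joint : IsStationaryGaussian π
  marginal_fst : π.map (fun ω t => (ω t).1) = p
  marginal_snd : π.map (fun ω t => (ω t).2) = q

/-- All finite dimensional distributions of the joint field have probability density functions. -/
def HasFiniteDimDensities {d m : ℕ} (π : Measure (Site d → State m × State m)) : Prop :=
  ∀ S : Finset (Site d), π.map (fun ω (t : S) => ω t) ≪ volume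

/-- The transport cost `E‖(h ⋆ (x - y))_t‖²` of a joint law `π` of `(x, y)`. -/
def transportCost {d m : ℕ} (h : Site d → Matrix (Fin m) (Fin m) ℝ) (t : Site d)
    (π : Measure (Site d → State m × State m)) : ℝ :=
  ∫ ω, ‖filtered h (discrepancy ω) t‖ ^ 2 ∂π

/-- The frequency response `H(e^{jϑ}) = ∑_t H_t e^{-j⟨ϑ, t⟩}`. -/
def frequencyResponse {d m : ℕ} (h : Site d → Matrix (Fin m) (Fin m) ℝ) (θ : Fin d → ℝ) :
    Matrix (Fin m) (Fin m) ℂ :=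
  Matrix.of fun i j => ∑' t, (h t i j : ℂ) * character t θ

/-- The weight function `Ω = H^* H`. -/
def weight {d m : ℕ} (h : Site d → Matrix (Fin m) (Fin m) ℝ) (θ : Fin d → ℝ) :
    Matrix (Fin m) (Fin m) ℂ :=
  (frequencyResponse h θ)ᴴ * frequencyResponse h θ

/-- The matrix `W A + W B - 2 (B^{1/2} W A W B^{1/2})^{1/2}`, for positive semidefinite Hermitian
matrices `W`, `A`, `B`; the square roots are the positive semidefinite ones. -/
def hellingerMatrix {m : ℕ} (W A B : Matrix (Fin m) (Fin m) ℂ) : Matrix (Fin m) (Fin m) ℂ :=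
  W * A + W * B - (2 : ℂ) • CFC.sqrt (CFC.sqrt B * W * A * W * CFC.sqrt B)

/-- The squared weighted Hellinger distance with weight `Ω`: the trace of the (entrywise) integral
`∫ (Ω Φx + Ω Φy - 2 (Φy^{1/2} Ω Φx Ω Φy^{1/2})^{1/2}) dμ`. -/
def weightedHellingerSq {d m : ℕ} (Ω Φx Φy : (Fin d → ℝ) → Matrix (Fin m) (Fin m) ℂ) : ℂ :=
  Matrix.trace (Matrix.of fun i j =>
    ∫ θ, hellingerMatrix (Ω θ) (Φx θ) (Φy θ) i j ∂(torusMeasure d))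

end

end GaussianField

open GaussianField

/-! Stationarity turns the transport problem into a separate matrix problem at each frequency. The
cross-covariances of a coupling are square summable because `Φx` is bounded, so by Riesz–Fischer
they are the Fourier coefficients of an `L²` cross density `M`
(`IsGaussianCoupling.exists_cross_density`). The covariance of the joint field is a positive
semidefinite kernel, which forces the block matrix with diagonal `Φx`, `Φy` and off-diagonal `M`,
`Mᴴ` to be positive semidefinite almost everywhere (`ae_posSemidef_jointDensity`). In these terms
the cost is `∫ tr(ΩΦx) + tr(ΩΦy) - 2 Re tr(ΩM)` (`transportCost_eq`), so what remains is to maximise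
`Re tr(ΩM)` at each `θ`.

Put `Q = Φy^{1/2}` and `R = (Q Ω Φx Ω Q)^{1/2}`. The maximum of the matrix problem is bounded by `tr
R` (`re_trace_mul_le_re_trace_sqrt`), which gives the lower bound on the cost of every coupling.
Since `Ω` may be singular, `R` need not be invertible; replacing it by `T = R + η` gives the
admissible block `N = Φx Ω Q T⁻¹ Q`, for which `Re tr(ΩN)` falls short of `tr R` by at most `η m`.

For the converse, `N` is shrunk to `(1 - η) N`. By coercivity of `Φx` and `Φy` the joint density is
then bounded below by a positive multiple of the identity, so the covariance kernel is strictly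
positive definite. Gram–Schmidt writes such a kernel as a Gram matrix with finite rows, and these
rows, applied to white noise, define a Gaussian field (`exists_isStationaryGaussian`). Strictness
makes its finite-dimensional laws absolutely continuous, and centred Gaussian laws are determined by
their covariances, which gives stationarity and the marginals. The near-optimal couplings therefore
all have densities, and both infima agree.

The fields and the filter are real while the densities are complex. No symmetry of `M` under `θ ↦
-θ` is needed: only real parts of Fourier coefficients enter, both in the kernel and in the cost. -/

namespace GaussianField

/-! ### The pointwise matrix problem: maximising `Re tr(WM)` over positive semidefinite blocks. -/

section MatrixInequalities

variable {n : Type*} [Fintype n] [DecidableEq n]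

/-- By cyclicity the trace equals that of the congruence `B^{1/2} A B^{1/2}`. -/
lemma trace_mul_nonneg_of_posSemidef {A B : Matrix n n ℂ} (hA : A.PosSemidef)
    (hB : B.PosSemidef) : 0 ≤ (A * B).trace := by
  have hs : 0 ≤ CFC.sqrt B := CFC.sqrt_nonneg B
  have hsH : (CFC.sqrt B)ᴴ = CFC.sqrt B := hs.posSemidef.1
  have h1 : CFC.sqrt B * CFC.sqrt B = B := CFC.sqrt_mul_sqrt_self B hB.nonneg
  have h2 : (A * B).trace = (CFC.sqrt B * A * (CFC.sqrt B)ᴴ).trace := by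
    rw [hsH, Matrix.trace_mul_cycle, h1, trace_mul_comm]
  rw [h2]
  exact (hA.mul_mul_conjTranspose_same _).trace_nonneg

lemma posSemidef_sqrt (A : Matrix n n ℂ) : (CFC.sqrt A).PosSemidef :=
  (CFC.sqrt_nonneg A).posSemidef

lemma sqrt_mul_sqrt_of_posSemidef {A : Matrix n n ℂ} (hA : A.PosSemidef) :
    CFC.sqrt A * CFC.sqrt A = A := CFC.sqrt_mul_sqrt_self A hA.nonneg

lemma isUnit_det_sqrt {A : Matrix n n ℂ} (hA : A.PosDef) : IsUnit (CFC.sqrt A).det := by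
  have h := congrArg Matrix.det (sqrt_mul_sqrt_of_posSemidef hA.posSemidef)
  rw [det_mul] at h
  refine isUnit_iff_ne_zero.2 fun h0 => hA.det_pos.ne' ?_
  rw [← h, h0, zero_mul]

lemma posSemidef_sandwich {n : Type*} [Fintype n] {W A Q : Matrix n n ℂ} (hA : A.PosSemidef)
    (hW : W.IsHermitian) (hQ : Q.IsHermitian) : (Q * W * A * W * Q).PosSemidef := by
  have h := hA.mul_mul_conjTranspose_same (Q * W)
  rw [conjTranspose_mul, hQ.eq, hW.eq] at h
  simpa only [mul_assoc] using h

lemma posDef_add_smul_one {n : Type*} [DecidableEq n] {R : Matrix n n ℂ} (hR : R.PosSemidef)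
    {η : ℝ} (hη : 0 < η) :
    (R + (η : ℂ) • (1 : Matrix n n ℂ)).PosDef :=
  Matrix.PosDef.posSemidef_add hR (Matrix.PosDef.one.smul (by exact_mod_cast hη))

/-- The trace of `W * M`, for the off-diagonal block `M` of a positive semidefinite matrix with
diagonal blocks `A` and `B`, is at most the trace of `(B^{1/2} W A W B^{1/2})^{1/2}`. -/
lemma re_trace_mul_le_re_trace_sqrt {W A B M : Matrix n n ℂ} (hW : W.IsHermitian)
    (hB : B.PosDef) (hP : (fromBlocks A M Mᴴ B).PosSemidef) :
    (W * M).trace.re ≤ (CFC.sqrt (CFC.sqrt B * W * A * W * CFC.sqrt B)).trace.re := by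
  have hA : A.PosSemidef := by
    have := hP.submatrix (Sum.inl : n → n ⊕ n)
    convert! this
  set Q := CFC.sqrt B with hQdef
  have hQ : Q.IsHermitian := (posSemidef_sqrt B).1
  have hQQ : Q * Q = B := sqrt_mul_sqrt_of_posSemidef hB.posSemidef
  have hQu : IsUnit Q.det := isUnit_det_sqrt hB
  set S := Q * W * A * W * Q with hS
  have hSp : S.PosSemidef := posSemidef_sandwich hA hW hQ
  set R := CFC.sqrt S with hR
  have hRp : R.PosSemidef := posSemidef_sqrt S
  have hRR : R * R = S := sqrt_mul_sqrt_of_posSemidef hSp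
  -- Pair the compression `L P Lᴴ`, where `L = [QW, -TQ⁻¹]` and `T = R + η`, with `T⁻¹`. This gives
  -- `0 ≤ tr(S T⁻¹) - 2 Re tr(WM) + tr T`. Moreover `S T⁻¹ = R - η R T⁻¹` has trace at most `tr R`,
  -- and `tr T = tr R + η n`. The shift by `η` only serves to make `T` invertible, and is removed by
  -- `η → 0`.
  have key : ∀ η : ℝ, 0 < η →
      2 * (W * M).trace.re ≤ 2 * R.trace.re + η * Fintype.card n := by
    intro η hη
    set T := R + (η : ℂ) • (1 : Matrix n n ℂ) with hT
    have hTp : T.PosDef := posDef_add_smul_one hRp hη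
    have hTu : IsUnit T.det := isUnit_iff_ne_zero.2 hTp.det_pos.ne'
    have hTi : T⁻¹.PosSemidef := hTp.inv.posSemidef
    have hRT : R = T - (η : ℂ) • 1 := by rw [hT]; simp
    -- the compressed block matrix
    set Lm : Matrix n (n ⊕ n) ℂ := fromCols (Q * W) (-(T * Q⁻¹)) with hL
    have hQi : (Q⁻¹)ᴴ = Q⁻¹ := by rw [conjTranspose_nonsing_inv, hQ.eq]
    have hLP : Lm * fromBlocks A M Mᴴ B * Lmᴴ =
        S - Q * W * M * Q⁻¹ * T - T * Q⁻¹ * Mᴴ * W * Q + T * T := by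
      have e1 : Lmᴴ = fromRows (W * Q) (-(Q⁻¹ * T)) := by
        rw [hL, conjTranspose_fromCols_eq_fromRows_conjTranspose]
        simp [conjTranspose_mul, hQ.eq, hW.eq, hTp.1.eq, hQi]
      have e2 : T * Q⁻¹ * B * Q⁻¹ * T = T * T := by
        rw [← hQQ]
        simp only [mul_assoc]
        rw [mul_nonsing_inv_cancel_left _ _ hQu, nonsing_inv_mul_cancel_left _ _ hQu]
      rw [e1, hL, fromCols_mul_fromBlocks, fromCols_mul_fromRows, ← e2, hS]
      simp only [mul_assoc, Matrix.add_mul, neg_mul, mul_neg]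
      abel
    have h0 : 0 ≤ (Lm * fromBlocks A M Mᴴ B * Lmᴴ * T⁻¹).trace :=
      trace_mul_nonneg_of_posSemidef (hP.mul_mul_conjTranspose_same _) hTi
    have hRTi : 0 ≤ (R * T⁻¹).trace := trace_mul_nonneg_of_posSemidef hRp hTi
    have hST : (S * T⁻¹) = R - (η : ℂ) • (R * T⁻¹) := by
      have : R * R = R * T - (η : ℂ) • R := by
        nth_rewrite 2 [hRT]
        rw [Matrix.mul_sub, mul_smul_comm, mul_one]
      rw [← hRR, this, Matrix.sub_mul, mul_nonsing_inv_cancel_right _ _ hTu, smul_mul_assoc]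
    have t1 : (Q * W * M * Q⁻¹ * T * T⁻¹).trace = (W * M).trace := by
      rw [mul_nonsing_inv_cancel_right _ _ hTu, trace_mul_comm]
      simp only [← mul_assoc, nonsing_inv_mul _ hQu, one_mul]
    have t2 : (T * Q⁻¹ * Mᴴ * W * Q * T⁻¹).trace = star (W * M).trace := by
      rw [trace_mul_comm]
      simp only [← mul_assoc, nonsing_inv_mul _ hTu, one_mul]
      rw [trace_mul_comm, ← trace_conjTranspose, conjTranspose_mul, hW.eq]
      simp only [← mul_assoc, mul_nonsing_inv _ hQu, one_mul]
    have t3 : (T * T * T⁻¹).trace = R.trace + η * Fintype.card n := by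
      rw [mul_nonsing_inv_cancel_right _ _ hTu, hT, trace_add, trace_smul, trace_one, smul_eq_mul]
    rw [hLP, Matrix.add_mul, Matrix.sub_mul, Matrix.sub_mul, trace_add, trace_sub, trace_sub, t1,
      t2,
      t3, hST, trace_sub, trace_smul] at h0
    have h1 := (Complex.le_def.1 h0).1
    have h2 := (Complex.le_def.1 hRTi).1
    simp at h1 h2
    nlinarith [mul_nonneg hη.le h2]
  have lim : Tendsto (fun η : ℝ => 2 * R.trace.re + η * Fintype.card n) (𝓝[>] 0)
      (𝓝 (2 * R.trace.re + 0 * Fintype.card n)) :=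
    ((continuous_const.add (continuous_id.mul continuous_const)).tendsto 0).mono_left
      nhdsWithin_le_nhds
  have := ge_of_tendsto lim (eventually_nhdsWithin_of_forall fun η hη => key η hη)
  linarith

/-- A nearly optimal off-diagonal block for `re_trace_mul_le_re_trace_sqrt`. -/
noncomputable def nearOptimalBlock (η : ℝ) (W A B : Matrix n n ℂ) : Matrix n n ℂ :=
  A * W * CFC.sqrt B *
    (CFC.sqrt (CFC.sqrt B * W * A * W * CFC.sqrt B) + (η : ℂ) • (1 : Matrix n n ℂ))⁻¹ * CFC.sqrt B

/-- The Schur complement of `A` is `Q T⁻¹ (T² - R²) T⁻¹ Q`, and `T² - R² = 2ηR + η²` is positive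
semidefinite. -/
lemma posSemidef_fromBlocks_nearOptimalBlock {W A B : Matrix n n ℂ} (hW : W.IsHermitian)
    (hA : A.PosDef) (hB : B.PosSemidef) {η : ℝ} (hη : 0 < η) :
    (fromBlocks A (nearOptimalBlock η W A B) (nearOptimalBlock η W A B)ᴴ B).PosSemidef := by
  unfold nearOptimalBlock
  set Q := CFC.sqrt B with hQdef
  have hQ : Q.IsHermitian := (posSemidef_sqrt B).1
  have hQQ : Q * Q = B := sqrt_mul_sqrt_of_posSemidef hB
  set S := Q * W * A * W * Q with hS
  have hSp : S.PosSemidef := posSemidef_sandwich hA.posSemidef hW hQ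
  set R := CFC.sqrt S with hR
  have hRp : R.PosSemidef := posSemidef_sqrt S
  have hRR : R * R = S := sqrt_mul_sqrt_of_posSemidef hSp
  set T := R + (η : ℂ) • (1 : Matrix n n ℂ) with hT
  have hTp : T.PosDef := posDef_add_smul_one hRp hη
  have hTu : IsUnit T.det := isUnit_iff_ne_zero.2 hTp.det_pos.ne'
  have hAu : IsUnit A.det := isUnit_iff_ne_zero.2 hA.det_pos.ne'
  have hTi : (T⁻¹)ᴴ = T⁻¹ := hTp.inv.1
  let _ := invertibleOfIsUnitDet A hAu
  rw [Matrix.PosDef.fromBlocks₁₁ _ _ hA]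
  have e : B - (A * W * Q * T⁻¹ * Q)ᴴ * A⁻¹ * (A * W * Q * T⁻¹ * Q) =
      (Q * T⁻¹) * (T * T - R * R) * (Q * T⁻¹)ᴴ := by
    have e1 : (A * W * Q * T⁻¹ * Q)ᴴ = Q * T⁻¹ * Q * W * A := by
      simp only [conjTranspose_mul, hTi, hQ.eq, hW.eq, hA.1.eq, mul_assoc]
    have e2 : (Q * T⁻¹)ᴴ = T⁻¹ * Q := by rw [conjTranspose_mul, hTi, hQ.eq]
    rw [e1, e2, Matrix.mul_sub, Matrix.sub_mul, hRR, hS]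
    congr 1
    · rw [← hQQ]
      simp only [mul_assoc, nonsing_inv_mul_cancel_left _ _ hTu,
        mul_nonsing_inv_cancel_left _ _ hTu]
    · simp only [mul_assoc, nonsing_inv_mul_cancel_left _ _ hAu]
  rw [e]
  refine Matrix.PosSemidef.mul_mul_conjTranspose_same ?_ _
  have : T * T - R * R = ((2 * η : ℝ) : ℂ) • R + ((η ^ 2 : ℝ) : ℂ) • 1 := by
    rw [hT]
    simp only [Matrix.add_mul, Matrix.mul_add, smul_mul_assoc, mul_smul_comm, one_mul, mul_one]
    push_cast
    module
  rw [this]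
  refine Matrix.PosSemidef.add (hRp.smul ?_) (Matrix.PosSemidef.one.smul ?_)
  · exact_mod_cast (by positivity : 0 ≤ 2 * η)
  · exact_mod_cast (by positivity : 0 ≤ η ^ 2)

/-- Cyclicity turns the right-hand trace into `tr(R² T⁻¹)`, and `R² T⁻¹ = R - η + η² T⁻¹`, whose
last term has nonnegative trace. -/
lemma re_trace_sqrt_sub_le_re_trace_nearOptimalBlock {W A B : Matrix n n ℂ} (hW : W.IsHermitian)
    (hA : A.PosSemidef) {η : ℝ} (hη : 0 < η) :
    (CFC.sqrt (CFC.sqrt B * W * A * W * CFC.sqrt B)).trace.re - η * Fintype.card n ≤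
      (W * nearOptimalBlock η W A B).trace.re := by
  unfold nearOptimalBlock
  set Q := CFC.sqrt B with hQdef
  have hQ : Q.IsHermitian := (posSemidef_sqrt B).1
  set S := Q * W * A * W * Q with hS
  have hSp : S.PosSemidef := posSemidef_sandwich hA hW hQ
  set R := CFC.sqrt S with hR
  have hRp : R.PosSemidef := posSemidef_sqrt S
  have hRR : R * R = S := sqrt_mul_sqrt_of_posSemidef hSp
  set T := R + (η : ℂ) • (1 : Matrix n n ℂ) with hT
  have hTp : T.PosDef := posDef_add_smul_one hRp hη
  have hTu : IsUnit T.det := isUnit_iff_ne_zero.2 hTp.det_pos.ne'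
  have hRT : R = T - (η : ℂ) • 1 := by rw [hT]; simp
  have e1 : (W * (A * W * Q * T⁻¹ * Q)).trace = (S * T⁻¹).trace := by
    rw [hS, ← mul_assoc, trace_mul_comm]
    simp only [mul_assoc]
  have e2 : S * T⁻¹ = R - (η : ℂ) • 1 + ((η ^ 2 : ℝ) : ℂ) • T⁻¹ := by
    have : R * R = R * T - (η : ℂ) • T + ((η ^ 2 : ℝ) : ℂ) • 1 := by
      nth_rewrite 2 [hRT]
      rw [Matrix.mul_sub, hT]
      simp only [mul_smul_comm, mul_one, Matrix.mul_add]
      push_cast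
      module
    rw [← hRR, this, Matrix.add_mul, Matrix.sub_mul, mul_nonsing_inv_cancel_right _ _ hTu,
      smul_mul_assoc, mul_nonsing_inv _ hTu, smul_mul_assoc, one_mul]
  have h3 : 0 ≤ T⁻¹.trace := hTp.inv.posSemidef.trace_nonneg
  have h4 := (Complex.le_def.1 h3).1
  rw [e1, e2, trace_add, trace_sub, trace_smul, trace_smul, trace_one]
  simp only [Complex.add_re, Complex.sub_re, smul_eq_mul, Complex.re_ofReal_mul, Complex.zero_re,
    Complex.natCast_re] at h4 ⊢
  nlinarith [mul_nonneg (sq_nonneg η) h4]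

lemma norm_sq_apply_le_re_mul_conjTranspose {n : Type*} [Fintype n] (X : Matrix n n ℂ) (i j : n) :
    ‖X i j‖ ^ 2 ≤ ((X * Xᴴ) i i).re := by
  have : ((X * Xᴴ) i i).re = ∑ k, ‖X i k‖ ^ 2 := by
    rw [mul_apply, Complex.re_sum]
    refine Finset.sum_congr rfl fun k _ => ?_
    rw [conjTranspose_apply, Complex.star_def, Complex.mul_conj, Complex.normSq_eq_norm_sq,
      Complex.ofReal_re]
  rw [this]
  exact Finset.single_le_sum (f := fun k => ‖X i k‖ ^ 2) (fun k _ => by positivity)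
    (Finset.mem_univ j)

/-- With `A = Q²`, the entry is an inner product of two rows of `Q`, so it is at most the mean of
two diagonal entries of `A`. This converts trace bounds into entrywise `L^∞` bounds. -/
lemma norm_apply_le_re_trace {A : Matrix n n ℂ} (hA : A.PosSemidef) (i j : n) :
    ‖A i j‖ ≤ A.trace.re := by
  obtain hQQ := sqrt_mul_sqrt_of_posSemidef hA
  set Q := CFC.sqrt A with hQdef
  have hQ : Qᴴ = Q := (posSemidef_sqrt A).1
  have hd : ∀ k, 0 ≤ (A k k).re := fun k => (Complex.le_def.1 (hA.diag_nonneg (i := k))).1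
  have e : ∀ i, ∑ k, ‖Q i k‖ ^ 2 = (A i i).re := fun i => by
    have h1 : A i i = (Q * Qᴴ) i i := by rw [hQ, hQQ]
    rw [h1, mul_apply, Complex.re_sum]
    refine Finset.sum_congr rfl fun k _ => ?_
    rw [conjTranspose_apply, Complex.star_def, Complex.mul_conj, Complex.normSq_eq_norm_sq,
      Complex.ofReal_re]
  have hle : ∀ k, (A k k).re ≤ A.trace.re := fun k => by
    rw [trace, Complex.re_sum]
    exact Finset.single_le_sum (f := fun k => (A k k).re) (fun k _ => hd k) (Finset.mem_univ k)
  calc ‖A i j‖ = ‖∑ k, Q i k * Q k j‖ := by rw [← mul_apply, hQQ]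
    _ ≤ ∑ k, ‖Q i k * Q k j‖ := norm_sum_le _ _
    _ ≤ ∑ k, (‖Q i k‖ ^ 2 + ‖Q j k‖ ^ 2) / 2 := by
        refine Finset.sum_le_sum fun k _ => ?_
        have : ‖Q k j‖ = ‖Q j k‖ := by
          rw [← hQ, conjTranspose_apply, norm_star, hQ]
        rw [norm_mul, this]
        nlinarith [sq_nonneg (‖Q i k‖ - ‖Q j k‖)]
    _ = ((A i i).re + (A j j).re) / 2 := by
        rw [← Finset.sum_div, Finset.sum_add_distrib, e, e]
    _ ≤ A.trace.re := by linarith [hle i, hle j]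

end MatrixInequalities

/-! ### Characters of the torus: orthonormality and Riesz–Fischer. -/

section Torus

variable {d : ℕ}

lemma character_apply (k : Site d) (θ : Fin d → ℝ) :
    character k θ = Complex.exp (((-∑ i, θ i * k i : ℝ) : ℂ) * Complex.I) := by
  unfold character
  congr 1
  push_cast
  ring

lemma norm_character (k : Site d) (θ : Fin d → ℝ) : ‖character k θ‖ = 1 := by
  rw [character_apply, Complex.norm_exp_ofReal_mul_I]

lemma character_add (k l : Site d) (θ : Fin d → ℝ) :
    character (k + l) θ = character k θ * character l θ := by
  rw [character, character, character, ← Complex.exp_add]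
  congr 1
  rw [← mul_add, ← Finset.sum_add_distrib]
  congr 1
  refine Finset.sum_congr rfl fun i _ => ?_
  simp
  ring

lemma conj_character (k : Site d) (θ : Fin d → ℝ) :
    (starRingEnd ℂ) (character k θ) = character (-k) θ := by
  rw [character_apply, character_apply, ← Complex.exp_conj]
  congr 1
  simp

lemma character_zero (θ : Fin d → ℝ) : character 0 θ = 1 := by
  simp [character]

lemma continuous_character (k : Site d) : Continuous (character k) := by
  unfold character
  fun_prop

lemma torusMeasure_eq_pi (d : ℕ) : torusMeasure d =
    ENNReal.ofReal ((2 * Real.pi) ^ d)⁻¹ •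
      Measure.pi (fun _ : Fin d => (volume : Measure ℝ).restrict (Set.Icc 0 (2 * Real.pi))) := by
  unfold torusMeasure
  congr 1
  rw [← Measure.restrict_pi_pi, Set.pi_univ_Icc]
  rfl

lemma integral_exp_int_mul (k : ℤ) :
    ∫ x in Set.Icc 0 (2 * Real.pi), Complex.exp (-Complex.I * ((x : ℂ) * (k : ℂ))) =
      if k = 0 then (2 * Real.pi : ℂ) else 0 := by
  rw [integral_Icc_eq_integral_Ioc, ← intervalIntegral.integral_of_le Real.two_pi_pos.le]
  split_ifs with h
  · simp [h]
  · have hc : (-Complex.I * k : ℂ) ≠ 0 := by simp [h]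
    have e : ∀ x : ℝ, Complex.exp (-Complex.I * ((x : ℂ) * (k : ℂ))) =
        Complex.exp ((-Complex.I * k) * x) := fun x => by congr 1; ring
    simp_rw [e]
    rw [integral_exp_mul_complex hc]
    have : (-Complex.I * k * ((2 * Real.pi : ℝ) : ℂ)) =
        ((-k : ℤ) : ℂ) * (2 * Real.pi * Complex.I) := by
      push_cast; ring
    rw [this, Complex.exp_int_mul_two_pi_mul_I]
    simp

lemma integral_character (k : Site d) :
    ∫ θ, character k θ ∂(torusMeasure d) = if k = 0 then 1 else 0 := by
  have e : ∀ θ : Fin d → ℝ, character k θ =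
      ∏ i, Complex.exp (-Complex.I * ((θ i : ℂ) * (k i : ℂ))) := fun θ => by
    rw [← Complex.exp_sum, ← Finset.mul_sum]; rfl
  simp_rw [e]
  rw [torusMeasure_eq_pi, integral_smul_measure,
    integral_fintype_prod_eq_prod
      (fun i (x : ℝ) => Complex.exp (-Complex.I * ((x : ℂ) * (k i : ℂ))))]
  simp_rw [integral_exp_int_mul]
  have hp : (0 : ℝ) < (2 * Real.pi) ^ d := by positivity
  rw [ENNReal.toReal_ofReal (by positivity)]
  split_ifs with h
  · subst h
    have : (2 * Real.pi : ℂ) ≠ 0 := by exact_mod_cast Real.two_pi_pos.ne'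
    simp only [Pi.zero_apply, if_true, Finset.prod_const, Finset.card_univ, Fintype.card_fin,
      Complex.real_smul]
    push_cast
    exact inv_mul_cancel₀ (pow_ne_zero _ this)
  · obtain ⟨i, hi⟩ := Function.ne_iff.1 h
    rw [Finset.prod_eq_zero (Finset.mem_univ i), smul_zero]
    exact if_neg hi

instance isProbabilityMeasure_torusMeasure (d : ℕ) : IsProbabilityMeasure (torusMeasure d) := by
  constructor
  rw [torusMeasure_eq_pi, Measure.smul_apply, Measure.pi_univ]
  simp only [Measure.restrict_apply_univ, Real.volume_Icc, sub_zero, Finset.prod_const,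
    Finset.card_univ, Fintype.card_fin, smul_eq_mul]
  rw [← ENNReal.ofReal_pow Real.two_pi_pos.le, ← ENNReal.ofReal_mul (by positivity),
    inv_mul_cancel₀ (by positivity), ENNReal.ofReal_one]

lemma memLp_character (k : Site d) (p : ℝ≥0∞) : MemLp (character k) p (torusMeasure d) :=
  MemLp.of_bound (continuous_character k).aestronglyMeasurable 1
    (ae_of_all _ fun θ => (norm_character k θ).le)

/-- **Riesz–Fischer**: every square summable family is the family of Fourier coefficients of a
square integrable function. -/
lemma exists_memLp_integral_mul_character_eq (c : Site d → ℂ) (hc : Summable fun k => ‖c k‖ ^ 2) :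
    ∃ M : (Fin d → ℝ) → ℂ, MemLp M 2 (torusMeasure d) ∧
      ∀ k, ∫ θ, M θ * character (-k) θ ∂(torusMeasure d) = c k := by
  let e : Site d → Lp ℂ 2 (torusMeasure d) := fun k => (memLp_character k 2).toLp
  have hin : ∀ (k : Site d) (f : Lp ℂ 2 (torusMeasure d)),
      inner ℂ (e k) f = ∫ θ, f θ * character (-k) θ ∂(torusMeasure d) := by
    intro k f
    rw [L2.inner_def]
    refine integral_congr_ae ?_
    filter_upwards [(memLp_character k 2).coeFn_toLp] with θ hθ
    rw [hθ, ← conj_character, RCLike.inner_apply]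
  have ho : Orthonormal ℂ e := by
    rw [orthonormal_iff_ite]
    intro k l
    rw [hin]
    have : ∫ θ, e l θ * character (-k) θ ∂(torusMeasure d) =
        ∫ θ, character (l - k) θ ∂(torusMeasure d) := by
      refine integral_congr_ae ?_
      filter_upwards [(memLp_character l 2).coeFn_toLp] with θ hθ
      rw [hθ, sub_eq_add_neg, character_add]
    rw [this, integral_character]
    simp only [sub_eq_zero, eq_comm]
  have hs : Summable fun k => c k • e k := by
    have := (ho.orthogonalFamily.summable_iff_norm_sq_summable c).2 hc
    simpa using this
  refine ⟨(∑' k, c k • e k : Lp ℂ 2 (torusMeasure d)), Lp.memLp _, fun k => ?_⟩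
  rw [← hin]
  have h1 := (innerSL ℂ (e k)).map_tsum hs
  simp only [innerSL_apply_apply] at h1
  rw [h1, tsum_eq_single k]
  · rw [inner_smul_right, (orthonormal_iff_ite.1 ho), if_pos rfl, mul_one]
  · intro l hl
    rw [inner_smul_right, (orthonormal_iff_ite.1 ho), if_neg hl.symm, mul_zero]

end Torus

/-! ### Nonnegativity of a function tested against squared trigonometric polynomials. -/

section Positivity

variable {d : ℕ}

/-- The projection `θ ↦ θ / 2π` of `ℝ^d` onto the torus `(ℝ / ℤ)^d`. -/
noncomputable def torusProj (d : ℕ) (θ : Fin d → ℝ) : UnitAddTorus (Fin d) :=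
  fun i => ((θ i / (2 * Real.pi) : ℝ) : UnitAddCircle)

lemma continuous_torusProj (d : ℕ) : Continuous (torusProj d) :=
  continuous_pi fun i => (AddCircle.continuous_mk' (1 : ℝ)).comp (by fun_prop)

lemma mFourier_torusProj (k : Site d) (θ : Fin d → ℝ) :
    UnitAddTorus.mFourier k (torusProj d θ) = character (-k) θ := by
  unfold torusProj
  simp only [UnitAddTorus.mFourier, ContinuousMap.coe_mk, fourier_coe_apply, character]
  rw [← Complex.exp_sum, Finset.mul_sum]
  congr 1
  refine Finset.sum_congr rfl fun i _ => ?_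
  have : (Real.pi : ℂ) ≠ 0 := by exact_mod_cast Real.pi_ne_zero
  simp
  field_simp

/-- The box is half-open because `0` and `2π` have the same image; the faces left out are null for
`torusMeasure` by `ae_mem_Ico_torusMeasure`. -/
lemma injOn_torusProj (d : ℕ) :
    Set.InjOn (torusProj d) (Set.univ.pi fun _ => Set.Ico 0 (2 * Real.pi)) := by
  intro x hx y hy hxy
  funext i
  have h1 := congrFun hxy i
  have hm : ∀ z ∈ Set.univ.pi (fun _ : Fin d => Set.Ico 0 (2 * Real.pi)),
      z i / (2 * Real.pi) ∈ Set.Ico (0 : ℝ) (0 + 1) := by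
    intro z hz
    have := hz i (Set.mem_univ i)
    rw [zero_add]
    exact ⟨div_nonneg this.1 Real.two_pi_pos.le, (div_lt_one Real.two_pi_pos).2 this.2⟩
  have h2 := (AddCircle.coe_eq_coe_iff_of_mem_Ico (p := (1 : ℝ)) (hm x hx) (hm y hy)).1 h1
  have := Real.two_pi_pos.ne'
  field_simp at h2
  exact h2

lemma ae_mem_Ico_torusMeasure (d : ℕ) :
    ∀ᵐ θ ∂(torusMeasure d), θ ∈ Set.univ.pi fun _ : Fin d => Set.Ico 0 (2 * Real.pi) := by
  unfold torusMeasure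
  refine Measure.ae_smul_measure ?_ _
  have h1 := Measure.univ_pi_Ico_ae_eq_Icc (μ := fun _ : Fin d => (volume : Measure ℝ))
    (f := fun _ => 0) (g := fun _ => 2 * Real.pi)
  have h2 : ∀ᵐ θ ∂(volume : Measure (Fin d → ℝ)),
      (θ ∈ Set.Icc (0 : Fin d → ℝ) (fun _ => 2 * Real.pi)) →
      θ ∈ Set.univ.pi fun _ : Fin d => Set.Ico 0 (2 * Real.pi) := by
    filter_upwards [h1] with θ hθ hmem
    have : (Set.univ.pi fun _ : Fin d => Set.Ico 0 (2 * Real.pi)) θ =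
      Set.Icc (0 : Fin d → ℝ) (fun _ => 2 * Real.pi) θ := hθ
    exact this.mpr hmem
  rw [ae_restrict_iff' measurableSet_Icc]
  exact h2

/-- Since `ψ = |√ψ|²` and `√ψ` is a uniform limit of trigonometric polynomials, the integral is a
limit of integrals that are nonnegative by hypothesis. -/
lemma integral_continuous_mul_nonneg {f : (Fin d → ℝ) → ℝ}
    (hf : Integrable f (torusMeasure d))
    (hpos : ∀ (F : Finset (Site d)) (c : Site d → ℂ),
      0 ≤ ∫ θ, ‖∑ k ∈ F, c k * character k θ‖ ^ 2 * f θ ∂(torusMeasure d))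
    (ψ : C(UnitAddTorus (Fin d), ℝ)) (hψ : ∀ x, 0 ≤ ψ x) :
    0 ≤ ∫ θ, ψ (torusProj d θ) * f θ ∂(torusMeasure d) := by
  -- approximate the square root of `ψ` by trigonometric polynomials
  let g : C(UnitAddTorus (Fin d), ℂ) :=
    ⟨fun x => ((Real.sqrt (ψ x) : ℝ) : ℂ), by fun_prop⟩
  have hg : g ∈ (Submodule.span ℂ (Set.range
      (UnitAddTorus.mFourier (d := Fin d)))).topologicalClosure := by
    rw [UnitAddTorus.span_mFourier_closure_eq_top]; trivial
  obtain ⟨p, hp, hlim⟩ := mem_closure_iff_seq_limit.1 hg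
  have hnn : ∀ n, 0 ≤ ∫ θ, ‖p n (torusProj d θ)‖ ^ 2 * f θ ∂(torusMeasure d) := by
    intro n
    obtain ⟨c, hc⟩ := Finsupp.mem_span_range_iff_exists_finsupp.1 (hp n)
    have e : ∀ θ, p n (torusProj d θ) =
        ∑ k ∈ c.support.image (fun k => -k), c (-k) * character k θ := by
      intro θ
      rw [Finset.sum_image (fun a _ b _ h => neg_injective h), ← hc, Finsupp.sum,
        ContinuousMap.sum_apply]
      refine Finset.sum_congr rfl fun k _ => ?_
      rw [ContinuousMap.smul_apply, mFourier_torusProj, neg_neg, smul_eq_mul]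
    simp_rw [e]
    exact hpos _ _
  have hb : ∃ K, ∀ n, ‖p n‖ ≤ K := by
    obtain ⟨K, hK⟩ := (Metric.isBounded_range_of_tendsto _ hlim).exists_norm_le
    exact ⟨K, fun n => hK _ ⟨n, rfl⟩⟩
  obtain ⟨K, hK⟩ := hb
  have hcont : ∀ n, Continuous fun θ => ‖p n (torusProj d θ)‖ ^ 2 := fun n =>
    (((p n).continuous.comp (continuous_torusProj d)).norm.pow 2)
  have hT : Tendsto (fun n => ∫ θ, ‖p n (torusProj d θ)‖ ^ 2 * f θ ∂(torusMeasure d)) atTop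
      (𝓝 (∫ θ, ψ (torusProj d θ) * f θ ∂(torusMeasure d))) := by
    refine tendsto_integral_of_dominated_convergence (fun θ => K ^ 2 * ‖f θ‖) (fun n => ?_)
      (hf.norm.const_mul _) (fun n => ae_of_all _ fun θ => ?_) (ae_of_all _ fun θ => ?_)
    · exact (hcont n).aestronglyMeasurable.mul hf.1
    · rw [norm_mul, norm_pow, norm_norm]
      gcongr
      exact ((p n).norm_coe_le_norm _).trans (hK n)
    · refine Tendsto.mul_const _ ?_
      have h1 : Tendsto (fun n => p n (torusProj d θ)) atTop (𝓝 (g (torusProj d θ))) :=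
        ((continuous_eval_const (F := C(UnitAddTorus (Fin d), ℂ)) (torusProj d θ)).tendsto
          g).comp hlim
      have h2 := (h1.norm).pow 2
      have h3 : ‖g (torusProj d θ)‖ ^ 2 = ψ (torusProj d θ) := by
        simp only [g, ContinuousMap.coe_mk, Complex.norm_real, Real.norm_eq_abs, sq_abs]
        exact Real.sq_sqrt (hψ _)
      rwa [h3] at h2
  exact ge_of_tendsto' hT hnn

/-- A square integrable function whose products with squared moduli of trigonometric polynomials
have nonnegative integrals is nonnegative. -/
lemma ae_nonneg_of_integral_trigPoly_mul_nonneg {f : (Fin d → ℝ) → ℝ}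
    (hf : MemLp f 2 (torusMeasure d))
    (hpos : ∀ (F : Finset (Site d)) (c : Site d → ℂ),
      0 ≤ ∫ θ, ‖∑ k ∈ F, c k * character k θ‖ ^ 2 * f θ ∂(torusMeasure d)) :
    0 ≤ᵐ[torusMeasure d] f := by
  have hfi : Integrable f (torusMeasure d) := hf.integrable (by norm_num)
  refine ae_nonneg_of_forall_setIntegral_nonneg hfi fun s hs _ => ?_
  set box : Set (Fin d → ℝ) := Set.univ.pi fun _ => Set.Ico 0 (2 * Real.pi) with hbox
  have hboxm : MeasurableSet box := MeasurableSet.univ_pi fun _ => measurableSet_Ico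
  -- Transporting `s` to the torus allows its indicator to be approximated by functions continuous
  -- there, that is, by periodic ones. Injectivity on the box makes the image measurable and the
  -- indicators agree almost everywhere.
  set B : Set (UnitAddTorus (Fin d)) := torusProj d '' (s ∩ box) with hB
  have hBm : MeasurableSet B :=
    (hs.inter hboxm).image_of_measurable_injOn (continuous_torusProj d).measurable
      ((injOn_torusProj d).mono Set.inter_subset_right)
  set ν := (torusMeasure d).map (torusProj d) with hν
  have hmeas := (continuous_torusProj d).measurable
  have : IsProbabilityMeasure ν := Measure.isProbabilityMeasure_map hmeas.aemeasurable
  have hind : ∀ᵐ θ ∂(torusMeasure d),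
      B.indicator (fun _ => (1 : ℝ)) (torusProj d θ) = s.indicator (fun _ => (1 : ℝ)) θ := by
    filter_upwards [ae_mem_Ico_torusMeasure d] with θ hθ
    have : torusProj d θ ∈ B ↔ θ ∈ s := by
      refine ⟨?_, fun h => ⟨θ, ⟨h, hθ⟩, rfl⟩⟩
      rintro ⟨x, hx, hxθ⟩
      rw [← injOn_torusProj d hx.2 hθ hxθ]
      exact hx.1
    by_cases h : θ ∈ s
    · rw [Set.indicator_of_mem h, Set.indicator_of_mem (this.2 h)]
    · rw [Set.indicator_of_notMem h, Set.indicator_of_notMem (fun h' => h (this.1 h'))]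
  have hBL : MemLp (B.indicator fun _ => (1 : ℝ)) 2 ν :=
    memLp_indicator_const 2 hBm 1 (Or.inr (measure_ne_top _ _))
  have happrox : ∀ ε : ℝ, 0 < ε →
      -(ε * (eLpNorm f 2 (torusMeasure d)).toReal) ≤ ∫ θ in s, f θ ∂(torusMeasure d) := by
    intro ε hε
    obtain ⟨φ, hφ, hφL⟩ := hBL.exists_boundedContinuous_eLpNorm_sub_le (by norm_num)
      (ENNReal.ofReal_pos.2 hε).ne'
    -- Passing to the positive part does not increase the distance to a nonnegative indicator. The
    -- error `∫ u f` is then controlled by Cauchy–Schwarz, which is where `f ∈ L²` enters.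
    let ψ : C(UnitAddTorus (Fin d), ℝ) := ⟨fun x => max (φ x) 0, by fun_prop⟩
    have h0 := integral_continuous_mul_nonneg hfi hpos ψ fun x => le_max_right _ _
    set u : (Fin d → ℝ) → ℝ := fun θ => s.indicator (fun _ => (1 : ℝ)) θ - ψ (torusProj d θ) with hu
    have hψc : Continuous fun θ => ψ (torusProj d θ) := ψ.continuous.comp (continuous_torusProj d)
    have hum : AEStronglyMeasurable u (torusMeasure d) :=
      ((stronglyMeasurable_const.indicator hs).aestronglyMeasurable).sub hψc.aestronglyMeasurable
    have hle : eLpNorm u 2 (torusMeasure d) ≤ ENNReal.ofReal ε := by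
      refine le_trans ?_ hφ
      rw [hν, eLpNorm_map_measure]
      · refine eLpNorm_mono_ae ?_
        filter_upwards [hind] with θ hθ
        simp only [hu, Function.comp, Pi.sub_apply, ← hθ, ψ, ContinuousMap.coe_mk, Real.norm_eq_abs]
        have hnn : 0 ≤ B.indicator (fun _ => (1 : ℝ)) (torusProj d θ) :=
          Set.indicator_nonneg (fun _ _ => zero_le_one) _
        rcases le_total (φ (torusProj d θ)) 0 with h | h
        · rw [max_eq_right h, sub_zero, abs_of_nonneg hnn, abs_of_nonneg (by linarith)]
          linarith
        · rw [max_eq_left h]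
      · exact (hBL.sub hφL).1
      · exact hmeas.aemeasurable
    have huL : MemLp u 2 (torusMeasure d) := ⟨hum, hle.trans_lt ENNReal.ofReal_lt_top⟩
    have hsplit : ∫ θ in s, f θ ∂(torusMeasure d) =
        ∫ θ, ψ (torusProj d θ) * f θ ∂(torusMeasure d) + ∫ θ, u θ * f θ ∂(torusMeasure d) := by
      have hi1 : Integrable (fun θ => u θ * f θ) (torusMeasure d) := huL.integrable_mul hf
      have hi2 : Integrable (fun θ => s.indicator f θ) (torusMeasure d) := hfi.indicator hs
      have e : ∀ θ, ψ (torusProj d θ) * f θ = s.indicator f θ - u θ * f θ := by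
        intro θ
        simp only [hu]
        by_cases h : θ ∈ s
        · simp only [Set.indicator_of_mem h]; ring
        · simp only [Set.indicator_of_notMem h]; ring
      simp_rw [e]
      rw [integral_sub hi2 hi1, integral_indicator hs]
      ring
    have hCS : |∫ θ, u θ * f θ ∂(torusMeasure d)| ≤
        ε * (eLpNorm f 2 (torusMeasure d)).toReal := by
      have h1 : eLpNorm (fun θ => u θ * f θ) 1 (torusMeasure d) ≤
          eLpNorm u 2 (torusMeasure d) * eLpNorm f 2 (torusMeasure d) := by
        have := eLpNorm_smul_le_mul_eLpNorm (p := 2) (q := 2) (r := 1) hf.1 hum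
        simpa [smul_eq_mul] using! this
      have h2 : ‖∫ θ, u θ * f θ ∂(torusMeasure d)‖ ≤
          (eLpNorm (fun θ => u θ * f θ) 1 (torusMeasure d)).toReal := by
        rw [eLpNorm_one_eq_lintegral_enorm]
        refine (norm_integral_le_lintegral_norm _).trans (le_of_eq ?_)
        simp only [ofReal_norm]
      refine h2.trans ?_
      rw [← ENNReal.toReal_ofReal hε.le, ← ENNReal.toReal_mul]
      refine ENNReal.toReal_mono (ENNReal.mul_ne_top ENNReal.ofReal_ne_top hf.2.ne) ?_
      exact h1.trans (mul_le_mul_left hle _)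
    rw [hsplit]
    linarith [(abs_le.1 hCS).1]
  have lim : Tendsto (fun ε : ℝ => -(ε * (eLpNorm f 2 (torusMeasure d)).toReal)) (𝓝[>] 0)
      (𝓝 (-(0 * (eLpNorm f 2 (torusMeasure d)).toReal))) :=
    ((continuous_id.mul continuous_const).neg.tendsto 0).mono_left nhdsWithin_le_nhds
  have := le_of_tendsto lim (eventually_nhdsWithin_of_forall fun ε hε => happrox ε hε)
  simpa using this

end Positivity

/-! ### Fourier coefficients of matrix densities and their Toeplitz forms. -/

section Spectral

variable {d : ℕ} {ι : Type*}

/-- The matrix-valued Fourier coefficient `∫ Ψ(θ) e^{j⟨θ, k⟩} dμ(θ)`. -/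
noncomputable def spectralCoeff (Ψ : (Fin d → ℝ) → Matrix ι ι ℂ) (k : Site d) : Matrix ι ι ℂ :=
  Matrix.of fun i j => ∫ θ, Ψ θ i j * character (-k) θ ∂(torusMeasure d)

lemma integrable_mul_character {f : (Fin d → ℝ) → ℂ} (hf : Integrable f (torusMeasure d))
    (k : Site d) : Integrable (fun θ => f θ * character k θ) (torusMeasure d) :=
  hf.mul_bdd (c := 1) (continuous_character k).aestronglyMeasurable
    (ae_of_all _ fun θ => (norm_character k θ).le)

/-- This is the bridge between positivity of a covariance kernel (left) and positivity of the
density (right): the double sum is the integral of `v* Ψ v`, where `v` is the trigonometric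
polynomial with coefficients the conjugates of `c`. -/
lemma sum_spectralCoeff_eq_integral [Fintype ι] {Ψ : (Fin d → ℝ) → Matrix ι ι ℂ}
    (hΨ : ∀ i j, Integrable (fun θ => Ψ θ i j) (torusMeasure d)) (F : Finset (Site d))
    (c : Site d → ι → ℂ) :
    ∑ s ∈ F, ∑ r ∈ F, ∑ i, ∑ j,
        c s i * (starRingEnd ℂ) (c r j) * spectralCoeff Ψ (s - r) i j =
      ∫ θ, star (fun j => ∑ s ∈ F, (starRingEnd ℂ) (c s j) * character s θ) ⬝ᵥ
        (Ψ θ *ᵥ fun j => ∑ s ∈ F, (starRingEnd ℂ) (c s j) * character s θ) ∂(torusMeasure d) := by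
  have e : ∀ θ, star (fun j => ∑ s ∈ F, (starRingEnd ℂ) (c s j) * character s θ) ⬝ᵥ
        (Ψ θ *ᵥ fun j => ∑ s ∈ F, (starRingEnd ℂ) (c s j) * character s θ) =
      ∑ s ∈ F, ∑ r ∈ F, ∑ i, ∑ j,
        c s i * (starRingEnd ℂ) (c r j) * (Ψ θ i j * character (-(s - r)) θ) := by
    intro θ
    have h1 : ∀ i, star (fun j => ∑ s ∈ F, (starRingEnd ℂ) (c s j) * character s θ) i =
        ∑ s ∈ F, c s i * character (-s) θ := by
      intro i
      rw [Pi.star_apply, star_sum]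
      refine Finset.sum_congr rfl fun s _ => ?_
      rw [star_mul', Complex.star_def, Complex.conj_conj, conj_character]
    simp only [dotProduct, mulVec, h1]
    simp_rw [Finset.sum_mul, Finset.mul_sum]
    rw [Finset.sum_comm]
    refine Finset.sum_congr rfl fun s _ => ?_
    have h2 : ∀ i, (∑ j, ∑ r ∈ F, c s i * character (-s) θ *
        (Ψ θ i j * ((starRingEnd ℂ) (c r j) * character r θ))) =
        ∑ r ∈ F, ∑ j, c s i * (starRingEnd ℂ) (c r j) * (Ψ θ i j * character (-(s - r)) θ) := by
      intro i
      rw [Finset.sum_comm]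
      refine Finset.sum_congr rfl fun r _ => Finset.sum_congr rfl fun j _ => ?_
      rw [neg_sub, sub_eq_neg_add, character_add]
      ring
    simp_rw [h2]
    rw [Finset.sum_comm]
  simp_rw [e]
  have hi : ∀ s r i j, Integrable (fun θ =>
      c s i * (starRingEnd ℂ) (c r j) * (Ψ θ i j * character (-(s - r)) θ)) (torusMeasure d) :=
    fun s r i j => (integrable_mul_character (hΨ i j) _).const_mul _
  rw [integral_finsetSum _ fun s _ => integrable_finsetSum _ fun r _ => integrable_finsetSum _
    fun i _ => integrable_finsetSum _ fun j _ => hi s r i j]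
  refine Finset.sum_congr rfl fun s _ => ?_
  rw [integral_finsetSum _ fun r _ => integrable_finsetSum _
    fun i _ => integrable_finsetSum _ fun j _ => hi s r i j]
  refine Finset.sum_congr rfl fun r _ => ?_
  rw [integral_finsetSum _ fun i _ => integrable_finsetSum _ fun j _ => hi s r i j]
  refine Finset.sum_congr rfl fun i _ => ?_
  rw [integral_finsetSum _ fun j _ => hi s r i j]
  refine Finset.sum_congr rfl fun j _ => ?_
  rw [integral_const_mul]
  rfl

end Spectral

/-! ### Mean square of a filtered field. -/

section FilterCost

variable {d m : ℕ}

lemma norm_toLp_le_sum (v : Fin m → ℝ) : ‖(WithLp.toLp 2 v : State m)‖ ≤ ∑ i, |v i| := by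
  have h : (WithLp.toLp 2 v : State m) = ∑ i, v i • EuclideanSpace.single i (1 : ℝ) := by
    ext j
    simp [Finset.sum_apply, Pi.single_apply]
  rw [h]
  refine (norm_sum_le _ _).trans (Finset.sum_le_sum fun i _ => ?_)
  rw [norm_smul, PiLp.norm_single, norm_one, mul_one, Real.norm_eq_abs]

/-- The sum of the absolute values of the entries of `H_s`. -/
noncomputable def filterNorm (h : Site d → Matrix (Fin m) (Fin m) ℝ) (s : Site d) : ℝ :=
  ∑ i, ∑ j, |h s i j|

lemma filterNorm_nonneg (h : Site d → Matrix (Fin m) (Fin m) ℝ) (s : Site d) :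
    0 ≤ filterNorm h s := Finset.sum_nonneg fun _ _ => Finset.sum_nonneg fun _ _ => abs_nonneg _

lemma abs_le_filterNorm (h : Site d → Matrix (Fin m) (Fin m) ℝ) (s : Site d) (i j : Fin m) :
    |h s i j| ≤ filterNorm h s :=
  (Finset.single_le_sum (f := fun j => |h s i j|) (fun _ _ => abs_nonneg _)
    (Finset.mem_univ j)).trans
    (Finset.single_le_sum (f := fun i => ∑ j, |h s i j|)
      (fun _ _ => Finset.sum_nonneg fun _ _ => abs_nonneg _) (Finset.mem_univ i))

lemma IsL1Filter.summable_filterNorm {h : Site d → Matrix (Fin m) (Fin m) ℝ} (hh : IsL1Filter h)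
    (t : Site d) : Summable fun s => filterNorm h (t - s) :=
  (Equiv.subLeft t).summable_iff (f := filterNorm h) |>.2
    (summable_sum fun i _ => summable_sum fun j _ => hh i j)

lemma norm_filterTerm_le (h : Site d → Matrix (Fin m) (Fin m) ℝ) (x : Site d → State m)
    (t s : Site d) : ‖filterTerm h x t s‖ ≤ filterNorm h (t - s) * ‖x s‖ := by
  unfold filterTerm filterNorm
  refine (norm_toLp_le_sum _).trans ?_
  rw [Finset.sum_mul]
  refine Finset.sum_le_sum fun i _ => ?_
  rw [mulVec, dotProduct, Finset.sum_mul]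
  refine (Finset.abs_sum_le_sum_abs _ _).trans (Finset.sum_le_sum fun j _ => ?_)
  rw [abs_mul]
  gcongr
  exact PiLp.norm_apply_le (x s) j

/-- The partial sums of the frequency response, in the order of the terms of `(h ⋆ e)_t`. -/
noncomputable def partialResponse (h : Site d → Matrix (Fin m) (Fin m) ℝ) (t : Site d)
    (F : Finset (Site d)) (θ : Fin d → ℝ) : Matrix (Fin m) (Fin m) ℂ :=
  Matrix.of fun i j => ∑ s ∈ F, (h (t - s) i j : ℂ) * character (t - s) θ

lemma norm_partialResponse_le {h : Site d → Matrix (Fin m) (Fin m) ℝ} (hh : IsL1Filter h)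
    (t : Site d) (F : Finset (Site d)) (θ : Fin d → ℝ) (i j : Fin m) :
    ‖partialResponse h t F θ i j‖ ≤ ∑' s, filterNorm h (t - s) := by
  refine (norm_sum_le _ _).trans ?_
  refine le_trans (Finset.sum_le_sum fun s _ => ?_)
    ((hh.summable_filterNorm t).sum_le_tsum F fun s _ => filterNorm_nonneg _ _)
  rw [norm_mul, norm_character, mul_one, Complex.norm_real]
  exact abs_le_filterNorm _ _ _ _

lemma continuous_partialResponse (h : Site d → Matrix (Fin m) (Fin m) ℝ) (t : Site d)
    (F : Finset (Site d)) (i j : Fin m) :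
    Continuous fun θ => partialResponse h t F θ i j := by
  simp only [partialResponse, Matrix.of_apply]
  exact continuous_finsetSum _ fun s _ => continuous_const.mul (continuous_character _)

lemma tendsto_partialResponse {h : Site d → Matrix (Fin m) (Fin m) ℝ} (hh : IsL1Filter h)
    (t : Site d) (θ : Fin d → ℝ) (i j : Fin m) :
    Tendsto (fun F => partialResponse h t F θ i j) atTop (𝓝 (frequencyResponse h θ i j)) := by
  have hs : Summable fun s => (h s i j : ℂ) * character s θ := by
    refine Summable.of_norm ?_
    simpa [norm_mul, norm_character] using hh i j
  exact ((Equiv.subLeft t).hasSum_iff (f := fun s => (h s i j : ℂ) * character s θ)).2 hs.hasSum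

lemma norm_frequencyResponse_le {h : Site d → Matrix (Fin m) (Fin m) ℝ} (hh : IsL1Filter h)
    (θ : Fin d → ℝ) (i j : Fin m) :
    ‖frequencyResponse h θ i j‖ ≤ ∑' s, filterNorm h (0 - s) :=
  le_of_tendsto' (tendsto_partialResponse hh 0 θ i j).norm
    fun F => norm_partialResponse_le hh 0 F θ i j

lemma measurable_frequencyResponse {h : Site d → Matrix (Fin m) (Fin m) ℝ} (hh : IsL1Filter h)
    (i j : Fin m) : Measurable fun θ => frequencyResponse h θ i j :=
  measurable_of_tendsto_metrizable' atTop
    (fun F => (continuous_partialResponse h 0 F i j).measurable)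
    (tendsto_pi_nhds.2 fun θ => tendsto_partialResponse hh 0 θ i j)

lemma mul_mul_conjTranspose_apply_eq_sum (X Y : Matrix (Fin m) (Fin m) ℂ) (i : Fin m) :
    (X * Y * Xᴴ) i i = ∑ k, ∑ j, Y j k * (X i j * star (X i k)) := by
  rw [mul_apply]
  refine Finset.sum_congr rfl fun k _ => ?_
  rw [mul_apply, Finset.sum_mul]
  refine Finset.sum_congr rfl fun j _ => ?_
  rw [conjTranspose_apply]
  ring

lemma norm_mul_mul_conjTranspose_apply_le {X : Matrix (Fin m) (Fin m) ℂ} {C : ℝ}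
    (hX : ∀ i j, ‖X i j‖ ≤ C) (Y : Matrix (Fin m) (Fin m) ℂ) (i : Fin m) :
    ‖(X * Y * Xᴴ) i i‖ ≤ ∑ k, ∑ j, ‖Y j k‖ * (C * C) := by
  rw [mul_mul_conjTranspose_apply_eq_sum]
  refine (norm_sum_le _ _).trans (Finset.sum_le_sum fun k _ =>
    (norm_sum_le _ _).trans (Finset.sum_le_sum fun j _ => ?_))
  rw [norm_mul, norm_mul, norm_star]
  have := (norm_nonneg _).trans (hX i j)
  gcongr
  exacts [hX i j, hX i k]

lemma integrable_mul_mul_conjTranspose_apply {X Ψ : (Fin d → ℝ) → Matrix (Fin m) (Fin m) ℂ}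
    {C : ℝ} (hX : ∀ i j, AEStronglyMeasurable (fun θ => X θ i j) (torusMeasure d))
    (hXC : ∀ i j θ, ‖X θ i j‖ ≤ C)
    (hΨ : ∀ i j, Integrable (fun θ => Ψ θ i j) (torusMeasure d)) (i : Fin m) :
    Integrable (fun θ => (X θ * Ψ θ * (X θ)ᴴ) i i) (torusMeasure d) := by
  simp_rw [mul_mul_conjTranspose_apply_eq_sum]
  refine integrable_finsetSum _ fun k _ => integrable_finsetSum _ fun j _ => ?_
  refine (hΨ j k).mul_bdd (c := C * C) ((hX i j).mul (hX i k).star) (ae_of_all _ fun θ => ?_)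
  rw [norm_mul, norm_star]
  have := (norm_nonneg _).trans (hXC i j θ)
  gcongr
  exacts [hXC i j θ, hXC i k θ]

variable {Ω : Type*} [MeasurableSpace Ω] {P : Measure Ω} {e : Site d → Ω → State m}
  {Ψ : (Fin d → ℝ) → Matrix (Fin m) (Fin m) ℂ} {h : Site d → Matrix (Fin m) (Fin m) ℝ}

/-- Each component of the partial sum contributes a Toeplitz form whose coefficients are a row of
the filter. As the filter is real, only the real parts of the spectral coefficients matter, so `Ψ`
itself may have complex Fourier coefficients. -/
lemma integral_norm_sq_partialSum_eq (hh : IsL1Filter h)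
    (he : ∀ s i, MemLp (fun ω => e s ω i) 2 P)
    (hΨ : ∀ i j, Integrable (fun θ => Ψ θ i j) (torusMeasure d))
    (hcov : ∀ s r i j, ∫ ω, e s ω i * e r ω j ∂P = (spectralCoeff Ψ (s - r) i j).re)
    (t : Site d) (F : Finset (Site d)) :
    ∫ ω, ‖∑ s ∈ F, filterTerm h (fun s => e s ω) t s‖ ^ 2 ∂P =
      ∫ θ, (partialResponse h t F θ * Ψ θ * (partialResponse h t F θ)ᴴ).trace.re
        ∂(torusMeasure d) := by
  have hint : ∀ s r i j, Integrable (fun ω => e s ω i * e r ω j) P :=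
    fun s r i j => (he s i).integrable_mul (he r j)
  have e1 : ∀ ω, ‖∑ s ∈ F, filterTerm h (fun s => e s ω) t s‖ ^ 2 =
      ∑ i, ∑ s ∈ F, ∑ r ∈ F, ∑ j, ∑ k,
        h (t - s) i j * h (t - r) i k * (e s ω j * e r ω k) := by
    intro ω
    rw [EuclideanSpace.norm_sq_eq]
    refine Finset.sum_congr rfl fun i _ => ?_
    have : (∑ s ∈ F, filterTerm h (fun s => e s ω) t s) i =
        ∑ s ∈ F, ∑ j, h (t - s) i j * e s ω j := by
      rw [WithLp.ofLp_sum, Finset.sum_apply]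
      rfl
    rw [this, Real.norm_eq_abs, sq_abs, sq, Finset.sum_mul_sum]
    refine Finset.sum_congr rfl fun s _ => Finset.sum_congr rfl fun r _ => ?_
    rw [Finset.sum_mul_sum]
    refine Finset.sum_congr rfl fun j _ => Finset.sum_congr rfl fun k _ => ?_
    ring
  have e2 : ∫ ω, ‖∑ s ∈ F, filterTerm h (fun s => e s ω) t s‖ ^ 2 ∂P =
      ∑ i, ∑ s ∈ F, ∑ r ∈ F, ∑ j, ∑ k,
        h (t - s) i j * h (t - r) i k * (spectralCoeff Ψ (s - r) j k).re := by
    have hi : ∀ i s r j k, Integrable (fun ω =>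
        h (t - s) i j * h (t - r) i k * (e s ω j * e r ω k)) P :=
      fun i s r j k => (hint s r j k).const_mul _
    simp_rw [e1]
    rw [integral_finsetSum _ fun i _ => integrable_finsetSum _ fun s _ => integrable_finsetSum _
      fun r _ => integrable_finsetSum _ fun j _ => integrable_finsetSum _ fun k _ => hi i s r j k]
    refine Finset.sum_congr rfl fun i _ => ?_
    rw [integral_finsetSum _ fun s _ => integrable_finsetSum _
      fun r _ => integrable_finsetSum _ fun j _ => integrable_finsetSum _ fun k _ => hi i s r j k]
    refine Finset.sum_congr rfl fun s _ => ?_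
    rw [integral_finsetSum _
      fun r _ => integrable_finsetSum _ fun j _ => integrable_finsetSum _ fun k _ => hi i s r j k]
    refine Finset.sum_congr rfl fun r _ => ?_
    rw [integral_finsetSum _
      fun j _ => integrable_finsetSum _ fun k _ => hi i s r j k]
    refine Finset.sum_congr rfl fun j _ => ?_
    rw [integral_finsetSum _ fun k _ => hi i s r j k]
    refine Finset.sum_congr rfl fun k _ => ?_
    rw [integral_const_mul, hcov]
  set w : Fin m → (Fin d → ℝ) → Fin m → ℂ := fun i θ j =>
    ∑ s ∈ F, (starRingEnd ℂ) ((h (t - s) i j : ℂ)) * character s θ with hw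
  have e3 : ∀ i θ, star (w i θ) ⬝ᵥ (Ψ θ *ᵥ w i θ) =
      (partialResponse h t F θ * Ψ θ * (partialResponse h t F θ)ᴴ) i i := by
    intro i θ
    -- The vector `w i θ` is the conjugate of row `i` of the partial response, up to the unimodular
    -- factor `character t θ`, which cancels in the quadratic form.
    have hw' : ∀ j, w i θ j = character t θ * star (partialResponse h t F θ i j) := by
      intro j
      simp only [hw, partialResponse, Matrix.of_apply, star_sum, Finset.mul_sum]
      refine Finset.sum_congr rfl fun s _ => ?_
      rw [star_mul', Complex.star_def, conj_character, neg_sub, sub_eq_add_neg s t,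
        character_add]
      have : character t θ * character (-t) θ = 1 := by
        rw [← character_add, add_neg_cancel, character_zero]
      linear_combination (-(starRingEnd ℂ) ((h (t - s) i j : ℂ)) * character s θ) * this
    have hcc : star (character t θ) * character t θ = 1 := by
      rw [Complex.star_def, conj_character, ← character_add, neg_add_cancel, character_zero]
    rw [mul_assoc, mul_apply, dotProduct]
    refine Finset.sum_congr rfl fun j _ => ?_
    rw [Pi.star_apply, hw', star_mul', star_star, mulVec, dotProduct, mul_apply,
      Finset.mul_sum, Finset.mul_sum]
    refine Finset.sum_congr rfl fun k _ => ?_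
    rw [hw', conjTranspose_apply]
    linear_combination (partialResponse h t F θ i j * Ψ θ j k *
      star (partialResponse h t F θ i k)) * hcc
  have hintd : ∀ i, Integrable (fun θ =>
      (partialResponse h t F θ * Ψ θ * (partialResponse h t F θ)ᴴ) i i) (torusMeasure d) :=
    fun i => integrable_mul_mul_conjTranspose_apply
      (fun i j => (continuous_partialResponse h t F i j).aestronglyMeasurable)
      (fun i j θ => norm_partialResponse_le hh t F θ i j) hΨ i
  rw [e2]
  have e4 : ∀ i, ∑ s ∈ F, ∑ r ∈ F, ∑ j, ∑ k,
        h (t - s) i j * h (t - r) i k * (spectralCoeff Ψ (s - r) j k).re =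
      ∫ θ, ((partialResponse h t F θ * Ψ θ * (partialResponse h t F θ)ᴴ) i i).re
        ∂(torusMeasure d) := by
    intro i
    have h1 := sum_spectralCoeff_eq_integral hΨ F (fun s j => (h (t - s) i j : ℂ))
    have h2 := congrArg Complex.re h1
    simp_rw [Complex.re_sum] at h2
    simp only [Complex.conj_ofReal, ← Complex.ofReal_mul, Complex.re_ofReal_mul] at h2
    rw [h2]
    have h3 : ∀ θ, star (fun j => ∑ s ∈ F, (h (t - s) i j : ℂ) * character s θ) ⬝ᵥ
        (Ψ θ *ᵥ fun j => ∑ s ∈ F, (h (t - s) i j : ℂ) * character s θ) =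
        (partialResponse h t F θ * Ψ θ * (partialResponse h t F θ)ᴴ) i i := by
      intro θ
      rw [← e3]
      simp only [hw, Complex.conj_ofReal]
    simp_rw [h3]
    exact (integral_re (hintd i)).symm
  simp_rw [e4]
  rw [← integral_finsetSum]
  · simp only [trace, Complex.re_sum, Matrix.diag_apply]
  · exact fun i _ => (hintd i).re

lemma tendsto_integral_trace_partialResponse (hh : IsL1Filter h)
    (hΨ : ∀ i j, Integrable (fun θ => Ψ θ i j) (torusMeasure d)) (t : Site d) :
    Tendsto (fun F => ∫ θ, (partialResponse h t F θ * Ψ θ * (partialResponse h t F θ)ᴴ).trace.re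
        ∂(torusMeasure d)) atTop
      (𝓝 (∫ θ, (frequencyResponse h θ * Ψ θ * (frequencyResponse h θ)ᴴ).trace.re
        ∂(torusMeasure d))) := by
  set C := ∑' s, filterNorm h (t - s) with hC
  refine tendsto_integral_filter_of_dominated_convergence
    (fun θ => ∑ _i : Fin m, ∑ k, ∑ j, ‖Ψ θ j k‖ * (C * C)) (Eventually.of_forall fun F => ?_)
    (Eventually.of_forall fun F => ae_of_all _ fun θ => ?_) ?_ (ae_of_all _ fun θ => ?_)
  · refine Complex.continuous_re.comp_aestronglyMeasurable ?_
    simp only [trace, Matrix.diag_apply]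
    exact Finset.aestronglyMeasurable_fun_sum _ fun i _ =>
      (integrable_mul_mul_conjTranspose_apply
        (fun i j => (continuous_partialResponse h t F i j).aestronglyMeasurable)
        (fun i j θ => norm_partialResponse_le hh t F θ i j) hΨ i).1
  · refine (Complex.abs_re_le_norm _).trans ((norm_sum_le _ _).trans
      (Finset.sum_le_sum fun i _ => ?_))
    exact norm_mul_mul_conjTranspose_apply_le
      (fun i j => norm_partialResponse_le hh t F θ i j) (Ψ θ) i
  · exact integrable_finsetSum _ fun i _ => integrable_finsetSum _ fun k _ =>
      integrable_finsetSum _ fun j _ => (hΨ j k).norm.mul_const _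
  · refine (Complex.continuous_re.tendsto _).comp ?_
    simp only [trace, Matrix.diag_apply, mul_mul_conjTranspose_apply_eq_sum]
    refine tendsto_finsetSum _ fun i _ => tendsto_finsetSum _ fun k _ =>
      tendsto_finsetSum _ fun j _ => ?_
    exact ((tendsto_partialResponse hh t θ i j).mul
      (tendsto_partialResponse hh t θ i k).star).const_mul _

/-- The square of the sum of the norms is dominated by an integrable function. -/
lemma exists_integrable_dominating (hh : IsL1Filter h) {K : ℝ}
    (he : ∀ s, AEStronglyMeasurable (e s) P)
    (hi : ∀ s, Integrable (fun ω => ‖e s ω‖ ^ 2) P)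
    (hK : ∀ s, ∫ ω, ‖e s ω‖ ^ 2 ∂P = K) (t : Site d) :
    ∃ G : Ω → ℝ, Integrable G P ∧ ∀ᵐ ω ∂P,
      Summable (filterTerm h (fun s => e s ω) t) ∧
      ∀ F : Finset (Site d), ‖∑ s ∈ F, filterTerm h (fun s => e s ω) t s‖ ^ 2 ≤ G ω := by
  set a : Site d → ℝ := fun s => filterNorm h (t - s) with ha
  have ha0 : ∀ s, 0 ≤ a s := fun s => filterNorm_nonneg _ _
  have has : Summable a := hh.summable_filterNorm t
  set A := ∑' s, a s with hA
  -- By weighted Cauchy–Schwarz, `(∑ a_s ‖e_s‖)² ≤ (∑ a_s)(∑ a_s ‖e_s‖²)`. The last sum, taken over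
  -- all sites, is `g`; its expectation is `K ∑ a_s`, hence finite.
  set g : Ω → ℝ≥0∞ := fun ω => ∑' s, ENNReal.ofReal (a s * ‖e s ω‖ ^ 2) with hg
  have hgm : ∀ s, AEMeasurable (fun ω => ENNReal.ofReal (a s * ‖e s ω‖ ^ 2)) P := fun s =>
    (((he s).norm.aemeasurable.pow_const 2).const_mul _).ennreal_ofReal
  have hgl : ∫⁻ ω, g ω ∂P ≠ ∞ := by
    rw [hg, lintegral_tsum hgm]
    have : ∀ s, ∫⁻ ω, ENNReal.ofReal (a s * ‖e s ω‖ ^ 2) ∂P = ENNReal.ofReal (a s * K) := by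
      intro s
      rw [← ofReal_integral_eq_lintegral_ofReal ((hi s).const_mul _)
        (ae_of_all _ fun ω => mul_nonneg (ha0 s) (sq_nonneg _)), integral_const_mul, hK]
    simp_rw [this]
    exact (has.mul_right K).tsum_ofReal_ne_top
  have hgam : AEMeasurable g P := AEMeasurable.tsum hgm
  refine ⟨fun ω => A * (g ω).toReal,
    (integrable_toReal_of_lintegral_ne_top hgam hgl).const_mul _, ?_⟩
  filter_upwards [ae_lt_top' hgam hgl] with ω hω
  have hsum : Summable fun s => a s * ‖e s ω‖ ^ 2 := by
    have h1 := ENNReal.summable_toReal hω.ne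
    refine h1.congr fun s => ?_
    rw [ENNReal.toReal_ofReal (mul_nonneg (ha0 s) (sq_nonneg _))]
  have htsum : ∀ F : Finset (Site d), ∑ s ∈ F, a s * ‖e s ω‖ ^ 2 ≤ (g ω).toReal := by
    intro F
    have h1 : ENNReal.ofReal (∑ s ∈ F, a s * ‖e s ω‖ ^ 2) ≤ g ω := by
      rw [ENNReal.ofReal_sum_of_nonneg fun s _ => mul_nonneg (ha0 s) (sq_nonneg _)]
      exact ENNReal.sum_le_tsum F
    exact (ENNReal.ofReal_le_iff_le_toReal hω.ne).1 h1
  refine ⟨?_, fun F => ?_⟩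
  -- Uses `‖e_s‖ ≤ 1 + ‖e_s‖²`; both resulting series converge.
  · refine Summable.of_norm_bounded (g := fun s => (a s + a s * ‖e s ω‖ ^ 2)) (has.add hsum)
      fun s => ?_
    refine (norm_filterTerm_le h _ t s).trans ?_
    rw [← mul_one_add]
    refine mul_le_mul_of_nonneg_left ?_ (ha0 s)
    nlinarith [sq_nonneg (‖e s ω‖ - 1)]
  · have h1 : ‖∑ s ∈ F, filterTerm h (fun s => e s ω) t s‖ ≤ ∑ s ∈ F, a s * ‖e s ω‖ :=
      (norm_sum_le _ _).trans (Finset.sum_le_sum fun s _ => norm_filterTerm_le h _ t s)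
    have h2 : (∑ s ∈ F, a s * ‖e s ω‖) ^ 2 ≤ (∑ s ∈ F, a s) * ∑ s ∈ F, a s * ‖e s ω‖ ^ 2 :=
      Finset.sum_sq_le_sum_mul_sum_of_sq_le_mul F (fun s _ => ha0 s)
        (fun s _ => mul_nonneg (ha0 s) (sq_nonneg _)) fun s _ => (by ring : _ = _).le
    calc _ ≤ (∑ s ∈ F, a s * ‖e s ω‖) ^ 2 := by gcongr
      _ ≤ _ := h2
      _ ≤ A * (g ω).toReal := by
        refine mul_le_mul (has.sum_le_tsum F fun s _ => ha0 s) (htsum F)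
          (Finset.sum_nonneg fun s _ => mul_nonneg (ha0 s) (sq_nonneg _)) (tsum_nonneg ha0)

lemma integrable_norm_sq_of_memLp (he : ∀ s i, MemLp (fun ω => e s ω i) 2 P) (s : Site d) :
    Integrable (fun ω => ‖e s ω‖ ^ 2) P := by
  simp_rw [EuclideanSpace.norm_sq_eq]
  exact integrable_finsetSum _ fun i _ => (he s i).integrable_norm_pow (by norm_num)

/-- The mean square of a filtered stationary field with spectral density `Ψ` is the integral of
`tr (H Ψ H^*)`. -/
theorem filtered_mean_square (hh : IsL1Filter h)
    (hem : ∀ s, AEStronglyMeasurable (e s) P)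
    (he : ∀ s i, MemLp (fun ω => e s ω i) 2 P)
    (hΨ : ∀ i j, Integrable (fun θ => Ψ θ i j) (torusMeasure d))
    (hcov : ∀ s r i j, ∫ ω, e s ω i * e r ω j ∂P = (spectralCoeff Ψ (s - r) i j).re)
    (t : Site d) :
    (∀ᵐ ω ∂P, Summable (filterTerm h (fun s => e s ω) t)) ∧
    Integrable (fun ω => ‖filtered h (fun s => e s ω) t‖ ^ 2) P ∧
    ∫ ω, ‖filtered h (fun s => e s ω) t‖ ^ 2 ∂P =
      ∫ θ, (frequencyResponse h θ * Ψ θ * (frequencyResponse h θ)ᴴ).trace.re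
        ∂(torusMeasure d) := by
  have hi := integrable_norm_sq_of_memLp he
  have hK : ∀ s, ∫ ω, ‖e s ω‖ ^ 2 ∂P = ∑ i, (spectralCoeff Ψ 0 i i).re := by
    intro s
    simp_rw [EuclideanSpace.norm_sq_eq]
    rw [integral_finsetSum _ fun i _ => (he s i).integrable_norm_pow (by norm_num)]
    refine Finset.sum_congr rfl fun i _ => ?_
    rw [← sub_self s, ← hcov]
    simp only [Real.norm_eq_abs, sq_abs]
    simp only [sq]
  obtain ⟨G, hG, hdom⟩ := exists_integrable_dominating hh hem hi hK t
  have hpm : ∀ F : Finset (Site d), AEStronglyMeasurable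
      (fun ω => ∑ s ∈ F, filterTerm h (fun s => e s ω) t s) P := by
    intro F
    refine Finset.aestronglyMeasurable_fun_sum _ fun s _ => ?_
    have hc : Continuous fun x : State m => (WithLp.toLp 2 (h (t - s) *ᵥ x.ofLp) : State m) := by
      fun_prop
    exact hc.comp_aestronglyMeasurable (hem s)
  have hpm2 : ∀ F : Finset (Site d), AEStronglyMeasurable
      (fun ω => ‖∑ s ∈ F, filterTerm h (fun s => e s ω) t s‖ ^ 2) P := fun F => (hpm F).norm.pow 2
  have hlim : ∀ᵐ ω ∂P, Tendsto (fun F : Finset (Site d) =>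
      ‖∑ s ∈ F, filterTerm h (fun s => e s ω) t s‖ ^ 2) atTop
      (𝓝 (‖filtered h (fun s => e s ω) t‖ ^ 2)) := by
    filter_upwards [hdom] with ω hω
    exact (hω.1.hasSum.norm).pow 2
  have hT := tendsto_integral_filter_of_dominated_convergence G
    (Eventually.of_forall hpm2)
    (Eventually.of_forall fun F => by
      filter_upwards [hdom] with ω hω
      rw [norm_pow, norm_norm]
      exact hω.2 F) hG hlim
  refine ⟨hdom.mono fun ω hω => hω.1, ?_, ?_⟩
  · refine hG.mono' (aestronglyMeasurable_of_tendsto_ae atTop hpm2 hlim) ?_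
    filter_upwards [hdom, hlim] with ω h1 h2
    rw [norm_pow, norm_norm]
    exact le_of_tendsto' h2 h1.2
  · simp_rw [integral_norm_sq_partialSum_eq hh he hΨ hcov t] at hT
    exact tendsto_nhds_unique hT (tendsto_integral_trace_partialResponse hh hΨ t)

end FilterCost

/-! ### Cholesky factorization of a countable strictly positive definite kernel. -/

section Factorization

/-- A countable strictly positive definite kernel factors through finite rows. -/
lemma exists_factorization {A : Type*} [Countable A] (K : A → A → ℝ) (hsymm : ∀ a b, K a b = K b a)
    (hpos : ∀ (F : Finset A) (c : A → ℝ), (∃ a ∈ F, c a ≠ 0) →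
      0 < ∑ a ∈ F, ∑ b ∈ F, c a * c b * K a b) :
    ∃ (l : A → ℕ → ℝ) (N : A → ℕ), ∀ a b n, N a ≤ n → N b ≤ n →
      (∀ j, N a ≤ j → l a j = 0) ∧ ∑ j ∈ Finset.range n, l a j * l b j = K a b := by
  classical
  -- Extended bilinearly to finitely supported functions, `K` becomes an inner product by strict
  -- positivity. Gram–Schmidt along an enumeration of `A` then factors it.
  let B : (A →₀ ℝ) →ₗ[ℝ] (A →₀ ℝ) →ₗ[ℝ] ℝ :=
    Finsupp.linearCombination ℝ (fun a => Finsupp.linearCombination ℝ (K a))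
  have hB1 : ∀ a b, B (Finsupp.single a 1) (Finsupp.single b 1) = K a b := by
    intro a b
    simp [B]
  have hBs : B.flip = B := by
    ext a b
    simp [B, hsymm a b]
  have hBsymm : ∀ x y, B x y = B y x := fun x y => by
    conv_lhs => rw [← hBs]
    rfl
  have hBB : ∀ x, B x x = ∑ a ∈ x.support, ∑ b ∈ x.support, x a * x b * K a b := by
    intro x
    simp only [B, Finsupp.linearCombination_apply, Finsupp.sum, LinearMap.sum_apply,
      LinearMap.smul_apply, smul_eq_mul, Finset.mul_sum]
    refine Finset.sum_congr rfl fun a _ => Finset.sum_congr rfl fun b _ => by ring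
  have hBpos : ∀ x, x ≠ 0 → 0 < B x x := by
    intro x hx
    rw [hBB]
    obtain ⟨a, ha⟩ := Finsupp.support_nonempty_iff.2 hx
    exact hpos _ _ ⟨a, ha, Finsupp.mem_support_iff.1 ha⟩
  let core : InnerProductSpace.Core ℝ (A →₀ ℝ) :=
    { inner := fun x y => B x y
      conj_inner_symm := fun x y => hBsymm y x
      re_inner_nonneg := fun x => by
        by_cases hx : x = 0
        · simp [hx]
        · exact (hBpos x hx).le
      add_left := fun x y z => by simp
      smul_left := fun x y r => by simp
      definite := fun x hx => by
        by_contra h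
        exact (hBpos x h).ne' hx }
  let _ : NormedAddCommGroup (A →₀ ℝ) := core.toNormedAddCommGroup
  let _ : InnerProductSpace ℝ (A →₀ ℝ) := InnerProductSpace.ofCore core.toCore
  have hin : ∀ x y : A →₀ ℝ, inner ℝ x y = B x y := fun x y => rfl
  let _ := Encodable.ofCountable A
  -- Integers that encode no element of `A` receive the zero vector; Gram–Schmidt returns zero there
  -- and the expansion below is unaffected.
  let v : ℕ → A →₀ ℝ := fun n => ((Encodable.decode n : Option A).map
    fun a => Finsupp.single a (1 : ℝ)).getD 0
  have hv : ∀ a : A, v (Encodable.encode a) = Finsupp.single a 1 := fun a => by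
    simp [v]
  let g : ℕ → A →₀ ℝ := InnerProductSpace.gramSchmidt ℝ v
  -- The coordinates of `v n` in the orthogonal system `g`: lower triangular with unit diagonal, so
  -- each row is finite.
  let q : ℕ → ℕ → ℝ := fun n j => if j < n then inner ℝ (g j) (v n) / ‖g j‖ ^ 2 else
    if j = n then 1 else 0
  have hexp : ∀ n k, n < k → v n = ∑ j ∈ Finset.range k, q n j • g j := by
    intro n k hnk
    have h1 : v n = ∑ j ∈ Finset.range (n + 1), q n j • g j := by
      rw [Finset.sum_range_succ]
      conv_lhs => rw [InnerProductSpace.gramSchmidt_def'' ℝ v n]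
      rw [add_comm]
      congr 1
      · rw [Nat.Iio_eq_range]
        refine Finset.sum_congr rfl fun j hj => ?_
        simp only [q, if_pos (Finset.mem_range.1 hj)]
        rfl
      · simp [q, g]
    rw [h1]
    refine Finset.sum_subset (Finset.range_mono hnk) fun j _ hj => ?_
    have : ¬ j < n + 1 := fun h => hj (Finset.mem_range.2 h)
    simp only [q]
    rw [if_neg (by omega), if_neg (by omega), zero_smul]
  -- The `g j` are orthogonal but not normalised, hence the factor `‖g j‖`. The diagonal entry of a
  -- row is not zero in general, hence the `+ 1` in the truncation index.
  refine ⟨fun a j => q (Encodable.encode a) j * ‖g j‖, fun a => Encodable.encode a + 1,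
    fun a b n ha hb => ⟨fun j hj => ?_, ?_⟩⟩
  · simp only [q]
    have hj' : Encodable.encode a + 1 ≤ j := hj
    rw [if_neg (by omega), if_neg (by omega), zero_mul]
  · have h1 : inner ℝ (v (Encodable.encode a)) (v (Encodable.encode b)) = K a b := by
      rw [hin, hv, hv, hB1]
    rw [← h1, hexp _ n ha, hexp _ n hb, sum_inner]
    refine Finset.sum_congr rfl fun i hi => ?_
    rw [inner_sum, Finset.sum_eq_single_of_mem i hi]
    · rw [inner_smul_left, inner_smul_right, real_inner_self_eq_norm_sq]
      simp only [conj_trivial]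
      ring
    · intro j _ hji
      rw [inner_smul_left, inner_smul_right,
        InnerProductSpace.gramSchmidt_orthogonal ℝ v hji.symm]
      simp

end Factorization

/-! ### Absolute continuity and uniqueness of Gaussian laws. -/

section GaussianLaws

lemma measure_pi_absolutelyContinuous {n : ℕ} {μ ν : Fin n → Measure ℝ} [∀ i, SigmaFinite (μ i)]
    [∀ i, SigmaFinite (ν i)] (h : ∀ i, μ i ≪ ν i) : Measure.pi μ ≪ Measure.pi ν := by
  induction n with
  | zero => rw [Measure.pi_of_empty, Measure.pi_of_empty]
  | succ n ih =>
    have h1 := (measurePreserving_piFinSuccAbove μ 0).symm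
    have h2 := (measurePreserving_piFinSuccAbove ν 0).symm
    rw [← h1.map_eq, ← h2.map_eq]
    refine Measure.AbsolutelyContinuous.map ?_ h1.measurable
    exact (h 0).prod (ih fun i => h _)

/-- The image of a standard Gaussian vector under a surjective linear map has a density. -/
lemma map_pi_gaussianReal_absolutelyContinuous {W : Type*} [NormedAddCommGroup W] [NormedSpace ℝ W]
    [MeasurableSpace W] [BorelSpace W] (ν : Measure W) [ν.IsAddHaarMeasure] {n : ℕ}
    (T : (Fin n → ℝ) →ₗ[ℝ] W) (hT : Function.Surjective T) :
    (Measure.pi fun _ : Fin n => gaussianReal 0 1).map T ≪ ν := by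
  -- The factor `c` may be infinite when the kernel is nontrivial, which is harmless for absolute
  -- continuity.
  obtain ⟨c, _, hc⟩ := T.exists_map_addHaar_eq_smul_addHaar
    (Measure.pi fun _ : Fin n => (volume : Measure ℝ)) ν hT
  have hm : Measurable T := T.continuous_of_finiteDimensional.measurable
  have h1 : (Measure.pi fun _ : Fin n => gaussianReal 0 1).map T ≪
      (Measure.pi fun _ : Fin n => (volume : Measure ℝ)).map T :=
    (measure_pi_absolutelyContinuous fun _ =>
      gaussianReal_absolutelyContinuous 0 one_ne_zero).map hm
  rw [hc] at h1
  exact h1.trans (Measure.smul_absolutelyContinuous)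

variable {T E κ : Type*} [NormedAddCommGroup E] [NormedSpace ℝ E] [MeasurableSpace E]
  [BorelSpace E] [SecondCountableTopology E] [CompleteSpace E] [Fintype κ]

lemma memLp_two_eval_of_isGaussianProcess {T E : Type*} [NormedAddCommGroup E] [NormedSpace ℝ E]
    [MeasurableSpace E] [BorelSpace E] {P : Measure (T → E)}
    (hP : IsGaussianProcess (fun (t : T) (x : T → E) => x t) P) (φ : E →L[ℝ] ℝ) (t : T) :
    MemLp (fun x : T → E => φ (x t)) 2 P :=
  ((hP.hasGaussianLaw_eval t).map φ).memLp_two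

/-- Two centered Gaussian laws with the same covariances are equal. -/
lemma measure_eq_of_isGaussianProcess (φ : κ → E →L[ℝ] ℝ)
    (hφ : ∀ L : E →L[ℝ] ℝ, ∃ c : κ → ℝ, ∀ x, L x = ∑ a, c a * φ a x)
    {P Q : Measure (T → E)}
    (hP : IsGaussianProcess (fun (t : T) (x : T → E) => x t) P)
    (hQ : IsGaussianProcess (fun (t : T) (x : T → E) => x t) Q)
    (hP0 : ∀ t a, ∫ x, φ a (x t) ∂P = 0) (hQ0 : ∀ t a, ∫ x, φ a (x t) ∂Q = 0)
    (hPQ : ∀ s t a b, ∫ x, φ a (x s) * φ b (x t) ∂P = ∫ x, φ a (x s) * φ b (x t) ∂Q) :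
    P = Q := by
  classical
  have hfdd : ∀ I : Finset T, P.map I.restrict = Q.map I.restrict := by
    intro I
    have gP : IsGaussian (P.map I.restrict) := (hP.hasGaussianLaw I).isGaussian_map
    have gQ : IsGaussian (Q.map I.restrict) := (hQ.hasGaussianLaw I).isGaussian_map
    refine Measure.ext_of_charFunDual ?_
    ext L
    -- expand the functional in coordinates
    have hL : ∃ c : I → κ → ℝ, ∀ x : T → E, L (I.restrict x) =
        ∑ i : I, ∑ a, c i a * φ a (x i) := by
      choose c hc using fun i : I => hφ (L ∘L ContinuousLinearMap.single ℝ (fun _ : I => E) i)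
      refine ⟨c, fun x => ?_⟩
      conv_lhs => rw [← Finset.univ_sum_single (I.restrict x), map_sum]
      refine Finset.sum_congr rfl fun i _ => ?_
      rw [← hc]
      rfl
    obtain ⟨c, hc⟩ := hL
    -- A centred Gaussian characteristic function depends on the variance alone, and the variance of
    -- `L` is a quadratic expression in the covariances of the `φ a`.
    have hcalc : ∀ {ν : Measure (T → E)},
        IsGaussianProcess (fun (t : T) (x : T → E) => x t) ν →
        (∀ t a, ∫ x, φ a (x t) ∂ν = 0) →
        charFunDual (ν.map I.restrict) L = Complex.exp (-((∑ i : I, ∑ a, ∑ j : I, ∑ b,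
          c i a * c j b * (∫ x, φ a (x i) * φ b (x j) ∂ν) : ℝ) : ℂ) / 2) := by
      intro ν hν hν0
      have gν : IsGaussian (ν.map I.restrict) := (hν.hasGaussianLaw I).isGaussian_map
      have hm : AEMeasurable (I.restrict (π := fun _ => E)) ν :=
        (Finset.measurable_restrict I).aemeasurable
      have hLp : ∀ t a, MemLp (fun x : T → E => φ a (x t)) 2 ν := fun t a =>
        memLp_two_eval_of_isGaussianProcess hν (φ a) t
      have := hν.isProbabilityMeasure
      have h0 : ∫ y, L y ∂(ν.map I.restrict) = 0 := by
        rw [integral_map hm (by fun_prop)]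
        simp_rw [hc]
        have hi1 : ∀ (i : I) a, Integrable (fun x : T → E => c i a * φ a (x i)) ν := fun i a =>
          ((hLp i a).integrable (by norm_num)).const_mul _
        rw [integral_finsetSum _ fun i _ => integrable_finsetSum _ fun a _ => hi1 i a]
        refine Finset.sum_eq_zero fun i _ => ?_
        rw [integral_finsetSum _ fun a _ => hi1 i a]
        refine Finset.sum_eq_zero fun a _ => ?_
        rw [integral_const_mul, hν0, mul_zero]
      have hv : Var[L; ν.map I.restrict] = ∑ i : I, ∑ a, ∑ j : I, ∑ b,
          c i a * c j b * (∫ x, φ a (x i) * φ b (x j) ∂ν) := by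
        rw [variance_of_integral_eq_zero (by fun_prop) h0, integral_map hm (by fun_prop)]
        have hint : ∀ (i : I) a (j : I) b, Integrable (fun x : T → E =>
            c i a * c j b * (φ a (x i) * φ b (x j))) ν := fun i a j b =>
          ((hLp i a).integrable_mul (hLp j b)).const_mul _
        have e : ∀ x : T → E, L (I.restrict x) ^ 2 = ∑ i : I, ∑ a, ∑ j : I, ∑ b,
            c i a * c j b * (φ a (x i) * φ b (x j)) := by
          intro x
          rw [hc, sq, Finset.sum_mul]
          refine Finset.sum_congr rfl fun i _ => ?_
          rw [Finset.sum_mul]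
          refine Finset.sum_congr rfl fun a _ => ?_
          rw [Finset.mul_sum]
          refine Finset.sum_congr rfl fun j _ => ?_
          rw [Finset.mul_sum]
          refine Finset.sum_congr rfl fun b _ => by ring
        simp_rw [e]
        rw [integral_finsetSum _ fun i _ => integrable_finsetSum _ fun a _ =>
          integrable_finsetSum _ fun j _ => integrable_finsetSum _ fun b _ => hint i a j b]
        refine Finset.sum_congr rfl fun i _ => ?_
        rw [integral_finsetSum _ fun a _ =>
          integrable_finsetSum _ fun j _ => integrable_finsetSum _ fun b _ => hint i a j b]
        refine Finset.sum_congr rfl fun a _ => ?_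
        rw [integral_finsetSum _ fun j _ => integrable_finsetSum _ fun b _ => hint i a j b]
        refine Finset.sum_congr rfl fun j _ => ?_
        rw [integral_finsetSum _ fun b _ => hint i a j b]
        refine Finset.sum_congr rfl fun b _ => ?_
        rw [integral_const_mul]
      rw [IsGaussian.charFunDual_eq, integral_complex_ofReal, h0, hv]
      congr 1
      push_cast
      ring
    rw [hcalc hP hP0, hcalc hQ hQ0]
    simp_rw [hPQ]
  have := hP.isProbabilityMeasure
  have : ∀ I : Finset T, IsFiniteMeasure (P.map I.restrict) := fun I => inferInstance
  exact IsProjectiveLimit.unique (P := fun I => P.map I.restrict) (fun I => rfl)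
    fun I => (hfdd I).symm

end GaussianLaws

/-! ### Construction of the joint field from white noise. -/

section JointField

variable {d m : ℕ}

/-- The coordinate functionals of `ℝ^m`. -/
noncomputable def stateCoord (i : Fin m) : State m →L[ℝ] ℝ := EuclideanSpace.proj i

lemma stateCoord_apply (i : Fin m) (x : State m) : stateCoord i x = x i := rfl

lemma exists_stateCoord_expansion (L : State m →L[ℝ] ℝ) :
    ∃ c : Fin m → ℝ, ∀ x, L x = ∑ i, c i * stateCoord i x := by
  refine ⟨fun i => L (EuclideanSpace.single i 1), fun x => ?_⟩
  have h : x = ∑ i, x i • EuclideanSpace.single i (1 : ℝ) := by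
    ext j
    simp [Finset.sum_apply, Pi.single_apply]
  conv_lhs => rw [h, map_sum]
  refine Finset.sum_congr rfl fun i _ => ?_
  rw [map_smul, smul_eq_mul, mul_comm, stateCoord_apply]

/-- The coordinate functionals of `ℝ^m × ℝ^m`. -/
noncomputable def jointCoord : Fin m ⊕ Fin m → (State m × State m →L[ℝ] ℝ) :=
  Sum.elim (fun i => stateCoord i ∘L ContinuousLinearMap.fst ℝ _ _)
    (fun i => stateCoord i ∘L ContinuousLinearMap.snd ℝ _ _)

lemma jointCoord_inl (i : Fin m) (x : State m × State m) : jointCoord (Sum.inl i) x = x.1 i := rfl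

lemma jointCoord_inr (i : Fin m) (x : State m × State m) : jointCoord (Sum.inr i) x = x.2 i := rfl

/-- The element of `ℝ^m × ℝ^m` with given coordinates. -/
noncomputable def jointMk : (Fin m ⊕ Fin m → ℝ) →ₗ[ℝ] State m × State m where
  toFun v := (WithLp.toLp 2 fun i => v (Sum.inl i), WithLp.toLp 2 fun i => v (Sum.inr i))
  map_add' _ _ := rfl
  map_smul' _ _ := rfl

lemma jointCoord_jointMk (v : Fin m ⊕ Fin m → ℝ) (a : Fin m ⊕ Fin m) :
    jointCoord a (jointMk v) = v a := by
  rcases a with i | i <;> rfl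

lemma jointMk_jointCoord (x : State m × State m) : jointMk (fun a => jointCoord a x) = x := rfl

lemma eq_of_jointCoord_eq {x y : State m × State m} (h : ∀ a, jointCoord a x = jointCoord a y) :
    x = y := by
  rw [← jointMk_jointCoord x, ← jointMk_jointCoord y]
  simp_rw [h]

lemma linearMap_eq_sum_jointCoord (L : State m × State m →ₗ[ℝ] ℝ) (x : State m × State m) :
    L x = ∑ a, L (jointMk (Pi.single a 1)) * jointCoord a x := by
  conv_lhs => rw [← jointMk_jointCoord x, ← LinearMap.comp_apply, LinearMap.pi_apply_eq_sum_univ]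
  refine Finset.sum_congr rfl fun a _ => ?_
  have : (fun j => if a = j then (1 : ℝ) else 0) = Pi.single a 1 := by
    ext b
    simp [Pi.single_apply, eq_comm]
  rw [this, smul_eq_mul, mul_comm, LinearMap.comp_apply]

lemma exists_jointCoord_expansion (L : State m × State m →L[ℝ] ℝ) :
    ∃ c : Fin m ⊕ Fin m → ℝ, ∀ x, L x = ∑ a, c a * jointCoord a x :=
  ⟨fun a => L (jointMk (Pi.single a 1)), fun x => linearMap_eq_sum_jointCoord L.toLinearMap x⟩

/-- The law of a sequence of independent standard Gaussian variables. -/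
noncomputable def whiteNoise : Measure (ℕ → ℝ) := Measure.infinitePi fun _ => gaussianReal 0 1

instance : IsProbabilityMeasure whiteNoise := by unfold whiteNoise; infer_instance

lemma hasLaw_eval_whiteNoise (j : ℕ) : whiteNoise.map (fun y => y j) = gaussianReal 0 1 :=
  Measure.infinitePi_map_eval (fun _ : ℕ => gaussianReal 0 1) j

lemma iIndepFun_whiteNoise : iIndepFun (fun (j : ℕ) (y : ℕ → ℝ) => y j) whiteNoise :=
  iIndepFun_infinitePi (X := fun _ x => x) fun _ => measurable_id

lemma isGaussianProcess_whiteNoise :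
    IsGaussianProcess (fun (j : ℕ) (y : ℕ → ℝ) => y j) whiteNoise where
  hasGaussianLaw I := by
    refine iIndepFun.hasGaussianLaw (X := fun (j : I) (y : ℕ → ℝ) => y j) (fun j => ⟨?_⟩)
      (iIndepFun_whiteNoise.precomp Subtype.val_injective)
    rw [hasLaw_eval_whiteNoise]
    infer_instance

lemma memLp_eval_whiteNoise (j : ℕ) : MemLp (fun y : ℕ → ℝ => y j) 2 whiteNoise :=
  (isGaussianProcess_whiteNoise.hasGaussianLaw_eval j).memLp_two

lemma integral_eval_whiteNoise (j : ℕ) : ∫ y, y j ∂whiteNoise = 0 := by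
  have h := integral_map (μ := whiteNoise) (φ := fun y => y j) (f := fun x : ℝ => x)
    (measurable_pi_apply j).aemeasurable (by fun_prop)
  rw [hasLaw_eval_whiteNoise, integral_id_gaussianReal] at h
  exact h.symm

lemma integral_eval_mul_eval_whiteNoise (j k : ℕ) :
    ∫ y, y j * y k ∂whiteNoise = if j = k then 1 else 0 := by
  split_ifs with h
  · subst h
    have h1 := integral_map (μ := whiteNoise) (φ := fun y => y j) (f := fun x : ℝ => x * x)
      (measurable_pi_apply j).aemeasurable (by fun_prop)
    rw [hasLaw_eval_whiteNoise] at h1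
    rw [← h1]
    have h2 := variance_id_gaussianReal (μ := 0) (v := 1)
    rw [variance_of_integral_eq_zero (by fun_prop) (by simp)] at h2
    simpa [sq] using h2
  · have h1 := (iIndepFun_whiteNoise.indepFun h).integral_fun_mul_eq_mul_integral
      (memLp_eval_whiteNoise j).1 (memLp_eval_whiteNoise k).1
    rw [h1, integral_eval_whiteNoise, zero_mul]

/-- The finite linear combinations of white noise with coefficients `l`. -/
noncomputable def noiseSum {A : Type*} (l : A → ℕ → ℝ) (n : ℕ) (a : A) (y : ℕ → ℝ) : ℝ :=
  ∑ j ∈ Finset.range n, l a j * y j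

lemma noiseSum_eq_of_le {A : Type*} {l : A → ℕ → ℝ} {N : ℕ} {a : A}
    (hl : ∀ j, N ≤ j → l a j = 0) {n : ℕ} (hn : N ≤ n) (y : ℕ → ℝ) :
    noiseSum l N a y = noiseSum l n a y := by
  refine Finset.sum_subset (Finset.range_mono hn) fun j _ hj => ?_
  rw [hl j (by simpa using hj), zero_mul]

lemma integral_noiseSum_mul {A : Type*} (l : A → ℕ → ℝ) (n : ℕ) (a b : A) :
    ∫ y, noiseSum l n a y * noiseSum l n b y ∂whiteNoise =
      ∑ j ∈ Finset.range n, l a j * l b j := by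
  have hi : ∀ j k, Integrable (fun y : ℕ → ℝ => l a j * l b k * (y j * y k)) whiteNoise :=
    fun j k => ((memLp_eval_whiteNoise j).integrable_mul (memLp_eval_whiteNoise k)).const_mul _
  have e : ∀ y, noiseSum l n a y * noiseSum l n b y =
      ∑ j ∈ Finset.range n, ∑ k ∈ Finset.range n, l a j * l b k * (y j * y k) := by
    intro y
    rw [noiseSum, noiseSum, Finset.sum_mul_sum]
    exact Finset.sum_congr rfl fun j _ => Finset.sum_congr rfl fun k _ => by ring
  simp_rw [e]
  rw [integral_finsetSum _ fun j _ => integrable_finsetSum _ fun k _ => hi j k]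
  refine Finset.sum_congr rfl fun j hj => ?_
  rw [integral_finsetSum _ fun k _ => hi j k, Finset.sum_eq_single_of_mem j hj]
  · rw [integral_const_mul, integral_eval_mul_eval_whiteNoise, if_pos rfl, mul_one]
  · intro k _ hkj
    rw [integral_const_mul, integral_eval_mul_eval_whiteNoise, if_neg hkj.symm, mul_zero]

lemma integral_noiseSum {A : Type*} (l : A → ℕ → ℝ) (n : ℕ) (a : A) :
    ∫ y, noiseSum l n a y ∂whiteNoise = 0 := by
  unfold noiseSum
  rw [integral_finsetSum _ fun j _ =>
    ((memLp_eval_whiteNoise j).integrable (by norm_num)).const_mul _]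
  refine Finset.sum_eq_zero fun j _ => ?_
  rw [integral_const_mul, integral_eval_whiteNoise, mul_zero]

lemma measurable_noiseSum {A : Type*} (l : A → ℕ → ℝ) (n : ℕ) (a : A) :
    Measurable (noiseSum l n a) := by
  unfold noiseSum
  fun_prop

lemma map_whiteNoise_restrict (n : ℕ) :
    whiteNoise.map (fun y (j : Fin n) => y j) = Measure.pi fun _ : Fin n => gaussianReal 0 1 := by
  have h := Measure.map_infinitePi_infinitePi_of_inj (P := fun _ : ℕ => gaussianReal 0 1)
    (f := fun j : Fin n => (j : ℕ)) Fin.val_injective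
  rw [← Measure.infinitePi_eq_pi]
  exact h

/-- The values on `S` of the field with coefficients `l`, as functions of the white noise. -/
noncomputable def noiseMap (l : Site d × (Fin m ⊕ Fin m) → ℕ → ℝ) (n : ℕ) (S : Finset (Site d)) :
    (Fin n → ℝ) →ₗ[ℝ] (S → State m × State m) :=
  LinearMap.pi fun t : S => jointMk ∘ₗ LinearMap.pi fun a =>
    ∑ j : Fin n, l (t, a) j • LinearMap.proj j

lemma noiseMap_apply (l : Site d × (Fin m ⊕ Fin m) → ℕ → ℝ) (n : ℕ) (S : Finset (Site d))
    (z : Fin n → ℝ) (t : S) :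
    noiseMap l n S z t = jointMk fun a => ∑ j : Fin n, l (t, a) j * z j := by
  refine eq_of_jointCoord_eq fun a => ?_
  rw [noiseMap, LinearMap.pi_apply, LinearMap.comp_apply, jointCoord_jointMk, jointCoord_jointMk]
  simp only [LinearMap.pi_apply, LinearMap.sum_apply, LinearMap.smul_apply, LinearMap.proj_apply,
    smul_eq_mul]

/-- If the range were proper, a nonzero functional would vanish on it. Evaluated at the noise vector
built from its own coefficients `c`, this functional gives the quadratic form at `c`, which is
positive. -/
lemma surjective_noiseMap (l : Site d × (Fin m ⊕ Fin m) → ℕ → ℝ) (n : ℕ) (S : Finset (Site d))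
    (hpos : ∀ c : Site d × (Fin m ⊕ Fin m) → ℝ, (∃ p ∈ S ×ˢ Finset.univ, c p ≠ 0) →
      0 < ∑ p ∈ S ×ˢ Finset.univ, ∑ q ∈ S ×ˢ Finset.univ,
        c p * c q * ∑ j ∈ Finset.range n, l p j * l q j) :
    Function.Surjective (noiseMap l n S) := by
  classical
  set T := noiseMap l n S with hTdef
  by_contra hsurj
  have hlt : LinearMap.range T < ⊤ :=
    lt_top_iff_ne_top.2 fun h => hsurj (LinearMap.range_eq_top.1 h)
  obtain ⟨f, hf0, hf⟩ := Submodule.exists_le_ker_of_lt_top _ hlt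
  let c : Site d × (Fin m ⊕ Fin m) → ℝ := fun p =>
    if h : p.1 ∈ S then f (Pi.single ⟨p.1, h⟩ (jointMk (Pi.single p.2 1))) else 0
  have hfc : ∀ w, f w = ∑ t : S, ∑ a, c (t, a) * jointCoord a (w t) := by
    intro w
    conv_lhs => rw [← Finset.univ_sum_single w, map_sum]
    refine Finset.sum_congr rfl fun t _ => ?_
    refine (linearMap_eq_sum_jointCoord
      (f ∘ₗ LinearMap.single ℝ (fun _ : S => State m × State m) t) (w t)).trans ?_
    refine Finset.sum_congr rfl fun a _ => ?_
    congr 1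
    simp only [c]
    rw [dif_pos t.2]
    rfl
  set F : Finset (Site d × (Fin m ⊕ Fin m)) := S ×ˢ Finset.univ with hF
  have hsumF : ∀ g : Site d × (Fin m ⊕ Fin m) → ℝ, ∑ t : S, ∑ a, g (t, a) = ∑ p ∈ F, g p := by
    intro g
    rw [hF, Finset.sum_product, ← Finset.sum_coe_sort S]
  have hne : ∃ p ∈ F, c p ≠ 0 := by
    by_contra! hall
    refine hf0 (LinearMap.ext fun w => ?_)
    rw [hfc, LinearMap.zero_apply]
    refine Finset.sum_eq_zero fun t _ => Finset.sum_eq_zero fun a _ => ?_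
    rw [hall (t, a) (Finset.mem_product.2 ⟨t.2, Finset.mem_univ _⟩), zero_mul]
  let z : Fin n → ℝ := fun j => ∑ p ∈ F, c p * l p j
  have h0 : f (T z) = 0 := hf (LinearMap.mem_range_self T z)
  have h1 : f (T z) = ∑ p ∈ F, ∑ q ∈ F, c p * c q * ∑ j ∈ Finset.range n, l p j * l q j := by
    rw [hfc]
    simp_rw [hTdef, noiseMap_apply, jointCoord_jointMk]
    rw [hsumF fun p => c p * ∑ j : Fin n, l p j * z j]
    refine Finset.sum_congr rfl fun p _ => ?_
    have e : ∑ j : Fin n, l p j * z j = ∑ q ∈ F, c q * ∑ j : Fin n, l p j * l q j := by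
      simp only [z, Finset.mul_sum]
      rw [Finset.sum_comm]
      exact Finset.sum_congr rfl fun q _ => Finset.sum_congr rfl fun j _ => by ring
    rw [e, Finset.mul_sum]
    refine Finset.sum_congr rfl fun q _ => ?_
    rw [Finset.sum_range fun j => l p j * l q j]
    ring
  exact (hpos c hne).ne' (h1.symm.trans h0)

/-- Existence of a stationary Gaussian joint field with a prescribed strictly positive definite
covariance; its finite dimensional distributions have densities. -/
theorem exists_isStationaryGaussian (K : Site d × (Fin m ⊕ Fin m) → Site d × (Fin m ⊕ Fin m) → ℝ)
    (hsymm : ∀ p q, K p q = K q p)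
    (hpos : ∀ (F : Finset (Site d × (Fin m ⊕ Fin m))) (c : Site d × (Fin m ⊕ Fin m) → ℝ),
      (∃ a ∈ F, c a ≠ 0) → 0 < ∑ a ∈ F, ∑ b ∈ F, c a * c b * K a b)
    (hshift : ∀ s t u a b, K (s + u, a) (t + u, b) = K (s, a) (t, b)) :
    ∃ π : Measure (Site d → State m × State m), IsStationaryGaussian π ∧ HasFiniteDimDensities π ∧
      ∀ s t a b, ∫ ω, jointCoord a (ω s) * jointCoord b (ω t) ∂π = K (s, a) (t, b) := by
  classical
  obtain ⟨l, N, hlN⟩ := exists_factorization K hsymm hpos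
  have hl : ∀ p j, N p ≤ j → l p j = 0 := fun p => (hlN p p (N p) le_rfl le_rfl).1
  have hK : ∀ p q n, N p ≤ n → N q ≤ n → ∑ j ∈ Finset.range n, l p j * l q j = K p q :=
    fun p q n hp hq => (hlN p q n hp hq).2
  -- One truncation level per site, valid for all `2m` coordinates; the sum is a convenient upper
  -- bound.
  obtain ⟨Nt, hNle⟩ : ∃ Nt : Site d → ℕ, ∀ t a, N (t, a) ≤ Nt t :=
    ⟨fun t => ∑ a, N (t, a), fun t a => Finset.single_le_sum (f := fun a => N (t, a))
      (fun _ _ => Nat.zero_le _) (Finset.mem_univ a)⟩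
  obtain ⟨Y, hY⟩ : ∃ Y : Site d → (ℕ → ℝ) → State m × State m,
      ∀ t, Y t = fun y => jointMk fun a => noiseSum l (Nt t) (t, a) y := ⟨_, fun _ => rfl⟩
  have hYc : ∀ t a y n, Nt t ≤ n → jointCoord a (Y t y) = noiseSum l n (t, a) y := by
    intro t a y n hn
    rw [hY, jointCoord_jointMk, ← noiseSum_eq_of_le (fun j => hl (t, a) j) (hNle t a),
      ← noiseSum_eq_of_le (fun j => hl (t, a) j) ((hNle t a).trans hn)]
  have hjm : Measurable (jointMk (m := m)) :=
    (jointMk (m := m)).continuous_of_finiteDimensional.measurable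
  have hYm : ∀ t, Measurable (Y t) := fun t => by
    rw [hY]
    exact hjm.comp (measurable_pi_lambda _ fun a => measurable_noiseSum _ _ _)
  have hYm' : Measurable fun y t => Y t y := measurable_pi_lambda _ hYm
  obtain ⟨π, hπ⟩ : ∃ π, π = whiteNoise.map (fun y t => Y t y) := ⟨_, rfl⟩
  have : IsProbabilityMeasure π := hπ ▸ Measure.isProbabilityMeasure_map hYm'.aemeasurable
  have hYG : IsGaussianProcess Y whiteNoise := by
    refine isGaussianProcess_whiteNoise.of_isGaussianProcess fun t => ⟨Finset.range (Nt t),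
      LinearMap.toContinuousLinearMap (jointMk ∘ₗ LinearMap.pi fun a =>
        ∑ j : Finset.range (Nt t), l (t, a) j • LinearMap.proj j), fun y => ?_⟩
    refine eq_of_jointCoord_eq fun a => ?_
    rw [LinearMap.coe_toContinuousLinearMap', LinearMap.comp_apply, hY, jointCoord_jointMk,
      jointCoord_jointMk]
    simp only [LinearMap.pi_apply, LinearMap.sum_apply, LinearMap.smul_apply, LinearMap.proj_apply,
      smul_eq_mul, noiseSum, Finset.restrict]
    exact (Finset.sum_coe_sort (Finset.range (Nt t)) fun j => l (t, a) j * y j).symm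
  have hG : IsGaussianProcess (fun (t : Site d) (x : Site d → State m × State m) => x t) π := by
    refine ⟨fun I => ⟨?_⟩⟩
    rw [hπ, Measure.map_map (Finset.measurable_restrict I) hYm']
    exact (hYG.hasGaussianLaw I).isGaussian_map
  have hcov : ∀ s t a b, ∫ ω, jointCoord a (ω s) * jointCoord b (ω t) ∂π = K (s, a) (t, b) := by
    intro s t a b
    have hm : Measurable fun ω : Site d → State m × State m =>
        jointCoord a (ω s) * jointCoord b (ω t) :=
      ((jointCoord a).measurable.comp (measurable_pi_apply s)).mul
        ((jointCoord b).measurable.comp (measurable_pi_apply t))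
    rw [hπ, integral_map hYm'.aemeasurable hm.aestronglyMeasurable]
    have e : ∀ y, jointCoord a (Y s y) * jointCoord b (Y t y) =
        noiseSum l (Nt s + Nt t) (s, a) y * noiseSum l (Nt s + Nt t) (t, b) y := fun y => by
      rw [hYc s a y _ (Nat.le_add_right _ _), hYc t b y _ (Nat.le_add_left _ _)]
    refine (integral_congr_ae (ae_of_all _ e)).trans ((integral_noiseSum_mul l _ _ _).trans ?_)
    exact hK _ _ _ ((hNle s a).trans (Nat.le_add_right _ _))
      ((hNle t b).trans (Nat.le_add_left _ _))
  have hmean : ∀ t a, ∫ ω, jointCoord a (ω t) ∂π = 0 := by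
    intro t a
    have hm : Measurable fun ω : Site d → State m × State m => jointCoord a (ω t) :=
      (jointCoord a).measurable.comp (measurable_pi_apply t)
    rw [hπ, integral_map hYm'.aemeasurable hm.aestronglyMeasurable]
    exact (integral_congr_ae (ae_of_all _ fun y => hYc t a y _ le_rfl)).trans
      (integral_noiseSum _ _ _)
  refine ⟨π, ⟨hG, fun t => ?_, fun u => ?_⟩, fun S => ?_, hcov⟩
  · refine eq_of_jointCoord_eq fun a => ?_
    rw [← ContinuousLinearMap.integral_comp_comm _ (hG.hasGaussianLaw_eval t).integrable, hmean,
      map_zero]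
  -- The shifted law is centred Gaussian with the same covariances by `hshift`, so uniqueness gives
  -- stationarity.
  · have hsm : Measurable fun (x : Site d → State m × State m) t => x (t + u) := by fun_prop
    refine measure_eq_of_isGaussianProcess jointCoord exists_jointCoord_expansion ?_ hG
      (fun t a => ?_) hmean fun s t a b => ?_
    · refine ⟨fun I => ⟨?_⟩⟩
      rw [Measure.map_map (Finset.measurable_restrict I) hsm]
      exact ((hG.comp_right fun t => t + u).hasGaussianLaw I).isGaussian_map
    · have hm : Measurable fun ω : Site d → State m × State m => jointCoord a (ω t) :=
        (jointCoord a).measurable.comp (measurable_pi_apply t)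
      rw [integral_map hsm.aemeasurable hm.aestronglyMeasurable]
      exact hmean _ a
    · have hm : Measurable fun ω : Site d → State m × State m =>
          jointCoord a (ω s) * jointCoord b (ω t) :=
        ((jointCoord a).measurable.comp (measurable_pi_apply s)).mul
          ((jointCoord b).measurable.comp (measurable_pi_apply t))
      rw [integral_map hsm.aemeasurable hm.aestronglyMeasurable, hcov, hcov, hshift]
  -- With `n` noise variables enough for every site of `S`, the restriction to `S` is a linear image
  -- of a standard Gaussian vector, and `hpos` makes that linear map onto.
  · set n := ∑ t ∈ S, Nt t with hn
    have hNn : ∀ t ∈ S, Nt t ≤ n := fun t ht =>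
      Finset.single_le_sum (f := Nt) (fun _ _ => Nat.zero_le _) ht
    set T := noiseMap l n S with hTdef
    have hTm : Measurable T := T.continuous_of_finiteDimensional.measurable
    have hlaw : π.map (fun ω (t : S) => ω t) =
        (Measure.pi fun _ : Fin n => gaussianReal 0 1).map T := by
      rw [← map_whiteNoise_restrict, hπ, Measure.map_map (by fun_prop) hYm',
        Measure.map_map hTm (by fun_prop)]
      congr 1
      ext1 y
      funext t
      simp only [Function.comp]
      rw [hTdef, noiseMap_apply]
      refine eq_of_jointCoord_eq fun a => ?_
      rw [hYc t a y n (hNn t t.2), jointCoord_jointMk, noiseSum,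
        Finset.sum_range fun j => l (t, a) j * y j]
    rw [hlaw]
    have hH1 : (volume : Measure (State m × State m)).IsAddHaarMeasure :=
      inferInstanceAs (Measure.prod volume volume).IsAddHaarMeasure
    have hH : (volume : Measure (S → State m × State m)).IsAddHaarMeasure :=
      Measure.pi.isAddHaarMeasure fun _ => volume
    refine map_pi_gaussianReal_absolutelyContinuous volume T ?_
    refine surjective_noiseMap l n S fun c hc => ?_
    have hple : ∀ p ∈ S ×ˢ Finset.univ, N p ≤ n := fun p hp =>
      (hNle p.1 p.2).trans (hNn p.1 (Finset.mem_product.1 hp).1)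
    refine (hpos _ c hc).trans_eq (Finset.sum_congr rfl fun p hp => Finset.sum_congr rfl
      fun q hq => ?_)
    rw [hK p q n (hple p hp) (hple q hq)]

end JointField

/-! ### Bounds on the density versus bounds on the Toeplitz forms. -/

section SpectralBounds

variable {d : ℕ} {ι : Type*}

lemma spectralCoeff_sub {Ψ Ψ' : (Fin d → ℝ) → Matrix ι ι ℂ}
    (hΨ : ∀ i j, Integrable (fun θ => Ψ θ i j) (torusMeasure d))
    (hΨ' : ∀ i j, Integrable (fun θ => Ψ' θ i j) (torusMeasure d)) (k : Site d) :
    spectralCoeff (fun θ => Ψ θ - Ψ' θ) k = spectralCoeff Ψ k - spectralCoeff Ψ' k := by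
  ext i j
  simp only [spectralCoeff, Matrix.of_apply, Matrix.sub_apply, sub_mul]
  exact integral_sub (integrable_mul_character (hΨ i j) _) (integrable_mul_character (hΨ' i j) _)

lemma spectralCoeff_add {Ψ Ψ' : (Fin d → ℝ) → Matrix ι ι ℂ}
    (hΨ : ∀ i j, Integrable (fun θ => Ψ θ i j) (torusMeasure d))
    (hΨ' : ∀ i j, Integrable (fun θ => Ψ' θ i j) (torusMeasure d)) (k : Site d) :
    spectralCoeff (fun θ => Ψ θ + Ψ' θ) k = spectralCoeff Ψ k + spectralCoeff Ψ' k := by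
  ext i j
  simp only [spectralCoeff, Matrix.of_apply, Matrix.add_apply, add_mul]
  exact integral_add (integrable_mul_character (hΨ i j) _) (integrable_mul_character (hΨ' i j) _)

lemma spectralCoeff_const [DecidableEq ι] (a : ℂ) (k : Site d) :
    spectralCoeff (fun _ => a • (1 : Matrix ι ι ℂ)) k =
      if k = 0 then a • (1 : Matrix ι ι ℂ) else 0 := by
  ext i j
  simp only [spectralCoeff, Matrix.of_apply]
  rw [integral_const_mul, integral_character]
  by_cases hk : k = 0 <;> simp [hk]

lemma spectralCoeff_conjTranspose (Ψ : (Fin d → ℝ) → Matrix ι ι ℂ) (k : Site d) :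
    spectralCoeff (fun θ => (Ψ θ)ᴴ) k = (spectralCoeff Ψ (-k))ᴴ := by
  ext i j
  simp only [spectralCoeff, Matrix.of_apply, Matrix.conjTranspose_apply]
  rw [← starRingEnd_apply, ← integral_conj]
  refine integral_congr_ae (ae_of_all _ fun θ => ?_)
  simp only [map_mul, conj_character, neg_neg]
  rfl

variable [Fintype ι]

lemma sum_spectralCoeff_const [DecidableEq ι] (a : ℂ) (F : Finset (Site d))
    (c : Site d → ι → ℂ) :
    ∑ s ∈ F, ∑ r ∈ F, ∑ i, ∑ j, c s i * (starRingEnd ℂ) (c r j) *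
      spectralCoeff (fun _ => a • (1 : Matrix ι ι ℂ)) (s - r) i j =
      a * ∑ s ∈ F, ∑ i, ((‖c s i‖ ^ 2 : ℝ) : ℂ) := by
  rw [Finset.mul_sum]
  refine Finset.sum_congr rfl fun s hs => ?_
  rw [Finset.sum_eq_single_of_mem s hs, Finset.mul_sum]
  · refine Finset.sum_congr rfl fun i _ => ?_
    rw [Finset.sum_eq_single_of_mem i (Finset.mem_univ i)]
    · rw [sub_self, spectralCoeff_const, if_pos rfl, Matrix.smul_apply, Matrix.one_apply_eq,
        Complex.mul_conj, Complex.normSq_eq_norm_sq, smul_eq_mul]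
      ring
    · intro j _ hj
      rw [sub_self, spectralCoeff_const, if_pos rfl, Matrix.smul_apply, Matrix.one_apply_ne hj.symm,
        smul_zero, mul_zero]
  · intro r _ hr
    refine Finset.sum_eq_zero fun i _ => Finset.sum_eq_zero fun j _ => ?_
    rw [spectralCoeff_const, if_neg (sub_ne_zero.2 hr.symm), Matrix.zero_apply, mul_zero]

lemma re_sum_spectralCoeff_nonneg {Ψ : (Fin d → ℝ) → Matrix ι ι ℂ}
    (hΨ : ∀ i j, Integrable (fun θ => Ψ θ i j) (torusMeasure d))
    (hpos : ∀ᵐ θ ∂(torusMeasure d), (Ψ θ).PosSemidef) (F : Finset (Site d))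
    (c : Site d → ι → ℂ) :
    0 ≤ (∑ s ∈ F, ∑ r ∈ F, ∑ i, ∑ j,
      c s i * (starRingEnd ℂ) (c r j) * spectralCoeff Ψ (s - r) i j).re := by
  rw [sum_spectralCoeff_eq_integral hΨ]
  refine (Complex.le_def.1 (integral_nonneg_of_ae ?_)).1
  filter_upwards [hpos] with θ hθ
  exact hθ.dotProduct_mulVec_nonneg _

/-- The constant density `a I` has Toeplitz form `a ∑ ‖c‖²` by orthogonality of characters; the
difference with `Ψ` has a nonnegative form. -/
lemma le_re_sum_spectralCoeff [DecidableEq ι] {Ψ : (Fin d → ℝ) → Matrix ι ι ℂ} {a : ℝ}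
    (hΨ : ∀ i j, Integrable (fun θ => Ψ θ i j) (torusMeasure d))
    (hpos : ∀ᵐ θ ∂(torusMeasure d), (Ψ θ - (a : ℂ) • (1 : Matrix ι ι ℂ)).PosSemidef)
    (F : Finset (Site d)) (c : Site d → ι → ℂ) :
    a * ∑ s ∈ F, ∑ i, ‖c s i‖ ^ 2 ≤ (∑ s ∈ F, ∑ r ∈ F, ∑ i, ∑ j,
      c s i * (starRingEnd ℂ) (c r j) * spectralCoeff Ψ (s - r) i j).re := by
  have h := re_sum_spectralCoeff_nonneg (Ψ := fun θ => Ψ θ - (a : ℂ) • (1 : Matrix ι ι ℂ))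
    (fun i j => (hΨ i j).sub (integrable_const _)) hpos F c
  have e : ∀ k i j, spectralCoeff (fun θ => Ψ θ - (a : ℂ) • (1 : Matrix ι ι ℂ)) k i j =
      spectralCoeff Ψ k i j - spectralCoeff (fun _ => (a : ℂ) • (1 : Matrix ι ι ℂ)) k i j := by
    intro k i j
    rw [spectralCoeff_sub (Ψ' := fun _ => (a : ℂ) • (1 : Matrix ι ι ℂ)) hΨ
      fun i j => integrable_const _, Matrix.sub_apply]
  simp only [e, mul_sub, Finset.sum_sub_distrib] at h
  rw [sum_spectralCoeff_const, Complex.sub_re, Complex.re_ofReal_mul] at h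
  simp only [← Complex.ofReal_sum, Complex.ofReal_re] at h
  linarith

lemma re_sum_spectralCoeff_le [DecidableEq ι] {Ψ : (Fin d → ℝ) → Matrix ι ι ℂ} {a : ℝ}
    (hΨ : ∀ i j, Integrable (fun θ => Ψ θ i j) (torusMeasure d))
    (hpos : ∀ᵐ θ ∂(torusMeasure d), ((a : ℂ) • (1 : Matrix ι ι ℂ) - Ψ θ).PosSemidef)
    (F : Finset (Site d)) (c : Site d → ι → ℂ) :
    (∑ s ∈ F, ∑ r ∈ F, ∑ i, ∑ j,
      c s i * (starRingEnd ℂ) (c r j) * spectralCoeff Ψ (s - r) i j).re ≤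
      a * ∑ s ∈ F, ∑ i, ‖c s i‖ ^ 2 := by
  have h := re_sum_spectralCoeff_nonneg (Ψ := fun θ => (a : ℂ) • (1 : Matrix ι ι ℂ) - Ψ θ)
    (fun i j => (integrable_const _).sub (hΨ i j)) hpos F c
  have e : ∀ k i j, spectralCoeff (fun θ => (a : ℂ) • (1 : Matrix ι ι ℂ) - Ψ θ) k i j =
      spectralCoeff (fun _ => (a : ℂ) • (1 : Matrix ι ι ℂ)) k i j - spectralCoeff Ψ k i j := by
    intro k i j
    rw [spectralCoeff_sub (Ψ := fun _ => (a : ℂ) • (1 : Matrix ι ι ℂ))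
      (fun i j => integrable_const _) hΨ, Matrix.sub_apply]
  simp only [e, mul_sub, Finset.sum_sub_distrib] at h
  rw [sum_spectralCoeff_const, Complex.sub_re, Complex.re_ofReal_mul] at h
  simp only [← Complex.ofReal_sum, Complex.ofReal_re] at h
  linarith

lemma memLp_star_dotProduct_mulVec {Ψ : (Fin d → ℝ) → Matrix ι ι ℂ} {q : ℝ≥0∞}
    (hΨ : ∀ i j, MemLp (fun θ => Ψ θ i j) q (torusMeasure d)) (v : ι → ℂ) :
    MemLp (fun θ => star v ⬝ᵥ (Ψ θ *ᵥ v)) q (torusMeasure d) := by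
  have h : MemLp (fun θ => ∑ i, ∑ j, star (v i) * v j * Ψ θ i j) q (torusMeasure d) :=
    memLp_finsetSum _ fun i _ => memLp_finsetSum _ fun j _ => (hΨ i j).const_mul _
  refine h.ae_eq (ae_of_all _ fun θ => ?_)
  simp only [dotProduct, mulVec, Pi.star_apply, Finset.mul_sum]
  exact Finset.sum_congr rfl fun i _ => Finset.sum_congr rfl fun j _ => by ring

/-- Coefficients proportional to a fixed `v` give a scalar trigonometric polynomial times `v`. This
reduces positivity of a matrix density to scalar positivity in each direction; the double
conjugation matches the form in `sum_spectralCoeff_eq_integral`. -/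
lemma star_dotProduct_mulVec_trigPoly (A : Matrix ι ι ℂ) (v : ι → ℂ) (F : Finset (Site d))
    (a : Site d → ℂ) (θ : Fin d → ℝ) :
    star (fun j => ∑ s ∈ F, (starRingEnd ℂ) ((starRingEnd ℂ) (a s * v j)) * character s θ) ⬝ᵥ
      (A *ᵥ fun j => ∑ s ∈ F, (starRingEnd ℂ) ((starRingEnd ℂ) (a s * v j)) * character s θ) =
      ((‖∑ k ∈ F, a k * character k θ‖ ^ 2 : ℝ) : ℂ) * (star v ⬝ᵥ (A *ᵥ v)) := by
  have hw : (fun j => ∑ s ∈ F, (starRingEnd ℂ) ((starRingEnd ℂ) (a s * v j)) *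
      character s θ) = (∑ k ∈ F, a k * character k θ) • v := by
    funext j
    rw [Pi.smul_apply, smul_eq_mul, Finset.sum_mul]
    refine Finset.sum_congr rfl fun s _ => ?_
    rw [Complex.conj_conj]
    ring
  rw [hw, star_smul, mulVec_smul, smul_dotProduct, dotProduct_smul, smul_eq_mul, smul_eq_mul,
    ← mul_assoc, ← starRingEnd_apply, Complex.conj_mul', Complex.ofReal_pow]

lemma ae_nonneg_re_star_dotProduct_mulVec {Ψ : (Fin d → ℝ) → Matrix ι ι ℂ}
    (hΨ : ∀ i j, MemLp (fun θ => Ψ θ i j) 2 (torusMeasure d))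
    (hpos : ∀ (F : Finset (Site d)) (c : Site d → ι → ℂ), 0 ≤ (∑ s ∈ F, ∑ r ∈ F, ∑ i, ∑ j,
      c s i * (starRingEnd ℂ) (c r j) * spectralCoeff Ψ (s - r) i j).re) (v : ι → ℂ) :
    ∀ᵐ θ ∂(torusMeasure d), 0 ≤ (star v ⬝ᵥ (Ψ θ *ᵥ v)).re := by
  have hf := memLp_star_dotProduct_mulVec hΨ v
  refine ae_nonneg_of_integral_trigPoly_mul_nonneg hf.re fun F a => ?_
  have h := hpos F fun s j => (starRingEnd ℂ) (a s * v j)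
  rw [sum_spectralCoeff_eq_integral fun i j => (hΨ i j).integrable (by norm_num)] at h
  simp_rw [star_dotProduct_mulVec_trigPoly] at h
  have hi : Integrable (fun θ => ((‖∑ k ∈ F, a k * character k θ‖ ^ 2 : ℝ) : ℂ) *
      (star v ⬝ᵥ (Ψ θ *ᵥ v))) (torusMeasure d) := by
    refine (hf.integrable (by norm_num)).bdd_mul (c := (∑ k ∈ F, ‖a k‖) ^ 2) ?_
      (ae_of_all _ fun θ => ?_)
    · have hc : Continuous fun θ : Fin d → ℝ => ∑ k ∈ F, a k * character k θ :=
        continuous_finsetSum _ fun k _ => continuous_const.mul (continuous_character k)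
      exact (Complex.continuous_ofReal.comp (hc.norm.pow 2)).aestronglyMeasurable
    · rw [Complex.norm_real, norm_pow, norm_norm]
      gcongr
      refine (norm_sum_le _ _).trans_eq (Finset.sum_congr rfl fun k _ => ?_)
      rw [norm_mul, norm_character, mul_one]
  have h' : (∫ θ, ((‖∑ k ∈ F, a k * character k θ‖ ^ 2 : ℝ) : ℂ) *
      (star v ⬝ᵥ (Ψ θ *ᵥ v)) ∂(torusMeasure d)).re = ∫ θ, ‖∑ k ∈ F, a k * character k θ‖ ^ 2 *
      (star v ⬝ᵥ (Ψ θ *ᵥ v)).re ∂(torusMeasure d) := by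
    rw [← RCLike.re_eq_complex_re, ← integral_re hi]
    simp only [RCLike.re_eq_complex_re, Complex.re_ofReal_mul]
  rw [h'] at h
  exact h

/-- A square integrable Hermitian spectral density with a positive semidefinite family of Fourier
coefficients is positive semidefinite almost everywhere. -/
lemma ae_posSemidef_of_re_sum_spectralCoeff_nonneg {Ψ : (Fin d → ℝ) → Matrix ι ι ℂ}
    (hΨ : ∀ i j, MemLp (fun θ => Ψ θ i j) 2 (torusMeasure d))
    (hherm : ∀ᵐ θ ∂(torusMeasure d), (Ψ θ).IsHermitian)
    (hpos : ∀ (F : Finset (Site d)) (c : Site d → ι → ℂ), 0 ≤ (∑ s ∈ F, ∑ r ∈ F, ∑ i, ∑ j,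
      c s i * (starRingEnd ℂ) (c r j) * spectralCoeff Ψ (s - r) i j).re) :
    ∀ᵐ θ ∂(torusMeasure d), (Ψ θ).PosSemidef := by
  -- The exceptional null set depends on `v`; a countable dense set of directions leaves a single
  -- null set, and continuity in `v` covers the rest.
  have hall := ae_all_iff.2 fun n : ℕ =>
    ae_nonneg_re_star_dotProduct_mulVec hΨ hpos (TopologicalSpace.denseSeq (ι → ℂ) n)
  filter_upwards [hall, hherm] with θ hθ hH
  have hcont : Continuous fun v : ι → ℂ => (star v ⬝ᵥ (Ψ θ *ᵥ v)).re :=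
    Complex.continuous_re.comp (continuous_star.dotProduct
      (continuous_const.matrix_mulVec continuous_id))
  have hre : ∀ v : ι → ℂ, 0 ≤ (star v ⬝ᵥ (Ψ θ *ᵥ v)).re := by
    intro v
    have hcl : IsClosed {v : ι → ℂ | 0 ≤ (star v ⬝ᵥ (Ψ θ *ᵥ v)).re} :=
      isClosed_le continuous_const hcont
    have hsub : Set.range (TopologicalSpace.denseSeq (ι → ℂ)) ⊆
        {v : ι → ℂ | 0 ≤ (star v ⬝ᵥ (Ψ θ *ᵥ v)).re} := by
      rintro _ ⟨n, rfl⟩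
      exact hθ n
    exact hcl.closure_subset_iff.2 hsub (TopologicalSpace.denseRange_denseSeq _ v)
  refine PosSemidef.of_dotProduct_mulVec_nonneg hH fun v => ?_
  refine Complex.le_def.2 ⟨hre v, ?_⟩
  exact (hH.im_star_dotProduct_mulVec_self v).symm

end SpectralBounds

/-! ### Power spectral densities: square integrability and Fourier coefficients. -/

section PowerSpectralDensity

variable {d m : ℕ} {p : Measure (Site d → State m)} {Φ : (Fin d → ℝ) → Matrix (Fin m) (Fin m) ℂ}

lemma memLp_trigPoly (F : Finset (Site d)) (c : Site d → ℂ) (q : ℝ≥0∞) :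
    MemLp (fun θ => ∑ t ∈ F, c t * character t θ) q (torusMeasure d) :=
  memLp_finsetSum _ fun t _ => (memLp_character t q).const_mul _

/-- Some partial sum is at finite `L²` distance from `Φ`, and partial sums are bounded. -/
lemma IsPowerSpectralDensity.memLp (hΦ : IsPowerSpectralDensity p Φ) (i j : Fin m) :
    MemLp (fun θ => Φ θ i j) 2 (torusMeasure d) := by
  obtain ⟨F, hF⟩ := ((hΦ i j).2.eventually (gt_mem_nhds ENNReal.zero_lt_top)).exists
  have hT := memLp_trigPoly F (fun t => (covariance p t i j : ℂ)) 2
  have h : MemLp (fun θ => Φ θ i j - ∑ t ∈ F, (covariance p t i j : ℂ) * character t θ) 2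
      (torusMeasure d) := ⟨(hΦ i j).1.sub hT.1, hF⟩
  exact (h.add hT).ae_eq (ae_of_all _ fun θ => sub_add_cancel _ _)

/-- On a probability space `L²` convergence implies `L¹` convergence, so Fourier coefficients pass
to the limit; those of the partial sums are constant once `k ∈ F`. -/
lemma IsPowerSpectralDensity.spectralCoeff_apply (hΦ : IsPowerSpectralDensity p Φ) (k : Site d)
    (i j : Fin m) : spectralCoeff Φ k i j = (covariance p k i j : ℂ) := by
  classical
  set T : Finset (Site d) → (Fin d → ℝ) → ℂ :=
    fun F θ => ∑ t ∈ F, (covariance p t i j : ℂ) * character t θ with hT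
  have hTL : ∀ F, MemLp (T F) 2 (torusMeasure d) := fun F => memLp_trigPoly F _ 2
  have hlim : Tendsto (fun F => ∫ θ, T F θ * character (-k) θ ∂(torusMeasure d)) atTop
      (𝓝 (∫ θ, Φ θ i j * character (-k) θ ∂(torusMeasure d))) := by
    refine tendsto_integral_of_L1' _
      (integrable_mul_character ((hΦ.memLp i j).integrable (by norm_num)) _).aestronglyMeasurable
      (Eventually.of_forall fun F =>
        integrable_mul_character ((hTL F).integrable (by norm_num)) _) ?_
    refine tendsto_of_tendsto_of_tendsto_of_le_of_le tendsto_const_nhds (hΦ i j).2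
      (fun F => zero_le) fun F => ?_
    refine le_trans (le_of_eq ?_) (eLpNorm_le_eLpNorm_of_exponent_le
      (p := 1) (by norm_num) ((hΦ i j).1.sub (hTL F).1))
    refine eLpNorm_congr_norm_ae (ae_of_all _ fun θ => ?_)
    simp only [Pi.sub_apply, ← sub_mul]
    rw [norm_mul, norm_character, mul_one, norm_sub_rev]
  refine tendsto_nhds_unique hlim (tendsto_const_nhds.congr' ?_)
  filter_upwards [eventually_ge_atTop {k}] with F hF
  have hk : k ∈ F := hF (Finset.mem_singleton_self k)
  have e : ∀ θ, T F θ * character (-k) θ =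
      ∑ t ∈ F, (covariance p t i j : ℂ) * character (t - k) θ := by
    intro θ
    rw [hT, Finset.sum_mul]
    refine Finset.sum_congr rfl fun t _ => ?_
    rw [mul_assoc, ← character_add, sub_eq_add_neg]
  simp_rw [e]
  rw [integral_finsetSum _ fun t _ =>
    ((memLp_character (t - k) 1).integrable le_rfl).const_mul _,
    Finset.sum_eq_single_of_mem k hk]
  · rw [integral_const_mul, integral_character, if_pos (sub_self k), mul_one]
  · intro t _ ht
    rw [integral_const_mul, integral_character, if_neg (sub_ne_zero.2 ht), mul_zero]

end PowerSpectralDensity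

/-! ### Covariances as mean squares, and their shift invariance. -/

section SecondMoments

variable {Ω : Type*} [MeasurableSpace Ω] {P : Measure Ω} {A ι : Type*} [Fintype ι]

/-- The quadratic form of a covariance is a mean square. -/
lemma sum_integral_mul_eq_integral_norm_sq {X : A → ι → Ω → ℝ}
    (hX : ∀ s i, MemLp (X s i) 2 P) (F : Finset A) (c : A → ι → ℂ) :
    ∑ s ∈ F, ∑ r ∈ F, ∑ i, ∑ j, c s i * (starRingEnd ℂ) (c r j) *
      ((∫ ω, X s i ω * X r j ω ∂P : ℝ) : ℂ) =
      ((∫ ω, ‖∑ s ∈ F, ∑ i, c s i * (X s i ω : ℂ)‖ ^ 2 ∂P : ℝ) : ℂ) := by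
  have hi : ∀ s r i j, Integrable (fun ω => c s i * (starRingEnd ℂ) (c r j) *
      ((X s i ω * X r j ω : ℝ) : ℂ)) P :=
    fun s r i j => ((hX s i).integrable_mul (hX r j)).ofReal.const_mul _
  have e : ∀ ω, ((‖∑ s ∈ F, ∑ i, c s i * (X s i ω : ℂ)‖ ^ 2 : ℝ) : ℂ) =
      ∑ s ∈ F, ∑ r ∈ F, ∑ i, ∑ j, c s i * (starRingEnd ℂ) (c r j) *
        ((X s i ω * X r j ω : ℝ) : ℂ) := by
    intro ω
    rw [Complex.ofReal_pow, ← Complex.mul_conj', map_sum, Finset.sum_mul_sum]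
    refine Finset.sum_congr rfl fun s _ => Finset.sum_congr rfl fun r _ => ?_
    rw [map_sum, Finset.sum_mul_sum]
    refine Finset.sum_congr rfl fun i _ => Finset.sum_congr rfl fun j _ => ?_
    rw [map_mul, Complex.conj_ofReal, Complex.ofReal_mul]
    ring
  rw [← integral_complex_ofReal]
  simp_rw [e]
  rw [integral_finsetSum _ fun s _ => integrable_finsetSum _ fun r _ => integrable_finsetSum _
    fun i _ => integrable_finsetSum _ fun j _ => hi s r i j]
  refine Finset.sum_congr rfl fun s _ => ?_
  rw [integral_finsetSum _ fun r _ => integrable_finsetSum _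
    fun i _ => integrable_finsetSum _ fun j _ => hi s r i j]
  refine Finset.sum_congr rfl fun r _ => ?_
  rw [integral_finsetSum _ fun i _ => integrable_finsetSum _ fun j _ => hi s r i j]
  refine Finset.sum_congr rfl fun i _ => ?_
  rw [integral_finsetSum _ fun j _ => hi s r i j]
  refine Finset.sum_congr rfl fun j _ => ?_
  rw [integral_const_mul, integral_complex_ofReal]

variable {d : ℕ} {E : Type*} [NormedAddCommGroup E] [NormedSpace ℝ E] [MeasurableSpace E]
  [BorelSpace E]

lemma IsStationaryGaussian.integral_mul_eq {p : Measure (Site d → E)} (hp : IsStationaryGaussian p)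
    {f g : E → ℝ} (hf : Measurable f) (hg : Measurable g) (s r : Site d) :
    ∫ x, f (x s) * g (x r) ∂p = ∫ x, f (x (s - r)) * g (x 0) ∂p := by
  have hsm : Measurable fun (x : Site d → E) t => x (t + r) :=
    measurable_pi_lambda _ fun t => measurable_pi_apply _
  have hm : Measurable fun x : Site d → E => f (x (s - r)) * g (x 0) :=
    (hf.comp (measurable_pi_apply _)).mul (hg.comp (measurable_pi_apply _))
  conv_rhs => rw [← hp.stationary r, integral_map hsm.aemeasurable hm.aestronglyMeasurable]
  simp only [sub_add_cancel, zero_add]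

lemma IsStationaryGaussian.integral_mul_eq_covariance {m : ℕ} {p : Measure (Site d → State m)}
    (hp : IsStationaryGaussian p) (s r : Site d) (i j : Fin m) :
    ∫ x, x s i * x r j ∂p = covariance p (s - r) i j :=
  hp.integral_mul_eq (f := fun v : State m => v i) (g := fun v => v j) (by fun_prop) (by fun_prop)
    s r

end SecondMoments

/-! ### Joint spectral density and cost of a coupling. -/

section Coupling

variable {d m : ℕ} {px py : Measure (Site d → State m)}
  {π : Measure (Site d → State m × State m)} {Φx Φy M : (Fin d → ℝ) → Matrix (Fin m) (Fin m) ℂ}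

lemma IsGaussianCoupling.integral_fst_mul_fst (hπ : IsGaussianCoupling px py π)
    (hpx : IsStationaryGaussian px) (s r : Site d) (i j : Fin m) :
    ∫ ω, (ω s).1 i * (ω r).1 j ∂π = covariance px (s - r) i j := by
  have hsm : Measurable fun (ω : Site d → State m × State m) t => (ω t).1 := by fun_prop
  have hm : Measurable fun x : Site d → State m => x s i * x r j := by fun_prop
  rw [← hpx.integral_mul_eq_covariance]
  conv_rhs => rw [← hπ.marginal_fst, integral_map hsm.aemeasurable hm.aestronglyMeasurable]

lemma IsGaussianCoupling.integral_snd_mul_snd (hπ : IsGaussianCoupling px py π)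
    (hpy : IsStationaryGaussian py) (s r : Site d) (i j : Fin m) :
    ∫ ω, (ω s).2 i * (ω r).2 j ∂π = covariance py (s - r) i j := by
  have hsm : Measurable fun (ω : Site d → State m × State m) t => (ω t).2 := by fun_prop
  have hm : Measurable fun x : Site d → State m => x s i * x r j := by fun_prop
  rw [← hpy.integral_mul_eq_covariance]
  conv_rhs => rw [← hπ.marginal_snd, integral_map hsm.aemeasurable hm.aestronglyMeasurable]

lemma IsStationaryGaussian.memLp_jointCoord (hπ : IsStationaryGaussian π) (s : Site d)
    (a : Fin m ⊕ Fin m) : MemLp (fun ω => jointCoord a (ω s)) 2 π :=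
  memLp_two_eval_of_isGaussianProcess hπ.gaussian _ s

/-- The cross-covariances of a coupling are square summable. -/
lemma IsGaussianCoupling.summable_sq_cross (hπ : IsGaussianCoupling px py π)
    (hpx : IsStationaryGaussian px) (hΦx : IsPowerSpectralDensity px Φx)
    (hb : IsBoundedCoercive Φx) (i j : Fin m) :
    Summable fun k : Site d => (∫ ω, (ω k).1 i * (ω 0).2 j ∂π) ^ 2 := by
  classical
  obtain ⟨_, C, _, hC⟩ := hb
  set c : Site d → ℝ := fun k => ∫ ω, (ω k).1 i * (ω 0).2 j ∂π with hc
  set K : ℝ := ∫ ω, (ω 0).2 j ^ 2 ∂π with hK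
  -- An upper bound for `Φx` that is also at least `1`, so that it can be divided by.
  set C' : ℝ := |C| + 1 with hC'
  have hC'pos : 0 < C' := by positivity
  have hx : ∀ s i, MemLp (fun ω => (ω s).1 i) 2 π := fun s i => hπ.joint.memLp_jointCoord s (.inl i)
  have hy : MemLp (fun ω => (ω 0).2 j) 2 π := hπ.joint.memLp_jointCoord 0 (.inr j)
  refine summable_of_sum_le (c := C' * (C' * K)) (fun _ => sq_nonneg _) fun F => ?_
  -- A Bessel-type argument: for `u = ∑ c_k x_k` the spectral bound gives `E u² ≤ C' ∑ c_k²`, while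
  -- `∑ c_k² = E[u y] ≤ E u² / (2C') + C' K / 2`. The first term absorbs half of the sum, leaving `∑
  -- c_k² ≤ C' K` uniformly in `F`.
  set u : (Site d → State m × State m) → ℝ := fun ω => ∑ k ∈ F, c k * (ω k).1 i with hu
  have huL : MemLp u 2 π := memLp_finsetSum _ fun k _ => (hx k i).const_mul _
  have hu2 : ∫ ω, u ω ^ 2 ∂π ≤ C' * ∑ k ∈ F, c k ^ 2 := by
    have h1 := re_sum_spectralCoeff_le (fun i j => (hΦx.memLp i j).integrable (by norm_num))
      (hC.mono fun _ h => h.2) F fun s i' => if i' = i then (c s : ℂ) else 0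
    have e1 : ∀ s r i j, spectralCoeff Φx (s - r) i j =
        ((∫ ω, (ω s).1 i * (ω r).1 j ∂π : ℝ) : ℂ) := fun s r i j => by
      rw [hΦx.spectralCoeff_apply, hπ.integral_fst_mul_fst hpx]
    simp_rw [e1] at h1
    rw [sum_integral_mul_eq_integral_norm_sq hx, Complex.ofReal_re] at h1
    have e2 : ∀ ω : Site d → State m × State m,
        ‖∑ s ∈ F, ∑ i', (if i' = i then (c s : ℂ) else 0) * (((ω s).1 i' : ℝ) : ℂ)‖ ^ 2 =
          u ω ^ 2 := by
      intro ω
      have : ∑ s ∈ F, ∑ i', (if i' = i then (c s : ℂ) else 0) * (((ω s).1 i' : ℝ) : ℂ) =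
          ((u ω : ℝ) : ℂ) := by
        simp [hu]
      rw [this, Complex.norm_real, Real.norm_eq_abs, sq_abs]
    have e3 : ∑ s ∈ F, ∑ i', ‖(if i' = i then (c s : ℂ) else 0)‖ ^ 2 = ∑ k ∈ F, c k ^ 2 := by
      refine Finset.sum_congr rfl fun s _ => ?_
      rw [Finset.sum_eq_single_of_mem i (Finset.mem_univ i) fun i' _ h => by simp [h]]
      simp
    simp_rw [e2] at h1
    rw [e3] at h1
    refine h1.trans (mul_le_mul_of_nonneg_right ?_ (Finset.sum_nonneg fun _ _ => sq_nonneg _))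
    exact (le_abs_self C).trans (by linarith)
  have huy : ∑ k ∈ F, c k ^ 2 = ∫ ω, u ω * (ω 0).2 j ∂π := by
    have e : ∀ ω : Site d → State m × State m,
        u ω * (ω 0).2 j = ∑ k ∈ F, c k * ((ω k).1 i * (ω 0).2 j) := fun ω => by
      rw [hu, Finset.sum_mul]
      exact Finset.sum_congr rfl fun k _ => by ring
    have hi : ∀ k, Integrable (fun ω : Site d → State m × State m =>
        c k * ((ω k).1 i * (ω 0).2 j)) π := fun k => ((hx k i).integrable_mul hy).const_mul _
    simp_rw [e]
    rw [integral_finsetSum _ fun k _ => hi k]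
    refine Finset.sum_congr rfl fun k _ => ?_
    rw [integral_const_mul, sq]
  have hle : ∫ ω, u ω * (ω 0).2 j ∂π ≤
      ∫ ω, ((2 * C')⁻¹ * u ω ^ 2 + C' / 2 * (ω 0).2 j ^ 2) ∂π := by
    refine integral_mono (huL.integrable_mul hy)
      ((huL.integrable_sq.const_mul _).add (hy.integrable_sq.const_mul _)) fun ω => ?_
    have h := sq_nonneg (u ω - C' * (ω 0).2 j)
    have h2 : (2 * C')⁻¹ * u ω ^ 2 + C' / 2 * (ω 0).2 j ^ 2 - u ω * (ω 0).2 j =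
        (2 * C')⁻¹ * (u ω - C' * (ω 0).2 j) ^ 2 := by
      field_simp
      ring
    have h3 : 0 ≤ (2 * C')⁻¹ * (u ω - C' * (ω 0).2 j) ^ 2 := by positivity
    linarith
  rw [integral_add (huL.integrable_sq.const_mul _) (hy.integrable_sq.const_mul _),
    integral_const_mul, integral_const_mul, ← huy] at hle
  have h4 : (2 * C')⁻¹ * ∫ ω, u ω ^ 2 ∂π ≤ (1 / 2) * ∑ k ∈ F, c k ^ 2 := by
    refine (mul_le_mul_of_nonneg_left hu2 (by positivity)).trans_eq ?_
    field_simp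
  have hK0 : 0 ≤ K := integral_nonneg fun _ => sq_nonneg _
  have h5 : C' / 2 * K = (C' * K) / 2 := by ring
  have h6 : ∑ k ∈ F, c k ^ 2 ≤ C' * K := by
    rw [h5] at hle
    linarith
  refine h6.trans (le_mul_of_one_le_left (by positivity) ?_)
  rw [hC']
  linarith [abs_nonneg C]

/-- The joint spectral density with cross spectral density `M`. -/
noncomputable def jointDensity (Φx M Φy : (Fin d → ℝ) → Matrix (Fin m) (Fin m) ℂ)
    (θ : Fin d → ℝ) : Matrix (Fin m ⊕ Fin m) (Fin m ⊕ Fin m) ℂ :=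
  fromBlocks (Φx θ) (M θ) (M θ)ᴴ (Φy θ)

lemma spectralCoeff_jointDensity (k : Site d) :
    spectralCoeff (jointDensity Φx M Φy) k = fromBlocks (spectralCoeff Φx k) (spectralCoeff M k)
      (spectralCoeff M (-k))ᴴ (spectralCoeff Φy k) := by
  rw [← spectralCoeff_conjTranspose]
  ext (i | i) (j | j) <;> rfl

lemma memLp_jointDensity {q : ℝ≥0∞} (hx : ∀ i j, MemLp (fun θ => Φx θ i j) q (torusMeasure d))
    (hM : ∀ i j, MemLp (fun θ => M θ i j) q (torusMeasure d))
    (hy : ∀ i j, MemLp (fun θ => Φy θ i j) q (torusMeasure d)) (a b : Fin m ⊕ Fin m) :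
    MemLp (fun θ => jointDensity Φx M Φy θ a b) q (torusMeasure d) := by
  rcases a with i | i <;> rcases b with j | j
  exacts [hx i j, hM i j, (hM j i).star, hy i j]

/-- A coupling has a joint spectral density. -/
lemma IsGaussianCoupling.exists_cross_density (hπ : IsGaussianCoupling px py π)
    (hpx : IsStationaryGaussian px) (hpy : IsStationaryGaussian py)
    (hΦx : IsPowerSpectralDensity px Φx) (hΦy : IsPowerSpectralDensity py Φy)
    (hb : IsBoundedCoercive Φx) :
    ∃ M : (Fin d → ℝ) → Matrix (Fin m) (Fin m) ℂ,
      (∀ i j, MemLp (fun θ => M θ i j) 2 (torusMeasure d)) ∧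
      ∀ s r a b, ((∫ ω, jointCoord a (ω s) * jointCoord b (ω r) ∂π : ℝ) : ℂ) =
        spectralCoeff (jointDensity Φx M Φy) (s - r) a b := by
  have hex : ∀ i j : Fin m, ∃ f : (Fin d → ℝ) → ℂ, MemLp f 2 (torusMeasure d) ∧
      ∀ k, ∫ θ, f θ * character (-k) θ ∂(torusMeasure d) =
        ((∫ ω, (ω k).1 i * (ω 0).2 j ∂π : ℝ) : ℂ) := by
    intro i j
    refine exists_memLp_integral_mul_character_eq _ ?_
    simpa [Complex.norm_real, sq_abs] using hπ.summable_sq_cross hpx hΦx hb i j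
  choose f hf hfc using hex
  refine ⟨fun θ => Matrix.of fun i j => f i j θ, fun i j => hf i j, fun s r a b => ?_⟩
  have hM : ∀ k i j, spectralCoeff (fun θ => Matrix.of fun i j => f i j θ) k i j =
    ((∫ ω, (ω k).1 i * (ω 0).2 j ∂π : ℝ) : ℂ) := fun k i j => hfc i j k
  have hcross : ∀ s r (i j : Fin m), ∫ ω, (ω s).1 i * (ω r).2 j ∂π =
      ∫ ω, (ω (s - r)).1 i * (ω 0).2 j ∂π := fun s r i j =>
    hπ.joint.integral_mul_eq (f := fun v : State m × State m => v.1 i) (g := fun v => v.2 j)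
      (by fun_prop) (by fun_prop) s r
  rw [spectralCoeff_jointDensity]
  rcases a with i | i <;> rcases b with j | j
  · rw [fromBlocks_apply₁₁, hΦx.spectralCoeff_apply]
    exact congrArg _ (hπ.integral_fst_mul_fst hpx s r i j)
  · rw [fromBlocks_apply₁₂, hM]
    exact congrArg _ (hcross s r i j)
  · rw [fromBlocks_apply₂₁, conjTranspose_apply, hM, neg_sub, ← hcross, ← starRingEnd_apply,
      Complex.conj_ofReal]
    refine congrArg _ (integral_congr_ae (ae_of_all _ fun ω => mul_comm _ _))
  · rw [fromBlocks_apply₂₂, hΦy.spectralCoeff_apply]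
    exact congrArg _ (hπ.integral_snd_mul_snd hpy s r i j)

lemma isHermitian_jointDensity {θ : Fin d → ℝ} (hx : (Φx θ).IsHermitian)
    (hy : (Φy θ).IsHermitian) : (jointDensity Φx M Φy θ).IsHermitian :=
  IsHermitian.fromBlocks hx rfl hy

/-- The joint spectral density of a coupling is positive semidefinite. -/
lemma ae_posSemidef_jointDensity (hπ : IsStationaryGaussian π)
    (hΦx : ∀ i j, MemLp (fun θ => Φx θ i j) 2 (torusMeasure d))
    (hM : ∀ i j, MemLp (fun θ => M θ i j) 2 (torusMeasure d))
    (hΦy : ∀ i j, MemLp (fun θ => Φy θ i j) 2 (torusMeasure d))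
    (hx : ∀ᵐ θ ∂(torusMeasure d), (Φx θ).IsHermitian)
    (hy : ∀ᵐ θ ∂(torusMeasure d), (Φy θ).IsHermitian)
    (hcov : ∀ s r a b, ((∫ ω, jointCoord a (ω s) * jointCoord b (ω r) ∂π : ℝ) : ℂ) =
        spectralCoeff (jointDensity Φx M Φy) (s - r) a b) :
    ∀ᵐ θ ∂(torusMeasure d), (jointDensity Φx M Φy θ).PosSemidef := by
  refine ae_posSemidef_of_re_sum_spectralCoeff_nonneg (memLp_jointDensity hΦx hM hΦy) ?_
    fun F c => ?_
  · filter_upwards [hx, hy] with θ h1 h2 using isHermitian_jointDensity h1 h2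
  · simp_rw [← hcov]
    rw [sum_integral_mul_eq_integral_norm_sq hπ.memLp_jointCoord, Complex.ofReal_re]
    exact integral_nonneg fun _ => sq_nonneg _

/-- As `Hᴴ H` is Hermitian, the terms in `N` and `Nᴴ` have conjugate traces and contribute the same
real part. -/
lemma re_trace_filter (H A B N : Matrix (Fin m) (Fin m) ℂ) :
    (H * (A + B - N - Nᴴ) * Hᴴ).trace.re =
      (Hᴴ * H * A).trace.re + (Hᴴ * H * B).trace.re - 2 * (Hᴴ * H * N).trace.re := by
  have h1 : ∀ Y : Matrix (Fin m) (Fin m) ℂ, (H * Y * Hᴴ).trace = (Hᴴ * H * Y).trace := fun Y => by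
    rw [trace_mul_comm, ← Matrix.mul_assoc]
  have h2 : (Hᴴ * H * Nᴴ).trace = star (Hᴴ * H * N).trace := by
    rw [← trace_conjTranspose, conjTranspose_mul, conjTranspose_mul, conjTranspose_conjTranspose,
      trace_mul_comm]
  have h3 : (star (Hᴴ * H * N).trace).re = (Hᴴ * H * N).trace.re := Complex.conj_re _
  rw [h1, Matrix.mul_sub, Matrix.mul_sub, Matrix.mul_add, trace_sub, trace_sub, trace_add,
    Complex.sub_re, Complex.sub_re, Complex.add_re, h2, h3]
  ring

/-- The transport cost in terms of the joint spectral density. -/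
lemma transportCost_eq {h : Site d → Matrix (Fin m) (Fin m) ℝ} (hh : IsL1Filter h)
    (hπ : IsStationaryGaussian π)
    (hx : ∀ i j, Integrable (fun θ => Φx θ i j) (torusMeasure d))
    (hM : ∀ i j, Integrable (fun θ => M θ i j) (torusMeasure d))
    (hy : ∀ i j, Integrable (fun θ => Φy θ i j) (torusMeasure d))
    (hcov : ∀ s r a b, ∫ ω, jointCoord a (ω s) * jointCoord b (ω r) ∂π =
        (spectralCoeff (jointDensity Φx M Φy) (s - r) a b).re) (t : Site d) :
    (∀ᵐ ω ∂π, Summable (filterTerm h (discrepancy ω) t)) ∧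
    Integrable (fun ω => ‖filtered h (discrepancy ω) t‖ ^ 2) π ∧
    transportCost h t π = ∫ θ, ((weight h θ * Φx θ).trace.re + (weight h θ * Φy θ).trace.re -
      2 * (weight h θ * M θ).trace.re) ∂(torusMeasure d) := by
  have hJ : ∀ s a, MemLp (fun ω => jointCoord a (ω s)) 2 π := hπ.memLp_jointCoord
  have hMs : ∀ i j, Integrable (fun θ => (M θ)ᴴ i j) (torusMeasure d) := fun i j => by
    have h := memLp_one_iff_integrable.1 (memLp_one_iff_integrable.2 (hM j i)).star
    exact h
  -- The discrepancy field has density `Φx + Φy - M - Mᴴ`, in the sense that its covariances are the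
  -- real parts of the Fourier coefficients.
  have key := filtered_mean_square (P := π) (e := fun s ω => (ω s).1 - (ω s).2)
    (Ψ := fun θ => Φx θ + Φy θ - M θ - (M θ)ᴴ) hh
    (fun s => by fun_prop)
    (fun s i => (hJ s (.inl i)).sub (hJ s (.inr i)))
    (fun i j => (((hx i j).add (hy i j)).sub (hM i j)).sub (hMs i j)) (fun s r i j => ?_) t
  · refine ⟨key.1, key.2.1, key.2.2.trans (integral_congr_ae (ae_of_all _ fun θ => ?_))⟩
    exact re_trace_filter _ _ _ _
  · have e1 : ∀ ω : Site d → State m × State m,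
        ((ω s).1 - (ω s).2) i * ((ω r).1 - (ω r).2) j =
        jointCoord (.inl i) (ω s) * jointCoord (.inl j) (ω r) -
        jointCoord (.inl i) (ω s) * jointCoord (.inr j) (ω r) -
        jointCoord (.inr i) (ω s) * jointCoord (.inl j) (ω r) +
        jointCoord (.inr i) (ω s) * jointCoord (.inr j) (ω r) := by
      intro ω
      simp only [jointCoord_inl, jointCoord_inr, PiLp.sub_apply]
      ring
    have hi : ∀ a b, Integrable (fun ω => jointCoord a (ω s) * jointCoord b (ω r)) π :=
      fun a b => (hJ s a).integrable_mul (hJ r b)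
    have h1 := (hi (.inl i) (.inl j)).sub (hi (.inl i) (.inr j))
    have h2 := h1.sub (hi (.inr i) (.inl j))
    refine (integral_congr_ae (ae_of_all _ e1)).trans ((integral_add h2 (hi _ _)).trans ?_)
    rw [integral_sub' h1 (hi _ _), integral_sub' (hi _ _) (hi _ _), hcov, hcov, hcov, hcov,
      spectralCoeff_jointDensity, fromBlocks_apply₁₁, fromBlocks_apply₁₂,
      fromBlocks_apply₂₁, fromBlocks_apply₂₂, ← spectralCoeff_conjTranspose]
    rw [spectralCoeff_sub (Ψ := fun θ => Φx θ + Φy θ - M θ) (Ψ' := fun θ => (M θ)ᴴ)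
        (fun i j => ((hx i j).add (hy i j)).sub (hM i j)) hMs,
      spectralCoeff_sub (Ψ := fun θ => Φx θ + Φy θ) (fun i j => (hx i j).add (hy i j)) hM,
      spectralCoeff_add hx hy]
    simp only [Matrix.sub_apply, Matrix.add_apply, Complex.sub_re, Complex.add_re]
    ring

end Coupling

/-! ### Measurability and boundedness of matrix square roots and inverses. -/

section BoundedMatrices

variable {α : Type*} [MeasurableSpace α] {μ : Measure α} {n : Type*} [Fintype n] [DecidableEq n]
  {A B : α → Matrix n n ℂ}

open scoped Matrix.Norms.L2Operator in
lemma continuousOn_matrix_sqrt :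
    ContinuousOn (CFC.sqrt : Matrix n n ℂ → Matrix n n ℂ) {X | 0 ≤ X} :=
  CFC.continuousOn_sqrt

lemma aestronglyMeasurable_matrix {n : Type*} [Fintype n] {A : α → Matrix n n ℂ}
    (hA : ∀ i j, AEStronglyMeasurable (fun x => A x i j) μ) :
    AEStronglyMeasurable A μ := by
  classical
  have h : AEStronglyMeasurable
      (fun x => ∑ i, ∑ j, A x i j • Matrix.single i j (1 : ℂ)) μ :=
    Finset.aestronglyMeasurable_fun_sum _ fun i _ => Finset.aestronglyMeasurable_fun_sum _
      fun j _ => (hA i j).smul aestronglyMeasurable_const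
  refine h.congr (ae_of_all _ fun x => ?_)
  simp only [Matrix.smul_single, smul_eq_mul, mul_one]
  exact (Matrix.matrix_eq_sum_single (A x)).symm

lemma aestronglyMeasurable_matrix_apply {n : Type*} {A : α → Matrix n n ℂ}
    (hA : AEStronglyMeasurable A μ) (i j : n) :
    AEStronglyMeasurable (fun x => A x i j) μ :=
  (Continuous.matrix_elem continuous_id i j).comp_aestronglyMeasurable hA

/-- The square root is known to be continuous only on positive semidefinite matrices. The map `X ↦
√√(Xᴴ X)` is continuous everywhere and coincides with it there. -/
lemma aestronglyMeasurable_sqrt (hA : AEStronglyMeasurable A μ)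
    (hp : ∀ᵐ x ∂μ, (A x).PosSemidef) : AEStronglyMeasurable (fun x => CFC.sqrt (A x)) μ := by
  have hc : Continuous fun X : Matrix n n ℂ => CFC.sqrt (CFC.sqrt (Xᴴ * X)) :=
    continuousOn_matrix_sqrt.comp_continuous
      (continuousOn_matrix_sqrt.comp_continuous
        (continuous_id.matrix_conjTranspose.matrix_mul continuous_id)
        fun X => (posSemidef_conjTranspose_mul_self X).nonneg)
      fun X => (posSemidef_sqrt _).nonneg
  refine (hc.comp_aestronglyMeasurable hA).congr ?_
  filter_upwards [hp] with x hx
  rw [hx.1.eq, CFC.sqrt_mul_self _ hx.nonneg]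

/-- By Cramer's formula only the scalar inverse of the determinant has to be handled, and that is
measurable including at `0`. -/
lemma aestronglyMeasurable_inv (hA : AEStronglyMeasurable A μ) :
    AEStronglyMeasurable (fun x => (A x)⁻¹) μ := by
  simp only [Matrix.inv_def, Ring.inverse_eq_inv']
  have h1 : AEStronglyMeasurable (fun x => (A x).det⁻¹) μ :=
    ((Continuous.matrix_det continuous_id).comp_aestronglyMeasurable
      hA).aemeasurable.inv.aestronglyMeasurable
  exact h1.smul ((Continuous.matrix_adjugate continuous_id).comp_aestronglyMeasurable hA)

lemma memLp_top_mul_apply {n : Type*} [Fintype n] {A B : α → Matrix n n ℂ}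
    (hA : ∀ i j, MemLp (fun x => A x i j) ∞ μ)
    (hB : ∀ i j, MemLp (fun x => B x i j) ∞ μ) (i j : n) :
    MemLp (fun x => (A x * B x) i j) ∞ μ := by
  simp only [mul_apply]
  exact memLp_finsetSum _ fun k _ => (hB k j).mul' (hA i k)

lemma memLp_top_of_ae_trace_le (hA : AEStronglyMeasurable A μ) (hp : ∀ᵐ x ∂μ, (A x).PosSemidef)
    {C : ℝ} (hC : ∀ᵐ x ∂μ, (A x).trace.re ≤ C) (i j : n) : MemLp (fun x => A x i j) ∞ μ := by
  refine memLp_top_of_bound (aestronglyMeasurable_matrix_apply hA i j) C ?_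
  filter_upwards [hp, hC] with x h1 h2 using (norm_apply_le_re_trace h1 i j).trans h2

/-- On the diagonal of `R = √X`, `r ≤ 1 + r²` and `|R_ii|² ≤ (R²)_ii`. -/
lemma re_trace_sqrt_le {X : Matrix n n ℂ} (hX : X.PosSemidef) :
    (CFC.sqrt X).trace.re ≤ Fintype.card n + X.trace.re := by
  have hR := posSemidef_sqrt X
  have h1 : ∀ i, ((CFC.sqrt X) i i).re ≤ 1 + (X i i).re := by
    intro i
    have h := norm_sq_apply_le_re_mul_conjTranspose (CFC.sqrt X) i i
    rw [hR.1.eq, sqrt_mul_sqrt_of_posSemidef hX] at h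
    have h2 := Complex.re_le_norm (CFC.sqrt X i i)
    nlinarith [sq_nonneg (‖CFC.sqrt X i i‖ - 1), norm_nonneg (CFC.sqrt X i i)]
  simp only [trace, Matrix.diag_apply, Complex.re_sum]
  refine (Finset.sum_le_sum fun i _ => h1 i).trans_eq ?_
  rw [Finset.sum_add_distrib]
  simp

lemma memLp_top_sqrt_apply (hA : ∀ i j, MemLp (fun x => A x i j) ∞ μ)
    (hp : ∀ᵐ x ∂μ, (A x).PosSemidef) (i j : n) : MemLp (fun x => CFC.sqrt (A x) i j) ∞ μ := by
  have htr : MemLp (fun x => (A x).trace) ∞ μ := memLp_finsetSum _ fun i _ => hA i i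
  obtain ⟨C, hC⟩ : ∃ C : ℝ, ∀ᵐ x ∂μ, ‖(A x).trace‖ ≤ C :=
    ⟨_, ae_le_eLpNormEssSup.mono fun x hx => by
      have := ENNReal.toReal_mono (by simpa using htr.2.ne) hx
      simpa using this⟩
  refine memLp_top_of_ae_trace_le (C := Fintype.card n + C)
    (aestronglyMeasurable_sqrt (aestronglyMeasurable_matrix fun i j => (hA i j).1) hp)
    (ae_of_all _ fun x => posSemidef_sqrt _) ?_ i j
  filter_upwards [hp, hC] with x h1 h2
  exact (re_trace_sqrt_le h1).trans
    (add_le_add_right ((Complex.re_le_norm _).trans h2) _)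

end BoundedMatrices

/-! ### Boundedness of the densities entering the Hellinger integrand. -/

section BoundedDensities

variable {d m : ℕ} {Φ Φx Φy : (Fin d → ℝ) → Matrix (Fin m) (Fin m) ℂ}
  {h : Site d → Matrix (Fin m) (Fin m) ℝ}

lemma posSemidef_smul_one {n : Type*} [Fintype n] [DecidableEq n] {a : ℝ} (ha : 0 ≤ a) :
    ((a : ℂ) • (1 : Matrix n n ℂ)).PosSemidef :=
  PosSemidef.one.smul (Complex.zero_le_real.2 ha)

lemma IsBoundedCoercive.ae_posDef (hb : IsBoundedCoercive Φ) :
    ∀ᵐ θ ∂(torusMeasure d), (Φ θ).PosDef := by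
  obtain ⟨c, C, hc, hΦ⟩ := hb
  filter_upwards [hΦ] with θ hθ
  simpa using posDef_add_smul_one hθ.1 hc

lemma IsBoundedCoercive.memLp_top (hb : IsBoundedCoercive Φ)
    (hΦ : ∀ i j, AEStronglyMeasurable (fun θ => Φ θ i j) (torusMeasure d)) (i j : Fin m) :
    MemLp (fun θ => Φ θ i j) ∞ (torusMeasure d) := by
  have hp := hb.ae_posDef
  obtain ⟨c, C, hc, hC⟩ := hb
  refine memLp_top_of_ae_trace_le (C := C * m) (aestronglyMeasurable_matrix hΦ)
    (hp.mono fun θ h => h.posSemidef) ?_ i j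
  filter_upwards [hC] with θ hθ
  have h1 := (Complex.le_def.1 hθ.2.trace_nonneg).1
  rw [trace_sub, trace_smul, trace_one, Complex.sub_re] at h1
  simpa using h1

lemma posSemidef_weight (h : Site d → Matrix (Fin m) (Fin m) ℝ) (θ : Fin d → ℝ) :
    (weight h θ).PosSemidef := posSemidef_conjTranspose_mul_self _

lemma memLp_top_weight (hh : IsL1Filter h) (i j : Fin m) :
    MemLp (fun θ => weight h θ i j) ∞ (torusMeasure d) := by
  have hH : ∀ i j, MemLp (fun θ => frequencyResponse h θ i j) ∞ (torusMeasure d) := fun i j =>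
    memLp_top_of_bound (measurable_frequencyResponse hh i j).aestronglyMeasurable _
      (ae_of_all _ fun θ => norm_frequencyResponse_le hh θ i j)
  exact memLp_top_mul_apply (A := fun θ => (frequencyResponse h θ)ᴴ) (fun i j => (hH j i).star) hH
    i j

/-- The geometric-mean type matrix `(B^{1/2} W A W B^{1/2})^{1/2}`. -/
noncomputable def rootMatrix (W A B : Matrix (Fin m) (Fin m) ℂ) : Matrix (Fin m) (Fin m) ℂ :=
  CFC.sqrt (CFC.sqrt B * W * A * W * CFC.sqrt B)

lemma memLp_top_rootMatrix (hh : IsL1Filter h)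
    (hx : ∀ i j, MemLp (fun θ => Φx θ i j) ∞ (torusMeasure d))
    (hy : ∀ i j, MemLp (fun θ => Φy θ i j) ∞ (torusMeasure d))
    (hxp : ∀ᵐ θ ∂(torusMeasure d), (Φx θ).PosSemidef)
    (hyp : ∀ᵐ θ ∂(torusMeasure d), (Φy θ).PosSemidef) (i j : Fin m) :
    MemLp (fun θ => rootMatrix (weight h θ) (Φx θ) (Φy θ) i j) ∞ (torusMeasure d) := by
  have hW := memLp_top_weight (d := d) hh
  have hQ := memLp_top_sqrt_apply hy hyp
  refine memLp_top_sqrt_apply (memLp_top_mul_apply (memLp_top_mul_apply (memLp_top_mul_apply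
    (memLp_top_mul_apply hQ hW) hx) hW) hQ) ?_ i j
  filter_upwards [hxp] with θ hθ
  exact posSemidef_sandwich hθ (posSemidef_weight h θ).1 (posSemidef_sqrt _).1

lemma memLp_top_hellingerMatrix (hh : IsL1Filter h)
    (hx : ∀ i j, MemLp (fun θ => Φx θ i j) ∞ (torusMeasure d))
    (hy : ∀ i j, MemLp (fun θ => Φy θ i j) ∞ (torusMeasure d))
    (hxp : ∀ᵐ θ ∂(torusMeasure d), (Φx θ).PosSemidef)
    (hyp : ∀ᵐ θ ∂(torusMeasure d), (Φy θ).PosSemidef) (i j : Fin m) :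
    MemLp (fun θ => hellingerMatrix (weight h θ) (Φx θ) (Φy θ) i j) ∞ (torusMeasure d) :=
  ((memLp_top_mul_apply (memLp_top_weight hh) hx i j).add
    (memLp_top_mul_apply (memLp_top_weight hh) hy i j)).sub
    ((memLp_top_rootMatrix hh hx hy hxp hyp i j).const_mul 2)

lemma aestronglyMeasurable_nearOptimalBlock (hh : IsL1Filter h) (η : ℝ)
    (hx : ∀ i j, MemLp (fun θ => Φx θ i j) ∞ (torusMeasure d))
    (hy : ∀ i j, MemLp (fun θ => Φy θ i j) ∞ (torusMeasure d))
    (hxp : ∀ᵐ θ ∂(torusMeasure d), (Φx θ).PosSemidef)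
    (hyp : ∀ᵐ θ ∂(torusMeasure d), (Φy θ).PosSemidef) :
    AEStronglyMeasurable (fun θ => nearOptimalBlock η (weight h θ) (Φx θ) (Φy θ))
      (torusMeasure d) := by
  have hW : AEStronglyMeasurable (weight h) (torusMeasure d) :=
    aestronglyMeasurable_matrix fun i j => (memLp_top_weight hh i j).1
  have hX : AEStronglyMeasurable Φx (torusMeasure d) :=
    aestronglyMeasurable_matrix fun i j => (hx i j).1
  have hQ : AEStronglyMeasurable (fun θ => CFC.sqrt (Φy θ)) (torusMeasure d) :=
    aestronglyMeasurable_sqrt (aestronglyMeasurable_matrix fun i j => (hy i j).1) hyp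
  have hR : AEStronglyMeasurable (fun θ => rootMatrix (weight h θ) (Φx θ) (Φy θ))
      (torusMeasure d) :=
    aestronglyMeasurable_matrix fun i j => (memLp_top_rootMatrix hh hx hy hxp hyp i j).1
  exact ((hX.mul hW).mul hQ).mul
    (aestronglyMeasurable_inv (hR.add aestronglyMeasurable_const)) |>.mul hQ

/-- No bound on the inverse in `nearOptimalBlock` is needed: every entry of the positive
semidefinite block matrix is dominated by its trace `tr Φx + tr Φy`, uniformly in `η`. -/
lemma memLp_top_nearOptimalBlock (hh : IsL1Filter h) {η : ℝ} (hη : 0 < η)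
    (hx : ∀ i j, MemLp (fun θ => Φx θ i j) ∞ (torusMeasure d))
    (hy : ∀ i j, MemLp (fun θ => Φy θ i j) ∞ (torusMeasure d))
    (hxp : ∀ᵐ θ ∂(torusMeasure d), (Φx θ).PosDef)
    (hyp : ∀ᵐ θ ∂(torusMeasure d), (Φy θ).PosSemidef) (i j : Fin m) :
    MemLp (fun θ => nearOptimalBlock η (weight h θ) (Φx θ) (Φy θ) i j) ∞ (torusMeasure d) := by
  have hm : ∀ {Φ : (Fin d → ℝ) → Matrix (Fin m) (Fin m) ℂ},
      (∀ i j, MemLp (fun θ => Φ θ i j) ∞ (torusMeasure d)) →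
      MemLp (fun θ => (Φ θ).trace) ∞ (torusMeasure d) :=
    fun h => memLp_finsetSum _ fun i _ => h i i
  have hsum : MemLp (fun θ => (Φx θ).trace + (Φy θ).trace) ∞ (torusMeasure d) := (hm hx).add (hm hy)
  refine hsum.of_le (aestronglyMeasurable_matrix_apply
    (aestronglyMeasurable_nearOptimalBlock hh η hx hy (hxp.mono fun θ h => h.posSemidef) hyp) i j)
    ?_
  filter_upwards [hxp, hyp] with θ h1 h2
  have hP := posSemidef_fromBlocks_nearOptimalBlock (posSemidef_weight h θ).1 h1 h2 hη
  refine (norm_apply_le_re_trace hP (.inl i) (.inr j)).trans ?_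
  refine le_trans (le_of_eq ?_) (Complex.re_le_norm _)
  simp [trace]

end BoundedDensities

/-! ### Uniform positivity of the density and strict positivity of the kernel. -/

section StrictPositivity

variable {d m : ℕ} {Φx Φy M : (Fin d → ℝ) → Matrix (Fin m) (Fin m) ℂ}

lemma posSemidef_fromBlocks_diagonal {n : Type*} [Fintype n] [DecidableEq n] {A B : Matrix n n ℂ}
    (hA : A.PosSemidef) (hB : B.PosSemidef) : (fromBlocks A 0 0 B).PosSemidef := by
  have e : fromBlocks A 0 0 B =
      (fromBlocks (CFC.sqrt A) 0 0 (CFC.sqrt B))ᴴ * fromBlocks (CFC.sqrt A) 0 0 (CFC.sqrt B) := by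
    rw [fromBlocks_conjTranspose, (posSemidef_sqrt A).1.eq, (posSemidef_sqrt B).1.eq,
      fromBlocks_multiply]
    simp [sqrt_mul_sqrt_of_posSemidef hA, sqrt_mul_sqrt_of_posSemidef hB]
  rw [e]
  exact posSemidef_conjTranspose_mul_self _

/-- Shrinking the off-diagonal blocks makes a block matrix uniformly positive. -/
lemma posSemidef_fromBlocks_smul_sub {n : Type*} [Fintype n] [DecidableEq n] {A B N : Matrix n n ℂ}
    (hP : (fromBlocks A N Nᴴ B).PosSemidef) {c ε : ℝ} (hε : 0 ≤ ε) (hε' : ε ≤ 1)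
    (hA : (A - (c : ℂ) • (1 : Matrix n n ℂ)).PosSemidef)
    (hB : (B - (c : ℂ) • (1 : Matrix n n ℂ)).PosSemidef) :
    (fromBlocks A (((1 - ε : ℝ) : ℂ) • N) (((1 - ε : ℝ) : ℂ) • N)ᴴ B -
      ((ε * c : ℝ) : ℂ) • (1 : Matrix (n ⊕ n) (n ⊕ n) ℂ)).PosSemidef := by
  -- A convex combination: weight `1 - ε` on the given block matrix and `ε` on the block diagonal of
  -- `A - c` and `B - c`.
  have e : fromBlocks A (((1 - ε : ℝ) : ℂ) • N) (((1 - ε : ℝ) : ℂ) • N)ᴴ B -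
      ((ε * c : ℝ) : ℂ) • (1 : Matrix (n ⊕ n) (n ⊕ n) ℂ) =
      ((1 - ε : ℝ) : ℂ) • fromBlocks A N Nᴴ B + (ε : ℂ) •
        fromBlocks (A - (c : ℂ) • (1 : Matrix n n ℂ)) 0 0 (B - (c : ℂ) • (1 : Matrix n n ℂ)) := by
    rw [sub_eq_add_neg, ← fromBlocks_one, fromBlocks_smul, fromBlocks_smul, fromBlocks_smul,
      fromBlocks_neg, fromBlocks_add, fromBlocks_add, conjTranspose_smul, Complex.star_def,
      Complex.conj_ofReal]
    congr 1
    · push_cast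
      module
    · simp
    · simp
    · push_cast
      module
  rw [e]
  exact (hP.smul (Complex.zero_le_real.2 (by linarith))).add
    ((posSemidef_fromBlocks_diagonal hA hB).smul (Complex.zero_le_real.2 hε))

lemma re_spectralCoeff_symm {ι : Type*} {Ψ : (Fin d → ℝ) → Matrix ι ι ℂ}
    (hherm : ∀ᵐ θ ∂(torusMeasure d), (Ψ θ).IsHermitian) (k : Site d) (a b : ι) :
    (spectralCoeff Ψ k a b).re = (spectralCoeff Ψ (-k) b a).re := by
  have h : spectralCoeff Ψ k = (spectralCoeff Ψ (-k))ᴴ := by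
    rw [← spectralCoeff_conjTranspose]
    ext i j
    refine integral_congr_ae ?_
    filter_upwards [hherm] with θ hθ
    rw [hθ.eq]
  rw [h, conjTranspose_apply]
  exact Complex.conj_re _

/-- For real coefficients the form built from real parts is the real part of the complex form, which
is at least `a ∑ ‖c‖²`. Extending `c` by zero replaces `F` by a product set. -/
lemma sum_re_spectralCoeff_pos {ι : Type*} [Fintype ι] [DecidableEq ι]
    {Ψ : (Fin d → ℝ) → Matrix ι ι ℂ} {a : ℝ} (ha : 0 < a)
    (hΨ : ∀ i j, Integrable (fun θ => Ψ θ i j) (torusMeasure d))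
    (hpos : ∀ᵐ θ ∂(torusMeasure d), (Ψ θ - (a : ℂ) • (1 : Matrix ι ι ℂ)).PosSemidef)
    (F : Finset (Site d × ι)) (c : Site d × ι → ℝ) (hc : ∃ p ∈ F, c p ≠ 0) :
    0 < ∑ p ∈ F, ∑ q ∈ F, c p * c q * (spectralCoeff Ψ (p.1 - q.1) p.2 q.2).re := by
  classical
  set S : Finset (Site d) := F.image Prod.fst with hS
  set c' : Site d × ι → ℝ := fun p => if p ∈ F then c p else 0 with hc'
  have hFS : F ⊆ S ×ˢ Finset.univ := fun p hp =>
    Finset.mem_product.2 ⟨Finset.mem_image_of_mem _ hp, Finset.mem_univ _⟩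
  have hsum : ∀ g : Site d × ι → ℝ, ∑ p ∈ F, c p * g p = ∑ s ∈ S, ∑ i, c' (s, i) * g (s, i) := by
    intro g
    rw [← Finset.sum_product' S Finset.univ fun s i => c' (s, i) * g (s, i),
      ← Finset.sum_subset hFS fun p _ hp => by simp [hc', hp]]
    exact Finset.sum_congr rfl fun p hp => by simp [hc', hp]
  have h := le_re_sum_spectralCoeff hΨ hpos S fun s i => ((c' (s, i) : ℝ) : ℂ)
  have e1 : (∑ s ∈ S, ∑ r ∈ S, ∑ i, ∑ j, ((c' (s, i) : ℝ) : ℂ) *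
      (starRingEnd ℂ) ((c' (r, j) : ℝ) : ℂ) * spectralCoeff Ψ (s - r) i j).re =
      ∑ p ∈ F, ∑ q ∈ F, c p * c q * (spectralCoeff Ψ (p.1 - q.1) p.2 q.2).re := by
    have e2 : ∀ p, ∑ q ∈ F, c p * c q * (spectralCoeff Ψ (p.1 - q.1) p.2 q.2).re =
        c p * ∑ r ∈ S, ∑ j, c' (r, j) * (spectralCoeff Ψ (p.1 - r) p.2 j).re := fun p => by
      rw [← hsum fun q => (spectralCoeff Ψ (p.1 - q.1) p.2 q.2).re, Finset.mul_sum]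
      exact Finset.sum_congr rfl fun q _ => mul_assoc _ _ _
    simp_rw [e2]
    rw [hsum fun p => ∑ r ∈ S, ∑ j, c' (r, j) * (spectralCoeff Ψ (p.1 - r) p.2 j).re]
    simp only [Complex.re_sum, Complex.conj_ofReal, ← Complex.ofReal_mul, Complex.re_ofReal_mul,
      Finset.mul_sum]
    refine Finset.sum_congr rfl fun s _ => ?_
    rw [Finset.sum_comm]
    exact Finset.sum_congr rfl fun i _ => Finset.sum_congr rfl fun r _ =>
      Finset.sum_congr rfl fun j _ => mul_assoc _ _ _
  rw [e1] at h
  refine lt_of_lt_of_le (mul_pos ha ?_) h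
  obtain ⟨p, hp, hp0⟩ := hc
  refine Finset.sum_pos' (fun s _ => Finset.sum_nonneg fun i _ => sq_nonneg _)
    ⟨p.1, Finset.mem_image_of_mem _ hp, Finset.sum_pos' (fun i _ => sq_nonneg _)
      ⟨p.2, Finset.mem_univ _, ?_⟩⟩
  simp only [hc', hp, if_true]
  have : ‖((c p : ℝ) : ℂ)‖ ≠ 0 := by simpa using hp0
  positivity

end StrictPositivity

/-! ### Realising a joint density by a Gaussian coupling. -/

section Construction

variable {d m : ℕ} {px py : Measure (Site d → State m)}
  {Φx Φy M : (Fin d → ℝ) → Matrix (Fin m) (Fin m) ℂ}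

/-- A field with the covariance of `p`, obtained from a joint field by a linear map, has law `p`. -/
lemma map_eq_of_covariance {p : Measure (Site d → State m)} (hp : IsStationaryGaussian p)
    {π : Measure (Site d → State m × State m)} (hπ : IsStationaryGaussian π)
    (L : State m × State m →L[ℝ] State m)
    (hcov : ∀ s r i j, ∫ ω, L (ω s) i * L (ω r) j ∂π = covariance p (s - r) i j) :
    π.map (fun ω t => L (ω t)) = p := by
  have hsm : Measurable fun (ω : Site d → State m × State m) t => L (ω t) :=
    measurable_pi_lambda _ fun t => L.measurable.comp (measurable_pi_apply t)
  have hG : IsGaussianProcess (fun (t : Site d) (x : Site d → State m) => x t)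
      (π.map (fun ω t => L (ω t))) := by
    have hL : IsGaussianProcess (fun (t : Site d) (ω : Site d → State m × State m) => L (ω t)) π :=
      hπ.gaussian.comp_left (fun _ => L)
    refine ⟨fun I => ⟨?_⟩⟩
    rw [Measure.map_map (Finset.measurable_restrict I) hsm]
    exact (hL.hasGaussianLaw I).isGaussian_map
  refine measure_eq_of_isGaussianProcess stateCoord exists_stateCoord_expansion hG hp.gaussian
    (fun t i => ?_) (fun t i => ?_) fun s t i j => ?_
  · have hm : Measurable fun x : Site d → State m => stateCoord i (x t) :=
      (stateCoord i).measurable.comp (measurable_pi_apply t)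
    rw [integral_map hsm.aemeasurable hm.aestronglyMeasurable]
    refine (ContinuousLinearMap.integral_comp_comm (stateCoord i ∘L L)
      (hπ.gaussian.hasGaussianLaw_eval t).integrable).trans ?_
    rw [hπ.zero_mean, map_zero]
  · rw [ContinuousLinearMap.integral_comp_comm _
      (hp.gaussian.hasGaussianLaw_eval t).integrable, hp.zero_mean, map_zero]
  · have hm : Measurable fun x : Site d → State m => stateCoord i (x s) * stateCoord j (x t) :=
      ((stateCoord i).measurable.comp (measurable_pi_apply s)).mul
        ((stateCoord j).measurable.comp (measurable_pi_apply t))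
    rw [integral_map hsm.aemeasurable hm.aestronglyMeasurable]
    exact (hcov s t i j).trans (hp.integral_mul_eq_covariance s t i j).symm

/-- A uniformly positive joint spectral density is realized by a Gaussian coupling. -/
lemma exists_isGaussianCoupling (hpx : IsStationaryGaussian px) (hpy : IsStationaryGaussian py)
    (hΦx : IsPowerSpectralDensity px Φx) (hΦy : IsPowerSpectralDensity py Φy)
    (hM : ∀ i j, Integrable (fun θ => M θ i j) (torusMeasure d)) {a : ℝ} (ha : 0 < a)
    (hx : ∀ᵐ θ ∂(torusMeasure d), (Φx θ).IsHermitian)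
    (hy : ∀ᵐ θ ∂(torusMeasure d), (Φy θ).IsHermitian)
    (hpos : ∀ᵐ θ ∂(torusMeasure d), (jointDensity Φx M Φy θ -
      (a : ℂ) • (1 : Matrix (Fin m ⊕ Fin m) (Fin m ⊕ Fin m) ℂ)).PosSemidef) :
    ∃ π, IsGaussianCoupling px py π ∧ HasFiniteDimDensities π ∧
      ∀ s r a b, ∫ ω, jointCoord a (ω s) * jointCoord b (ω r) ∂π =
        (spectralCoeff (jointDensity Φx M Φy) (s - r) a b).re := by
  have hJ : ∀ a b, Integrable (fun θ => jointDensity Φx M Φy θ a b) (torusMeasure d) :=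
    fun a b => memLp_one_iff_integrable.1 (memLp_jointDensity
      (fun i j => (hΦx.memLp i j).mono_exponent (by norm_num))
      (fun i j => memLp_one_iff_integrable.2 (hM i j))
      (fun i j => (hΦy.memLp i j).mono_exponent (by norm_num)) a b)
  have hJh : ∀ᵐ θ ∂(torusMeasure d), (jointDensity Φx M Φy θ).IsHermitian := by
    filter_upwards [hx, hy] with θ h1 h2 using isHermitian_jointDensity h1 h2
  -- The real part makes the kernel real whatever `M` is. It leaves the marginals unchanged, because
  -- the coefficients of `Φx` and `Φy` are already real covariances.
  obtain ⟨π, hπ, hπd, hπc⟩ := exists_isStationaryGaussian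
    (fun p q => (spectralCoeff (jointDensity Φx M Φy) (p.1 - q.1) p.2 q.2).re)
    (fun p q => by rw [re_spectralCoeff_symm hJh, neg_sub])
    (fun F c hc => sum_re_spectralCoeff_pos ha hJ hpos F c hc)
    (fun s t u a b => by simp only [add_sub_add_right_eq_sub])
  refine ⟨π, ⟨hπ, ?_, ?_⟩, hπd, hπc⟩
  · refine map_eq_of_covariance hpx hπ (ContinuousLinearMap.fst ℝ _ _) fun s r i j => ?_
    refine (hπc s r (.inl i) (.inl j)).trans ?_
    rw [spectralCoeff_jointDensity, fromBlocks_apply₁₁, hΦx.spectralCoeff_apply, Complex.ofReal_re]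
  · refine map_eq_of_covariance hpy hπ (ContinuousLinearMap.snd ℝ _ _) fun s r i j => ?_
    refine (hπc s r (.inr i) (.inr j)).trans ?_
    rw [spectralCoeff_jointDensity, fromBlocks_apply₂₂, hΦy.spectralCoeff_apply, Complex.ofReal_re]

end Construction

/-! ### Lower bound for every coupling and near-optimal couplings. -/

section OptimalCost

variable {d m : ℕ} {px py : Measure (Site d → State m)}
  {Φx Φy M : (Fin d → ℝ) → Matrix (Fin m) (Fin m) ℂ} {h : Site d → Matrix (Fin m) (Fin m) ℝ}

lemma integrable_of_memLp_top {f : (Fin d → ℝ) → ℂ} (hf : MemLp f ∞ (torusMeasure d)) :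
    Integrable f (torusMeasure d) := hf.integrable le_top

lemma integrable_re_trace {A : (Fin d → ℝ) → Matrix (Fin m) (Fin m) ℂ}
    (hA : ∀ i j, Integrable (fun θ => A θ i j) (torusMeasure d)) :
    Integrable (fun θ => (A θ).trace.re) (torusMeasure d) :=
  Integrable.re (𝕜 := ℂ) (integrable_finsetSum _ fun i _ => hA i i)

lemma integrable_weight_mul_apply (hh : IsL1Filter h)
    (hM : ∀ i j, Integrable (fun θ => M θ i j) (torusMeasure d)) (i j : Fin m) :
    Integrable (fun θ => (weight h θ * M θ) i j) (torusMeasure d) := by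
  simp only [mul_apply]
  refine integrable_finsetSum _ fun k _ => memLp_one_iff_integrable.1 ?_
  exact (memLp_one_iff_integrable.2 (hM k j)).mul' (memLp_top_weight hh i k)

/-- The trace of the integrand of the weighted Hellinger distance. -/
noncomputable def hellingerDensity (h : Site d → Matrix (Fin m) (Fin m) ℝ)
    (Φx Φy : (Fin d → ℝ) → Matrix (Fin m) (Fin m) ℂ) (θ : Fin d → ℝ) : ℝ :=
  (weight h θ * Φx θ).trace.re + (weight h θ * Φy θ).trace.re -
    2 * (rootMatrix (weight h θ) (Φx θ) (Φy θ)).trace.re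

/-- The three traces involved are nonnegative, hence real, although `W A` itself need not be
Hermitian. -/
lemma trace_hellingerMatrix_eq {θ : Fin d → ℝ} (hx : (Φx θ).PosSemidef) (hy : (Φy θ).PosSemidef) :
    (hellingerMatrix (weight h θ) (Φx θ) (Φy θ)).trace = (hellingerDensity h Φx Φy θ : ℂ) := by
  have e : ∀ {z : ℂ}, 0 ≤ z → z = ((z.re : ℝ) : ℂ) := fun hz =>
    Complex.ext rfl (Complex.le_def.1 hz).2.symm
  have h1 := e (trace_mul_nonneg_of_posSemidef (posSemidef_weight h θ) hx)
  have h2 := e (trace_mul_nonneg_of_posSemidef (posSemidef_weight h θ) hy)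
  have h3 := e (posSemidef_sqrt (CFC.sqrt (Φy θ) * weight h θ * Φx θ * weight h θ *
    CFC.sqrt (Φy θ))).trace_nonneg
  rw [hellingerMatrix, trace_sub, trace_add, trace_smul, h1, h2, h3, smul_eq_mul]
  simp only [hellingerDensity, rootMatrix]
  push_cast
  ring

lemma weightedHellingerSq_eq_integral
    (hi : ∀ i j, Integrable (fun θ => hellingerMatrix (weight h θ) (Φx θ) (Φy θ) i j)
      (torusMeasure d))
    (hx : ∀ᵐ θ ∂(torusMeasure d), (Φx θ).PosSemidef)
    (hy : ∀ᵐ θ ∂(torusMeasure d), (Φy θ).PosSemidef) :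
    ((∫ θ, hellingerDensity h Φx Φy θ ∂(torusMeasure d) : ℝ) : ℂ) =
      weightedHellingerSq (weight h) Φx Φy := by
  rw [← integral_complex_ofReal, weightedHellingerSq, trace]
  simp only [Matrix.diag_apply, Matrix.of_apply]
  rw [← integral_finsetSum _ fun i _ => hi i i]
  refine integral_congr_ae ?_
  filter_upwards [hx, hy] with θ h1 h2 using (trace_hellingerMatrix_eq h1 h2).symm

/-- The lower bound: the joint density of the coupling satisfies the pointwise trace inequality at
almost every frequency, and this is integrated. -/
lemma integral_hellingerDensity_le_transportCost (hpx : IsStationaryGaussian px)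
    (hpy : IsStationaryGaussian py) (hΦx : IsPowerSpectralDensity px Φx)
    (hΦy : IsPowerSpectralDensity py Φy) (hbx : IsBoundedCoercive Φx) (hby : IsBoundedCoercive Φy)
    (hh : IsL1Filter h) (t : Site d) {π : Measure (Site d → State m × State m)}
    (hπ : IsGaussianCoupling px py π) :
    (∀ᵐ ω ∂π, Summable (filterTerm h (discrepancy ω) t)) ∧
    Integrable (fun ω => ‖filtered h (discrepancy ω) t‖ ^ 2) π ∧
    ∫ θ, hellingerDensity h Φx Φy θ ∂(torusMeasure d) ≤ transportCost h t π := by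
  obtain ⟨M, hM, hcov⟩ := hπ.exists_cross_density hpx hpy hΦx hΦy hbx
  have hx : ∀ i j, Integrable (fun θ => Φx θ i j) (torusMeasure d) := fun i j =>
    (hΦx.memLp i j).integrable (by norm_num)
  have hy : ∀ i j, Integrable (fun θ => Φy θ i j) (torusMeasure d) := fun i j =>
    (hΦy.memLp i j).integrable (by norm_num)
  have hMi : ∀ i j, Integrable (fun θ => M θ i j) (torusMeasure d) := fun i j =>
    (hM i j).integrable (by norm_num)
  have hP := ae_posSemidef_jointDensity hπ.joint hΦx.memLp hM hΦy.memLp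
    (hbx.ae_posDef.mono fun _ h => h.1) (hby.ae_posDef.mono fun _ h => h.1) hcov
  obtain ⟨h1, h2, h3⟩ := transportCost_eq hh hπ.joint hx hMi hy
    (fun s r a b => by rw [← hcov, Complex.ofReal_re]) t
  refine ⟨h1, h2, ?_⟩
  rw [h3]
  have hr := memLp_top_rootMatrix hh (hbx.memLp_top fun i j => (hΦx i j).1)
    (hby.memLp_top fun i j => (hΦy i j).1) (hbx.ae_posDef.mono fun _ h => h.posSemidef)
    (hby.ae_posDef.mono fun _ h => h.posSemidef)
  have hxy := (integrable_re_trace (integrable_weight_mul_apply hh hx)).add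
    (integrable_re_trace (integrable_weight_mul_apply hh hy))
  refine integral_mono_ae (hxy.sub ((integrable_re_trace fun i j =>
    integrable_of_memLp_top (hr i j)).const_mul 2)) (hxy.sub ((integrable_re_trace
    (integrable_weight_mul_apply hh hMi)).const_mul 2)) ?_
  filter_upwards [hP, hby.ae_posDef] with θ hθ hθy
  have := re_trace_mul_le_re_trace_sqrt (posSemidef_weight h θ).1 hθy hθ
  simp only [hellingerDensity, rootMatrix]
  linarith

/-- The upper bound: the cross density is `(1 - η)` times the near-optimal block, the shrinking
being what provides finite-dimensional densities. -/
lemma exists_transportCost_le (hpx : IsStationaryGaussian px)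
    (hpy : IsStationaryGaussian py) (hΦx : IsPowerSpectralDensity px Φx)
    (hΦy : IsPowerSpectralDensity py Φy) (hbx : IsBoundedCoercive Φx) (hby : IsBoundedCoercive Φy)
    (hh : IsL1Filter h) (t : Site d) :
    ∃ K : ℝ, 0 ≤ K ∧ ∀ η : ℝ, 0 < η → η < 1 → ∃ π, IsGaussianCoupling px py π ∧
      HasFiniteDimDensities π ∧
      transportCost h t π ≤ ∫ θ, hellingerDensity h Φx Φy θ ∂(torusMeasure d) + η * K := by
  have hx : ∀ i j, Integrable (fun θ => Φx θ i j) (torusMeasure d) := fun i j =>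
    (hΦx.memLp i j).integrable (by norm_num)
  have hy : ∀ i j, Integrable (fun θ => Φy θ i j) (torusMeasure d) := fun i j =>
    (hΦy.memLp i j).integrable (by norm_num)
  have hxt := hbx.memLp_top fun i j => (hΦx i j).1
  have hyt := hby.memLp_top fun i j => (hΦy i j).1
  have hxd := hbx.ae_posDef
  have hyd := hby.ae_posDef
  have hri := integrable_re_trace fun i j => integrable_of_memLp_top
    (memLp_top_rootMatrix hh hxt hyt (hxd.mono fun _ h => h.posSemidef)
      (hyd.mono fun _ h => h.posSemidef) i j)
  have hxy := (integrable_re_trace (integrable_weight_mul_apply hh hx)).add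
    (integrable_re_trace (integrable_weight_mul_apply hh hy))
  have hdi : Integrable (hellingerDensity h Φx Φy) (torusMeasure d) := hxy.sub (hri.const_mul 2)
  have hr0 : ∀ θ, 0 ≤ (rootMatrix (weight h θ) (Φx θ) (Φy θ)).trace.re := fun θ =>
    (Complex.le_def.1 (posSemidef_sqrt _).trace_nonneg).1
  obtain ⟨cx, _, hcx, hcx'⟩ := hbx
  obtain ⟨cy, _, hcy, hcy'⟩ := hby
  -- From `tr R - η m ≤ Re tr(WN) ≤ tr R` one gets `-2(1 - η) Re tr(WN) ≤ -2 tr R + η (2m + 2 tr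
  -- R)`; integrating the excess gives `K`.
  refine ⟨2 * m + 2 * ∫ θ, (rootMatrix (weight h θ) (Φx θ) (Φy θ)).trace.re ∂(torusMeasure d),
    add_nonneg (by positivity) (mul_nonneg two_pos.le (integral_nonneg hr0)),
    fun η hη hη1 => ?_⟩
  set N : (Fin d → ℝ) → Matrix (Fin m) (Fin m) ℂ :=
    fun θ => nearOptimalBlock η (weight h θ) (Φx θ) (Φy θ) with hN
  have hNi : ∀ i j, Integrable (fun θ => N θ i j) (torusMeasure d) := fun i j =>
    integrable_of_memLp_top (memLp_top_nearOptimalBlock hh hη hxt hyt hxd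
      (hyd.mono fun _ h => h.posSemidef) i j)
  have hMi : ∀ i j, Integrable (fun θ => (((1 - η : ℝ) : ℂ) • N θ) i j) (torusMeasure d) :=
    fun i j => (hNi i j).const_mul _
  have hP : ∀ᵐ θ ∂(torusMeasure d),
      (fromBlocks (Φx θ) (N θ) (N θ)ᴴ (Φy θ)).PosSemidef := by
    filter_upwards [hxd, hyd] with θ h1 h2
    exact posSemidef_fromBlocks_nearOptimalBlock (posSemidef_weight h θ).1 h1 h2.posSemidef hη
  -- Replaces the two coercivity constants by their minimum, so that both diagonal blocks share one
  -- lower bound.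
  have hc : ∀ {A : Matrix (Fin m) (Fin m) ℂ} {c : ℝ}, min cx cy ≤ c →
      (A - (c : ℂ) • (1 : Matrix (Fin m) (Fin m) ℂ)).PosSemidef →
      (A - ((min cx cy : ℝ) : ℂ) • (1 : Matrix (Fin m) (Fin m) ℂ)).PosSemidef := by
    intro A c hle hA
    have e := hA.add (posSemidef_smul_one (n := Fin m) (sub_nonneg.2 hle))
    rw [Complex.ofReal_sub, sub_smul] at e
    simpa using e
  obtain ⟨π, hπ, hπd, hπc⟩ := exists_isGaussianCoupling
    (M := fun θ => ((1 - η : ℝ) : ℂ) • N θ) (a := η * min cx cy) hpx hpy hΦx hΦy hMi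
    (mul_pos hη (lt_min hcx hcy)) (hxd.mono fun _ h => h.1) (hyd.mono fun _ h => h.1) (by
      filter_upwards [hP, hcx', hcy'] with θ h1 h2 h3
      exact posSemidef_fromBlocks_smul_sub h1 hη.le hη1.le (hc (min_le_left _ _) h2.1)
        (hc (min_le_right _ _) h3.1))
  refine ⟨π, hπ, hπd, ?_⟩
  rw [(transportCost_eq hh hπ.joint hx hMi hy hπc t).2.2]
  have hb : ∫ θ, hellingerDensity h Φx Φy θ ∂(torusMeasure d) + η * (2 * m + 2 * ∫ θ,
      (rootMatrix (weight h θ) (Φx θ) (Φy θ)).trace.re ∂(torusMeasure d)) =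
      ∫ θ, (hellingerDensity h Φx Φy θ + (η * (2 * m) +
        η * 2 * (rootMatrix (weight h θ) (Φx θ) (Φy θ)).trace.re)) ∂(torusMeasure d) := by
    have hci : Integrable (fun θ => η * (2 * m) +
        η * 2 * (rootMatrix (weight h θ) (Φx θ) (Φy θ)).trace.re) (torusMeasure d) :=
      (integrable_const _).add (hri.const_mul _)
    rw [integral_add hdi hci, integral_add (integrable_const _) (hri.const_mul _),
      integral_const, probReal_univ, one_smul, integral_const_mul]
    ring
  rw [hb]
  refine integral_mono_ae (hxy.sub ((integrable_re_trace
    (integrable_weight_mul_apply hh hMi)).const_mul 2))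
    (hdi.add ((integrable_const _).add (hri.const_mul _))) ?_
  filter_upwards [hP, hxd, hyd] with θ h1 h2 h3
  have hup := re_trace_mul_le_re_trace_sqrt (posSemidef_weight h θ).1 h3 h1
  have hlo := re_trace_sqrt_sub_le_re_trace_nearOptimalBlock (B := Φy θ)
    (posSemidef_weight h θ).1 h2.posSemidef hη
  rw [Fintype.card_fin] at hlo
  have e : (weight h θ * ((1 - η : ℝ) : ℂ) • N θ).trace.re =
      (1 - η) * (weight h θ * N θ).trace.re := by
    rw [Matrix.mul_smul, trace_smul, smul_eq_mul, Complex.re_ofReal_mul]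
  simp only [hellingerDensity, rootMatrix]
  rw [e]
  have h4 := mul_le_mul_of_nonneg_left hup hη.le
  simp only [hN] at h4 ⊢
  linarith

end OptimalCost

end GaussianField

/-! ### Conclusion: both infima equal the Hellinger integral. -/

theorem proposition2 {d m : ℕ}
    (px py : Measure (Site d → State m))
    (hpx : IsStationaryGaussian px)
    (hpy : IsStationaryGaussian py)
    (Φx Φy : (Fin d → ℝ) → Matrix (Fin m) (Fin m) ℂ)
    (hΦx : IsPowerSpectralDensity px Φx)
    (hΦy : IsPowerSpectralDensity py Φy)
    (hΦx_bc : IsBoundedCoercive Φx)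
    (hΦy_bc : IsBoundedCoercive Φy)
    (h : Site d → Matrix (Fin m) (Fin m) ℝ)
    (hh : IsL1Filter h)
    (t : Site d) :
    -- the cost of every coupling is a well defined, finite expectation
    (∀ π, IsGaussianCoupling px py π →
      (∀ᵐ ω ∂π, Summable (filterTerm h (discrepancy ω) t)) ∧
      Integrable
        (fun ω => ‖filtered h (discrepancy ω) t‖ ^ 2) π) ∧
    -- the integrand of the weighted Hellinger distance is integrable
    (∀ i j, Integrable
      (fun θ => hellingerMatrix (weight h θ) (Φx θ) (Φy θ) i j)
      (torusMeasure d)) ∧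
    ∃ D : ℝ,
      (D : ℂ) = weightedHellingerSq (weight h) Φx Φy ∧
      -- `D` is the infimum of the cost over all Gaussian couplings, ...
      IsGLB (transportCost h t '' {π | IsGaussianCoupling px py π}) D ∧
      -- ... and also over those with finite dimensional probability density functions
      IsGLB (transportCost h t ''
        {π | IsGaussianCoupling px py π ∧
          HasFiniteDimDensities π}) D := by
  have hx : ∀ᵐ θ ∂(torusMeasure d), (Φx θ).PosSemidef :=
    hΦx_bc.ae_posDef.mono fun _ h => h.posSemidef
  have hy : ∀ᵐ θ ∂(torusMeasure d), (Φy θ).PosSemidef :=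
    hΦy_bc.ae_posDef.mono fun _ h => h.posSemidef
  have hlow := fun π (hπ : IsGaussianCoupling px py π) =>
    integral_hellingerDensity_le_transportCost hpx hpy hΦx hΦy hΦx_bc hΦy_bc hh t hπ
  have hint : ∀ i j, Integrable (fun θ => hellingerMatrix (weight h θ) (Φx θ) (Φy θ) i j)
      (torusMeasure d) := fun i j => integrable_of_memLp_top
    (memLp_top_hellingerMatrix hh (hΦx_bc.memLp_top fun i j => (hΦx i j).1)
      (hΦy_bc.memLp_top fun i j => (hΦy i j).1) hx hy i j)
  obtain ⟨K, hK, hup⟩ := exists_transportCost_le hpx hpy hΦx hΦy hΦx_bc hΦy_bc hh t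
  -- A lower bound over the smaller class of couplings with densities already lies below the
  -- integral, so this settles both infima.
  have hglb : ∀ b : ℝ, (∀ π, IsGaussianCoupling px py π → HasFiniteDimDensities π →
      b ≤ transportCost h t π) → b ≤ ∫ θ, hellingerDensity h Φx Φy θ ∂(torusMeasure d) := by
    intro b hb
    refine le_of_forall_pos_le_add fun ε hε => ?_
    -- The `K + 1` avoids division by zero when `K = 0`, and `1 / 2` keeps the parameter below `1`.
    obtain ⟨π, hπ, hπd, hle⟩ := hup (min (ε / (K + 1)) (1 / 2)) (by positivity)
      (by linarith [min_le_right (ε / (K + 1)) (1 / 2)])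
    refine (hb π hπ hπd).trans (hle.trans (add_le_add_right ?_ _))
    calc min (ε / (K + 1)) (1 / 2) * K ≤ ε / (K + 1) * (K + 1) :=
          mul_le_mul (min_le_left _ _) (by linarith) hK (by positivity)
      _ = ε := div_mul_cancel₀ _ (by positivity)
  refine ⟨fun π hπ => ⟨(hlow π hπ).1, (hlow π hπ).2.1⟩, hint,
    ∫ θ, hellingerDensity h Φx Φy θ ∂(torusMeasure d),
    weightedHellingerSq_eq_integral hint hx hy, ⟨?_, fun b hb => hglb b fun π hπ _ => ?_⟩,
    ⟨?_, fun b hb => hglb b fun π hπ hπd => ?_⟩⟩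
  · rintro _ ⟨π, hπ, rfl⟩
    exact (hlow π hπ).2.2
  · exact hb ⟨π, hπ, rfl⟩
  · rintro _ ⟨π, hπ, rfl⟩
    exact (hlow π hπ.1).2.2
  · exact hb ⟨π, ⟨hπ, hπd⟩, rfl⟩
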